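/- Let $W_1$ be either the continuous-time simple random walk on $\mathbb{Z}$ (the undirected case) or the Poisson process (the directed case), started from $0$ and jumping at rate $1/k$. For $t \ge 0$ let $\nu_t$ be the law of $W_1(t)$, and let $Q_1(t) := -\log \nu_t(W_1(t))$; this is a square-integrable random variable, and $\mathbb{E}[Q_1(t)]$ is the entropy of $W_1(t)$. For $k, n \in \mathbb{N}$ and $\alpha \in \mathbb{R}$, let the cutoff time $t_\alpha = t_\alpha(k,n) \ge 0$ be defined by $$ \mathbb{E}[Q_1(t_\alpha)] = \bigl(\log n + \alpha \sqrt{v k}\bigr)/k, \qquad v := \mathrm{Var}(Q_1(t_0)), $$ where $t_0 = t_0(k,n)$, the entropic time, is given by $\mathbb{E}[Q_1(t_0)] = (\log n)/k$. Consider sequences $k = k_N$, $n = n_N$ of positive integers, and write $a \eqsim b$ if $a = b\,(1+o(1))$ and $a \ll b$ if $a = o(b)$, as $N \to \infty$. There are continuous functions $f, g : (0,\infty) \to (0,\infty)$, one pair for each of the two cases, with $f$ not the same function in the two cases and $g$ not the same function in the two cases, such that the following holds in each case whenever $1 \ll \log k \ll \log n$. For every $\alpha \in \mathbb{R}$, for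 all large $N$ the defining equation of $t_\alpha$ has exactly one solution in $[0,\infty)$, and $t_\alpha \eqsim t_0$. Moreover: * if $k \ll \log n$, then $t_0 \eqsim k\, n^{2/k}/(2\pi e)$ and $t_\alpha - t_0 \eqsim \sqrt{2}\, \alpha t_0/\sqrt{k}$; * if $k \eqsim \lambda \log n$ with $\lambda \in (0,\infty)$, then $t_0 \eqsim k\, f(\lambda)$ and $t_\alpha - t_0 \eqsim g(\lambda)\, \alpha t_0/\sqrt{k}$; * if $k \gg \log n$, then, with $\kappa := k/\log n$, $t_0 \eqsim k/(\kappa \log \kappa)$ and $t_\alpha - t_0 \eqsim \sqrt{\kappa \log \kappa}\, \alpha t_0/\sqrt{k}$. -/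

import Mathlib

open MeasureTheory ProbabilityTheory Filter Asymptotics Set

namespace EntropicTimes

/-- The two cases: the simple random walk on `ℤ` (undirected) and the Poisson process (directed). -/
inductive WalkCase
  | undirected
  | directed

/-- Law of a single jump: uniform on `{1, -1}` for the simple random walk, and `1` for the
Poisson process. -/
noncomputable def jumpLaw : WalkCase → Measure ℤ
  | .undirected => (2⁻¹ : ENNReal) • Measure.dirac 1 + (2⁻¹ : ENNReal) • Measure.dirac (-1)
  | .directed => Measure.dirac 1

/-- Law of the sum of `m` independent jumps. -/
noncomputable def stepLaw (c : WalkCase) : ℕ → Measure ℤ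
  | 0 => Measure.dirac 0
  | m + 1 => (stepLaw c m).conv (jumpLaw c)

/-- The law `ν_t` of `W₁(t)`, where `W₁` is started from `0` and jumps at rate `1 / k`:
the number of jumps by time `t ≥ 0` is Poisson with mean `t / k`. -/
noncomputable def coordLaw (c : WalkCase) (k : ℕ) (t : ℝ) : Measure ℤ :=
  (poissonMeasure (t / k).toNNReal).bind (stepLaw c)

/-- `Q₁(t) = - log ν_t(W₁(t))`, as a function of the value `x` of `W₁(t)`. -/
noncomputable def infoContent (c : WalkCase) (k : ℕ) (t : ℝ) (x : ℤ) : ℝ :=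
  - Real.log ((coordLaw c k t).real {x})

/-- `E[Q₁(t)]`, the entropy of `W₁(t)`. -/
noncomputable def meanInfo (c : WalkCase) (k : ℕ) (t : ℝ) : ℝ :=
  ∫ x, infoContent c k t x ∂(coordLaw c k t)

/-- `Var(Q₁(t))`. -/
noncomputable def varInfo (c : WalkCase) (k : ℕ) (t : ℝ) : ℝ :=
  variance (infoContent c k t) (coordLaw c k t)

/-- The entropic time `t₀(k, n)`: the time `t ≥ 0` at which `E[Q₁(t)] = (log n) / k`. -/
noncomputable def entropicTime (c : WalkCase) (k n : ℕ) : ℝ :=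
  sInf {t : ℝ | 0 ≤ t ∧ meanInfo c k t = Real.log n / k}

/-- The defining equation of `t_α(k, n)`:
`t ≥ 0` and `E[Q₁(t)] = (log n + α √(v k)) / k` with `v = Var(Q₁(t₀))`. -/
def IsCutoffTime (c : WalkCase) (k n : ℕ) (α t : ℝ) : Prop :=
  0 ≤ t ∧ meanInfo c k t =
    (Real.log n + α * √(varInfo c k (entropicTime c k n) * k)) / k

/-- The cutoff time `t_α(k, n)`: the time that satisfies the defining equation. -/
noncomputable def cutoffTime (c : WalkCase) (k n : ℕ) (α : ℝ) : ℝ :=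
  sInf {t : ℝ | IsCutoffTime c k n α t}

end EntropicTimes

open EntropicTimes

/-!
Everything is reduced to the rate-one walk at time `s = t / k`, with entropy `H(s)` and varentropy
`V(s)` given by sums over `ℤ` (`meanInfo_eq`, `varInfo_eq`). The entropy increases strictly from `0`
to infinity (`entropyDeriv_pos`, `tendsto_entropy_atTop`), so the defining equations of the entropic
and cutoff times become `H(s₀) = log n / k` and `H(s_α) = H(s₀) + α √(V(s₀) / k)`, each with at most
one solution.

To first order `s_α - s₀ = α √(V(s₀) / k) / H'(s₀)`, that is, `(s_α - s₀) / s₀ = α G(s₀) / √k` with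
the window scale `G(s) = √V(s) / (s H'(s))`. By the mean value theorem this is legitimate as soon as
`G(s₀) / √k → 0` and `s H'(s)` is slowly varying (`tendsto_entropySlope_ratio`,
`exists_entropyInv_add_expansion`). Since `s₀` may oscillate between large, bounded and small
values, such statements are proved along ultrafilters, where one of the three cases occurs
(`ultrafilter_trichotomy`). In the last case the condition `log k ≪ log n` is used: it says that
`k s₀ → ∞` (`tendsto_mul_unitEntropicTime`), while `G(s) ∼ 1 / √s`.

What remains are the asymptotics of `H`, `H'` and `V` at both ends.

At small times the walk has made no jump, or one jump, up to an event of probability `O(s²)`, which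
gives `H(s) = s log (1 / s) + (1 + h) s + o(s)`, where `h` is the entropy of a single jump: `log 2`
for the simple random walk and `0` for the Poisson process (`tendsto_entropy_small`,
`tendsto_entropyDeriv_small`, `tendsto_varentropy_small`).

At large times both walks behave like a Gaussian of variance `s` (`tendsto_large`). The information
content `- log P(X_s = x)` is `log (2 π s) / 2 + (x - E X_s)² / (2 s)` up to an error that vanishes
in `L²`, so that `H(s) = log (2 π e s) / 2 + o(1)` and `V(s) → 1 / 2`
(`tendsto_of_quadratic_info`), while `s H'(s) → 1 / 2` by a computation of the Fisher information.
For the Poisson process this follows from the formula of Stirling, and moments are computed by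
size-biasing. For the simple random walk the ratios of neighbouring masses satisfy a continued
fraction recursion, whose solution is monotone (`massRatio_sub_mem`); it bounds the increments of
the information content between arsinh-type functions (`sinh_info_step`), and the normalizing
constant is found by Poisson summation (`tendsto_info_zero_undirected`).

The limiting functions of the middle regime are `f(λ) = H⁻¹(1 / λ)` and `g(λ) = G(f(λ))`. They
differ between the two walks because `h` does: `f` determines `H`, and `g` determines `h` through
the limit of `H G² - 2 log G` at small times (`tendsto_entropy_windowScale`).
-/

namespace EntropicTimes
open scoped Topology Nat ENNReal

/-! ### The mass function of the rate-one walk -/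

/-- The second of the two equally likely jumps (the first one is `1`), so that both walks jump
by an element of `{1, altJump c}` with probability `1 / 2` each. -/
def altJump : WalkCase → ℤ
  | .undirected => -1
  | .directed => 1

lemma altJump_cases (c : WalkCase) : altJump c = 1 ∨ altJump c = -1 := by
  cases c <;> simp [altJump]

/-- Mass function of the sum of `m` independent jumps. -/
noncomputable def stepMass (c : WalkCase) : ℕ → ℤ → ℝ
  | 0, x => if x = 0 then 1 else 0
  | m + 1, x => (stepMass c m (x - 1) + stepMass c m (x - altJump c)) / 2

/-- Mass function at time `s` of the walk that jumps at rate `1`. -/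
noncomputable def mass (c : WalkCase) (s : ℝ) (x : ℤ) : ℝ :=
  ∑' m : ℕ, Real.exp (-s) * s ^ m / m ! * stepMass c m x

lemma stepMass_succ (c : WalkCase) (m : ℕ) (x : ℤ) : stepMass c (m + 1) x =
    (stepMass c m (x - 1) + stepMass c m (x - altJump c)) / 2 := rfl

lemma jumpLaw_eq (c : WalkCase) : jumpLaw c =
    (2⁻¹ : ENNReal) • Measure.dirac 1 + (2⁻¹ : ENNReal) • Measure.dirac (altJump c) := by
  cases c
  · rfl
  · simp [jumpLaw, altJump, ← add_smul, ENNReal.inv_two_add_inv_two]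

instance (c : WalkCase) : IsProbabilityMeasure (jumpLaw c) := by
  rw [jumpLaw_eq]
  refine ⟨?_⟩
  simp [ENNReal.inv_two_add_inv_two]

instance (c : WalkCase) (m : ℕ) : IsProbabilityMeasure (stepLaw c m) := by
  induction m with
  | zero => unfold stepLaw; infer_instance
  | succ m ih => unfold stepLaw; infer_instance

lemma stepMass_nonneg (c : WalkCase) (m : ℕ) (x : ℤ) : 0 ≤ stepMass c m x := by
  induction m generalizing x with
  | zero => unfold stepMass; split_ifs <;> norm_num
  | succ m ih => unfold stepMass; linarith [ih (x - 1), ih (x - altJump c)]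

lemma stepLaw_real_singleton (c : WalkCase) (m : ℕ) (x : ℤ) :
    (stepLaw c m).real {x} = stepMass c m x := by
  induction m generalizing x with
  | zero =>
    simp only [stepLaw, stepMass, measureReal_def]
    rw [Measure.dirac_apply' _ (measurableSet_singleton x)]
    by_cases h : x = 0
    · simp [h]
    · simp [h, Ne.symm h]
  | succ m ih =>
    have h1 : ∀ j : ℤ, ((stepLaw c m).conv (Measure.dirac j)) {x} = (stepLaw c m) {x - j} := by
      intro j
      rw [Measure.conv_dirac, Measure.map_apply (by fun_prop) (measurableSet_singleton x)]
      congr 1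
      ext y
      simp only [mem_preimage, mem_singleton_iff]
      omega
    simp only [stepLaw, stepMass, ← ih]
    rw [jumpLaw_eq, Measure.conv_add, measureReal_def, Measure.add_apply, Measure.conv_smul_right,
      Measure.conv_smul_right, Measure.smul_apply, Measure.smul_apply, h1, h1,
      smul_eq_mul, smul_eq_mul, ENNReal.toReal_add (by finiteness) (by finiteness)]
    simp [measureReal_def]
    ring

lemma stepMass_le_one (c : WalkCase) (m : ℕ) (x : ℤ) : stepMass c m x ≤ 1 := by
  rw [← stepLaw_real_singleton]; exact measureReal_le_one

lemma summable_poisson (s : ℝ) : Summable (fun m : ℕ => Real.exp (-s) * s ^ m / m !) := by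
  simpa [mul_div_assoc] using (Real.summable_pow_div_factorial s).mul_left (Real.exp (-s))

lemma tsum_pow_div_factorial (s : ℝ) : ∑' m : ℕ, s ^ m / (m ! : ℝ) = Real.exp s := by
  rw [Real.exp_eq_exp_ℝ, NormedSpace.exp_eq_tsum_div]

lemma summable_mass (c : WalkCase) {s : ℝ} (hs : 0 ≤ s) (x : ℤ) :
    Summable (fun m : ℕ => Real.exp (-s) * s ^ m / m ! * stepMass c m x) := by
  refine Summable.of_nonneg_of_le (fun m => ?_) (fun m => ?_) (summable_poisson s)
  · have := stepMass_nonneg c m x; positivity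
  · exact mul_le_of_le_one_right (by positivity) (stepMass_le_one c m x)

instance (c : WalkCase) (k : ℕ) (t : ℝ) : IsProbabilityMeasure (coordLaw c k t) := by
  unfold coordLaw
  refine ⟨?_⟩
  rw [Measure.bind_apply MeasurableSet.univ (by fun_prop)]
  simp

lemma coordLaw_real_singleton (c : WalkCase) (k : ℕ) {t : ℝ} (ht : 0 ≤ t) (x : ℤ) :
    (coordLaw c k t).real {x} = mass c (t / k) x := by
  have hs : 0 ≤ t / k := by positivity
  unfold coordLaw mass
  rw [measureReal_def, Measure.bind_apply (measurableSet_singleton x) (by fun_prop),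
    lintegral_countable', ENNReal.tsum_toReal_eq]
  · refine tsum_congr fun m => ?_
    rw [ENNReal.toReal_mul, ← measureReal_def, ← measureReal_def, stepLaw_real_singleton,
      poissonMeasure_real_singleton, Real.coe_toNNReal _ hs, mul_comm]
  · intro m; finiteness

lemma mass_nonneg (c : WalkCase) {s : ℝ} (hs : 0 ≤ s) (x : ℤ) : 0 ≤ mass c s x :=
  tsum_nonneg fun m => by have := stepMass_nonneg c m x; positivity

lemma hasSum_mass (c : WalkCase) {s : ℝ} (hs : 0 ≤ s) : HasSum (mass c s) 1 := by
  have h := fun x => coordLaw_real_singleton c 1 hs x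
  simp only [Nat.cast_one, div_one] at h
  have h2 : (coordLaw c 1 s) univ = ∑' x : ℤ, (coordLaw c 1 s) {x} := by
    rw [← lintegral_one, lintegral_countable']; simp
  have h3 : Summable (mass c s) := by
    simp only [← funext h]
    simp only [measureReal_def]
    apply ENNReal.summable_toReal
    rw [← h2]; simp
  convert h3.hasSum
  simp only [← h, measureReal_def]
  rw [← ENNReal.tsum_toReal_eq (by intro; finiteness), ← h2]
  simp

lemma stepMass_neg_undirected (m : ℕ) (x : ℤ) :
    stepMass .undirected m (-x) = stepMass .undirected m x := by
  induction m generalizing x with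
  | zero => simp [stepMass]
  | succ m ih =>
    simp only [stepMass, altJump]
    rw [← ih (x - 1), ← ih (x - -1)]
    ring_nf

lemma mass_neg_undirected (s : ℝ) (x : ℤ) :
    mass .undirected s (-x) = mass .undirected s x := by
  simp [mass, stepMass_neg_undirected]

lemma stepMass_directed (m : ℕ) (x : ℤ) :
    stepMass .directed m x = if x = m then 1 else 0 := by
  induction m generalizing x with
  | zero => simp [stepMass]
  | succ m ih =>
    simp only [stepMass, altJump, ih, sub_eq_iff_eq_add]
    push_cast
    split_ifs <;> simp

lemma mass_directed_natCast (s : ℝ) (n : ℕ) :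
    mass .directed s n = Real.exp (-s) * s ^ n / n ! := by
  unfold mass
  rw [tsum_eq_single n]
  · simp [stepMass_directed]
  · intro m hm
    simp [stepMass_directed, Ne.symm hm]

lemma mass_directed_of_neg (s : ℝ) {x : ℤ} (hx : x < 0) : mass .directed s x = 0 := by
  unfold mass
  rw [← tsum_zero]
  refine tsum_congr fun m => ?_
  have : x ≠ m := by omega
  simp [stepMass_directed, this]

/-- Exponential (Chernoff) bound for the sum of `m` jumps. -/
lemma stepMass_le_exp (c : WalkCase) (l : ℝ) (m : ℕ) (x : ℤ) : stepMass c m x ≤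
    ((Real.exp l + Real.exp (l * altJump c)) / 2) ^ m * Real.exp (- (l * x)) := by
  induction m generalizing x with
  | zero =>
    unfold stepMass; split_ifs with h
    · simp [h]
    · positivity
  | succ m ih =>
    unfold stepMass
    have h1 := ih (x - 1)
    have h2 := ih (x - altJump c)
    have e1 : Real.exp (-(l * ((x - 1 : ℤ) : ℝ))) = Real.exp l * Real.exp (-(l * x)) := by
      rw [← Real.exp_add]; push_cast; ring_nf
    have e2 : Real.exp (-(l * ((x - altJump c : ℤ) : ℝ))) =
        Real.exp (l * altJump c) * Real.exp (-(l * x)) := by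
      rw [← Real.exp_add]; push_cast; ring_nf
    rw [e1] at h1
    rw [e2] at h2
    rw [pow_succ]
    linarith

lemma mass_le_exp (c : WalkCase) (l : ℝ) {s : ℝ} (hs : 0 ≤ s) (x : ℤ) : mass c s x ≤
    Real.exp (s * ((Real.exp l + Real.exp (l * altJump c)) / 2)) * Real.exp (- (l * x)) := by
  set A := (Real.exp l + Real.exp (l * altJump c)) / 2 with hA
  have hA0 : 0 ≤ A := by positivity
  have h1 : mass c s x ≤ ∑' m : ℕ, (s * A) ^ m / (m ! : ℝ) * Real.exp (- (l * x)) := by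
    refine (summable_mass c hs x).tsum_le_tsum (fun m => ?_)
      ((Real.summable_pow_div_factorial _).mul_right _)
    calc Real.exp (-s) * s ^ m / m ! * stepMass c m x
        ≤ 1 * s ^ m / m ! * (A ^ m * Real.exp (- (l * x))) := by
          gcongr
          · exact stepMass_nonneg c m x
          · simpa using hs
          · exact stepMass_le_exp c l m x
      _ = _ := by rw [mul_pow]; ring
  rwa [tsum_mul_right, tsum_pow_div_factorial] at h1

/-- Locally uniform exponential decay of the mass function. -/
lemma mass_le_exp_neg_abs (c : WalkCase) {s S : ℝ} (hs : 0 ≤ s) (hS : s ≤ S) (x : ℤ) :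
    mass c s x ≤ Real.exp (S * Real.exp 1) * Real.exp (- |(x : ℝ)|) := by
  have key : ∀ l : ℝ, |l| ≤ 1 → mass c s x ≤ Real.exp (S * Real.exp 1) * Real.exp (- (l * x)) := by
    intro l hl
    refine (mass_le_exp c l hs x).trans ?_
    have h1 : Real.exp l ≤ Real.exp 1 := Real.exp_le_exp.2 (abs_le.1 hl).2
    have h2 : Real.exp (l * altJump c) ≤ Real.exp 1 := by
      refine Real.exp_le_exp.2 ((le_abs_self _).trans ?_)
      rcases altJump_cases c with h | h <;> simpa [h] using hl
    gcongr
    all_goals linarith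
  rcases abs_cases (x : ℝ) with h | h
  · rw [h.1]; simpa using key 1 (by simp)
  · rw [h.1]; simpa using key (-1) (by simp)

/-- By exchangeability, each of the `m + 1` jumps contributes equally to the sum. -/
lemma stepMass_stein (c : WalkCase) (m : ℕ) (x : ℤ) :
    (x : ℝ) * stepMass c (m + 1) x =
      (m + 1) * ((stepMass c m (x - 1) + altJump c * stepMass c m (x - altJump c)) / 2) := by
  induction m generalizing x with
  | zero =>
    simp only [stepMass, sub_eq_zero]
    rcases altJump_cases c with h | h <;> simp only [h] <;> split_ifs <;> simp_all <;> norm_num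
  | succ m ih =>
    have h1 := ih (x - 1)
    have h2 := ih (x - altJump c)
    rw [stepMass_succ, stepMass_succ c m (x - 1), stepMass_succ c m (x - altJump c)]
    rw [stepMass_succ] at h1 h2
    push_cast at h1 h2 ⊢
    have e : x - altJump c - 1 = x - 1 - altJump c := by ring
    rw [e] at h2 ⊢
    linear_combination (h1 + h2) / 2

/-- Pointwise form of the size-bias identity `E[X f(X)] = (s / 2) E[f(X + 1) + σ f(X + σ)]`, where
`σ = altJump c`. -/
lemma mass_stein (c : WalkCase) {s : ℝ} (hs : 0 ≤ s) (x : ℤ) : (x : ℝ) * mass c s x =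
    s / 2 * (mass c s (x - 1) + altJump c * mass c s (x - altJump c)) := by
  have h0 : (x : ℝ) * stepMass c 0 x = 0 := by
    unfold stepMass; split_ifs with h <;> simp [h]
  have h1 := summable_mass c hs (x - 1)
  have h2 := (summable_mass c hs (x - altJump c)).mul_left (altJump c : ℝ)
  have h3 := (summable_mass c hs x).mul_left (x : ℝ)
  unfold mass
  rw [← tsum_mul_left, ← tsum_mul_left, ← h1.tsum_add h2, ← tsum_mul_left, h3.tsum_eq_zero_add]
  rw [mul_left_comm, h0, mul_zero, zero_add]
  refine tsum_congr fun m => ?_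
  rw [mul_left_comm, stepMass_stein, Nat.factorial_succ]
  push_cast
  field_simp
  ring

/-- The Kolmogorov forward equation. -/
lemma hasDerivAt_mass (c : WalkCase) {s : ℝ} (hs : 0 < s) (x : ℤ) :
    HasDerivAt (fun r => mass c r x)
      ((mass c s (x - 1) + mass c s (x - altJump c)) / 2 - mass c s x) s := by
  have hd : HasDerivAt (fun r => ∑' m : ℕ, r ^ m / (m ! : ℝ) * stepMass c m x)
      (∑' m : ℕ, (m * s ^ (m - 1)) / (m ! : ℝ) * stepMass c m x) s := by
    have hu : Summable fun m : ℕ => (m * (s + 1) ^ (m - 1)) / (m ! : ℝ) := by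
      rw [← summable_nat_add_iff 1]
      refine (Real.summable_pow_div_factorial (s + 1)).congr fun m => ?_
      rw [Nat.factorial_succ]; push_cast; field_simp
    refine hasDerivAt_tsum_of_isPreconnected hu (t := Ioo 0 (s + 1)) isOpen_Ioo
      isPreconnected_Ioo (fun m r _ => ((hasDerivAt_pow m r).div_const _).mul_const _)
      (fun m r hr => ?_) (y₀ := s) ⟨hs, by linarith⟩ ?_ ⟨hs, by linarith⟩
    · have := stepMass_nonneg c m x
      have h1 := stepMass_le_one c m x
      have h0 := hr.1
      rw [Real.norm_of_nonneg (by positivity)]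
      refine (mul_le_of_le_one_right (by positivity) h1).trans ?_
      have := hr.2.le
      gcongr
    · refine Summable.of_nonneg_of_le (fun m => ?_) (fun m => ?_)
        (Real.summable_pow_div_factorial s)
      · have := stepMass_nonneg c m x; positivity
      · exact mul_le_of_le_one_right (by positivity) (stepMass_le_one c m x)
  have he : ∀ (r : ℝ) (y : ℤ),
      mass c r y = Real.exp (-r) * ∑' m : ℕ, r ^ m / (m ! : ℝ) * stepMass c m y := by
    intro r y
    rw [mass, ← tsum_mul_left]
    exact tsum_congr fun m => by ring
  have hsum : ∀ y : ℤ, Summable fun m : ℕ => s ^ m / (m ! : ℝ) * stepMass c m y := fun y =>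
    Summable.of_nonneg_of_le
      (fun m => by have := stepMass_nonneg c m y; positivity)
      (fun m => mul_le_of_le_one_right (by positivity) (stepMass_le_one c m y))
      (Real.summable_pow_div_factorial s)
  have hshift : ∑' m : ℕ, (m * s ^ (m - 1)) / (m ! : ℝ) * stepMass c m x =
      ((∑' m : ℕ, s ^ m / (m ! : ℝ) * stepMass c m (x - 1)) +
        ∑' m : ℕ, s ^ m / (m ! : ℝ) * stepMass c m (x - altJump c)) / 2 := by
    have e : ∀ m : ℕ, ((m + 1 : ℕ) * s ^ (m + 1 - 1)) / ((m + 1)! : ℝ) * stepMass c (m + 1) x =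
        (s ^ m / (m ! : ℝ) * stepMass c m (x - 1) +
          s ^ m / (m ! : ℝ) * stepMass c m (x - altJump c)) / 2 := by
      intro m
      rw [Nat.factorial_succ, stepMass]; push_cast; field_simp
    have hs1 : Summable fun m : ℕ => (m * s ^ (m - 1)) / (m ! : ℝ) * stepMass c m x := by
      rw [← summable_nat_add_iff 1]
      exact (((hsum _).add (hsum _)).div_const 2).congr fun m => (e m).symm
    rw [hs1.tsum_eq_zero_add, ← (hsum _).tsum_add (hsum _), ← tsum_div_const]
    simp only [e]; simp
  rw [hshift] at hd
  have h2 := ((hasDerivAt_id s).neg.exp).mul hd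
  have hf : (fun r => mass c r x) =
      fun r => Real.exp (-r) * ∑' m : ℕ, r ^ m / (m ! : ℝ) * stepMass c m x :=
    funext fun r => he r x
  rw [hf]
  convert! h2 using 1
  simp only [he]
  simp
  ring

/-- The support of the walk at positive times: `ℤ` for the simple random walk and `ℕ` for the
Poisson process. -/
def walkSupport : WalkCase → Set ℤ
  | .undirected => univ
  | .directed => Ici 0

lemma stepMass_natAbs (c : WalkCase) {x : ℤ} (hx : x ∈ walkSupport c) :
    (2⁻¹ : ℝ) ^ x.natAbs ≤ stepMass c x.natAbs x := by
  have key : ∀ n : ℕ, (2⁻¹ : ℝ) ^ n ≤ stepMass c n n := by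
    intro n
    induction n with
    | zero => simp [stepMass]
    | succ n ih =>
      have h := stepMass_nonneg c n ((n + 1 : ℕ) - altJump c)
      rw [stepMass, pow_succ]
      push_cast at h ⊢
      rw [add_sub_cancel_right]
      linarith
  cases c with
  | undirected =>
    rcases Int.natAbs_eq x with h | h
    · rw [h, Int.natAbs_natCast]; exact key _
    · rw [h, stepMass_neg_undirected, Int.natAbs_neg, Int.natAbs_natCast]; exact key _
  | directed =>
    lift x to ℕ using hx
    exact key _

/-- Lower bound from the event of exactly `|x|` jumps, all towards `x`. -/
lemma le_mass (c : WalkCase) {s : ℝ} (hs : 0 ≤ s) {x : ℤ} (hx : x ∈ walkSupport c) :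
    Real.exp (-s) * (s / 2) ^ x.natAbs / (x.natAbs)! ≤ mass c s x := by
  have h := (summable_mass c hs x).le_tsum x.natAbs
    (fun m _ => by have := stepMass_nonneg c m x; positivity)
  refine le_trans ?_ h
  have h2 := stepMass_natAbs c hx
  calc _ = Real.exp (-s) * s ^ x.natAbs / (x.natAbs)! * 2⁻¹ ^ x.natAbs := by
        rw [div_eq_mul_inv s 2, mul_pow]; ring
    _ ≤ _ := by gcongr

lemma mass_pos (c : WalkCase) {s : ℝ} (hs : 0 < s) {x : ℤ} (hx : x ∈ walkSupport c) :
    0 < mass c s x := lt_of_lt_of_le (by positivity) (le_mass c hs.le hx)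

lemma mass_eq_zero (c : WalkCase) (s : ℝ) {x : ℤ} (hx : x ∉ walkSupport c) :
    mass c s x = 0 := by
  cases c with
  | undirected => exact absurd (mem_univ x) hx
  | directed => exact mass_directed_of_neg s (not_le.1 hx)

lemma mass_le_one (c : WalkCase) {s : ℝ} (hs : 0 ≤ s) (x : ℤ) : mass c s x ≤ 1 :=
  le_hasSum (hasSum_mass c hs) x fun y _ => mass_nonneg c hs y

/-- The information content `- log P(X_s = x)` of the rate-one walk at time `s`. It is
zero outside the support, where `Real.log 0 = 0`. -/
noncomputable def info (c : WalkCase) (s : ℝ) (x : ℤ) : ℝ := - Real.log (mass c s x)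

lemma info_nonneg (c : WalkCase) {s : ℝ} (hs : 0 ≤ s) (x : ℤ) : 0 ≤ info c s x := by
  have := Real.log_nonpos (mass_nonneg c hs x) (mass_le_one c hs x)
  unfold info; linarith

lemma info_le (c : WalkCase) {s : ℝ} (hs : 0 < s) (x : ℤ) :
    info c s x ≤ s + (|Real.log s| + 2) * (x : ℝ) ^ 2 := by
  by_cases hx : x ∈ walkSupport c
  · have h := Real.log_le_log (by positivity) (le_mass c hs.le hx)
    set n := x.natAbs with hn
    have hxn : (x : ℝ) ^ 2 = (n : ℝ) ^ 2 := by
      have : (x.natAbs : ℝ) = |(x : ℝ)| := by rw [Nat.cast_natAbs]; simp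
      rw [hn, this, sq_abs]
    rw [hxn]
    rw [Real.log_div (by positivity) (by positivity), Real.log_mul (by positivity) (by positivity),
      Real.log_exp, Real.log_pow, Real.log_div hs.ne' two_ne_zero] at h
    have h1 : Real.log (n ! : ℝ) ≤ n ^ 2 := by
      have : Real.log (n ! : ℝ) ≤ Real.log ((n : ℝ) ^ n) :=
        Real.log_le_log (by positivity) (by exact_mod_cast Nat.factorial_le_pow n)
      rw [Real.log_pow] at this
      rcases Nat.eq_zero_or_pos n with h0 | h0
      · simp [h0]
      · have h2 := Real.log_le_sub_one_of_pos (x := (n : ℝ)) (by exact_mod_cast h0)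
        nlinarith [(Nat.cast_nonneg n : (0 : ℝ) ≤ n)]
    have h3 : (n : ℝ) ≤ n ^ 2 := by exact_mod_cast Nat.le_self_pow two_ne_zero n
    have h4 := Real.log_two_lt_d9
    have h5 := neg_abs_le (Real.log s)
    have h6 := abs_nonneg (Real.log s)
    have h7 : -(n : ℝ) ^ 2 * (|Real.log s| + 1) ≤ n * (Real.log s - Real.log 2) := by
      have hlog : -(|Real.log s| + 1) ≤ Real.log s - Real.log 2 := by linarith
      nlinarith [mul_le_mul_of_nonneg_left hlog (Nat.cast_nonneg n : (0 : ℝ) ≤ n),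
        mul_nonneg (sub_nonneg.2 h3) (by linarith : 0 ≤ |Real.log s| + 1)]
    unfold info
    nlinarith
  · rw [info, mass_eq_zero c s hx]
    simp
    positivity

/-! ### Expectations of functions of polynomial growth -/

/-- Polynomial growth of a function on `ℤ`. -/
def PolyGrowth (F : ℤ → ℝ) : Prop := ∃ (C : ℝ) (n : ℕ), ∀ x : ℤ, |F x| ≤ C * (1 + (x : ℝ) ^ 2) ^ n

lemma PolyGrowth.exists_nonneg {F : ℤ → ℝ} (h : PolyGrowth F) :
    ∃ (C : ℝ) (n : ℕ), 0 ≤ C ∧ ∀ x : ℤ, |F x| ≤ C * (1 + (x : ℝ) ^ 2) ^ n := by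
  obtain ⟨C, n, h⟩ := h
  refine ⟨C, n, ?_, h⟩
  simpa using (abs_nonneg _).trans (h 0)

lemma PolyGrowth.mono {F G : ℤ → ℝ} (h : PolyGrowth G) (hFG : ∀ x, |F x| ≤ |G x|) :
    PolyGrowth F := by
  obtain ⟨C, n, h⟩ := h
  exact ⟨C, n, fun x => (hFG x).trans (h x)⟩

lemma polyGrowth_const (a : ℝ) : PolyGrowth fun _ => a := ⟨|a|, 0, by simp⟩

lemma polyGrowth_cast : PolyGrowth fun x => (x : ℝ) := by
  refine ⟨1, 1, fun x => ?_⟩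
  rw [abs_le]
  constructor <;> nlinarith [sq_nonneg ((x : ℝ) + 1), sq_nonneg ((x : ℝ) - 1)]

lemma PolyGrowth.add {F G : ℤ → ℝ} (hF : PolyGrowth F) (hG : PolyGrowth G) :
    PolyGrowth fun x => F x + G x := by
  obtain ⟨C, n, hC, h⟩ := hF.exists_nonneg
  obtain ⟨D, m, hD, h'⟩ := hG.exists_nonneg
  refine ⟨C + D, n + m, fun x => (abs_add_le _ _).trans ?_⟩
  have h1 : (1 : ℝ) ≤ 1 + (x : ℝ) ^ 2 := by nlinarith [sq_nonneg (x : ℝ)]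
  have h2 : (1 + (x : ℝ) ^ 2) ^ n ≤ (1 + (x : ℝ) ^ 2) ^ (n + m) :=
    pow_le_pow_right₀ h1 (by omega)
  have h3 : (1 + (x : ℝ) ^ 2) ^ m ≤ (1 + (x : ℝ) ^ 2) ^ (n + m) :=
    pow_le_pow_right₀ h1 (by omega)
  nlinarith [h x, h' x, mul_le_mul_of_nonneg_left h2 hC, mul_le_mul_of_nonneg_left h3 hD]

lemma PolyGrowth.mul {F G : ℤ → ℝ} (hF : PolyGrowth F) (hG : PolyGrowth G) :
    PolyGrowth fun x => F x * G x := by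
  obtain ⟨C, n, hC, h⟩ := hF.exists_nonneg
  obtain ⟨D, m, hD, h'⟩ := hG.exists_nonneg
  refine ⟨C * D, n + m, fun x => ?_⟩
  rw [abs_mul, pow_add]
  calc |F x| * |G x| ≤ (C * (1 + (x : ℝ) ^ 2) ^ n) * (D * (1 + (x : ℝ) ^ 2) ^ m) :=
        mul_le_mul (h x) (h' x) (abs_nonneg _) (by positivity)
    _ = _ := by ring

lemma PolyGrowth.neg {F : ℤ → ℝ} (hF : PolyGrowth F) : PolyGrowth fun x => - F x :=
  hF.mono fun x => by simp

lemma PolyGrowth.sub {F G : ℤ → ℝ} (hF : PolyGrowth F) (hG : PolyGrowth G) :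
    PolyGrowth fun x => F x - G x := by simpa [sub_eq_add_neg] using hF.add hG.neg

lemma PolyGrowth.const_mul {F : ℤ → ℝ} (hF : PolyGrowth F) (a : ℝ) :
    PolyGrowth fun x => a * F x := (polyGrowth_const a).mul hF

lemma PolyGrowth.div_const {F : ℤ → ℝ} (hF : PolyGrowth F) (a : ℝ) :
    PolyGrowth fun x => F x / a := by simpa [div_eq_inv_mul] using hF.const_mul a⁻¹

lemma PolyGrowth.pow {F : ℤ → ℝ} (hF : PolyGrowth F) (n : ℕ) : PolyGrowth fun x => F x ^ n := by
  induction n with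
  | zero => simpa using polyGrowth_const 1
  | succ n ih => simpa [pow_succ] using ih.mul hF

lemma PolyGrowth.shift {F : ℤ → ℝ} (hF : PolyGrowth F) (j : ℤ) :
    PolyGrowth fun x => F (x + j) := by
  obtain ⟨C, n, hC, h⟩ := hF.exists_nonneg
  refine ⟨C * (2 * (1 + (j : ℝ) ^ 2)) ^ n, n, fun x => (h _).trans ?_⟩
  rw [mul_assoc, ← mul_pow]
  have : (1 + ((x + j : ℤ) : ℝ) ^ 2) ≤ 2 * (1 + (j : ℝ) ^ 2) * (1 + (x : ℝ) ^ 2) := by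
    push_cast
    nlinarith [sq_nonneg ((x : ℝ) - j), sq_nonneg ((x : ℝ) * j)]
  gcongr

lemma summable_poly_mul_exp_neg_abs (n : ℕ) :
    Summable fun x : ℤ => (1 + (x : ℝ) ^ 2) ^ n * Real.exp (-|(x : ℝ)|) := by
  have hb : ∀ m : ℕ, (1 + (m : ℝ) ^ 2) ^ n ≤ ((m + 1 : ℕ) : ℝ) ^ (2 * n) := by
    intro m
    rw [pow_mul]
    push_cast
    gcongr
    nlinarith [(Nat.cast_nonneg m : (0 : ℝ) ≤ m)]
  have h1 : Summable fun m : ℕ => (1 + (m : ℝ) ^ 2) ^ n * Real.exp (-(m : ℝ)) := by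
    have h := (summable_nat_add_iff 1).2
      (Real.summable_pow_mul_exp_neg_nat_mul (2 * n) zero_lt_one)
    refine Summable.of_nonneg_of_le (fun m => by positivity) (fun m => ?_)
      (h.mul_left (Real.exp 1))
    calc (1 + (m : ℝ) ^ 2) ^ n * Real.exp (-(m : ℝ))
        ≤ ((m + 1 : ℕ) : ℝ) ^ (2 * n) * Real.exp (-(m : ℝ)) := by gcongr; exact hb m
      _ = _ := by
        rw [mul_left_comm, ← Real.exp_add]; push_cast; ring_nf
  refine Summable.of_nat_of_neg ?_ ?_
  · simpa using h1
  · simpa using h1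

/-- Expectation of `F(X_s)` for the rate-one walk `X`. -/
noncomputable def mean (c : WalkCase) (s : ℝ) (F : ℤ → ℝ) : ℝ := ∑' x : ℤ, mass c s x * F x

lemma summable_mean (c : WalkCase) {s : ℝ} (hs : 0 ≤ s) {F : ℤ → ℝ} (hF : PolyGrowth F) :
    Summable fun x => mass c s x * F x := by
  obtain ⟨C, n, hC, h⟩ := hF.exists_nonneg
  refine Summable.of_norm_bounded
    ((summable_poly_mul_exp_neg_abs n).mul_left (Real.exp (s * Real.exp 1) * C)) fun x => ?_
  rw [norm_mul, Real.norm_of_nonneg (mass_nonneg c hs x), Real.norm_eq_abs]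
  calc mass c s x * |F x| ≤ (Real.exp (s * Real.exp 1) * Real.exp (- |(x : ℝ)|)) *
        (C * (1 + (x : ℝ) ^ 2) ^ n) :=
        mul_le_mul (mass_le_exp_neg_abs c hs le_rfl x) (h x) (abs_nonneg _) (by positivity)
    _ = _ := by ring

section mean
variable {c : WalkCase} {s : ℝ} {F G : ℤ → ℝ}

lemma mean_add (hs : 0 ≤ s) (hF : PolyGrowth F) (hG : PolyGrowth G) :
    mean c s (fun x => F x + G x) = mean c s F + mean c s G := by
  unfold mean
  rw [← (summable_mean c hs hF).tsum_add (summable_mean c hs hG)]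
  simp [mul_add]

lemma mean_sub (hs : 0 ≤ s) (hF : PolyGrowth F) (hG : PolyGrowth G) :
    mean c s (fun x => F x - G x) = mean c s F - mean c s G := by
  unfold mean
  rw [← (summable_mean c hs hF).tsum_sub (summable_mean c hs hG)]
  simp [mul_sub]

lemma mean_const_mul (a : ℝ) : mean c s (fun x => a * F x) = a * mean c s F := by
  unfold mean
  rw [← tsum_mul_left]
  exact tsum_congr fun x => by ring

lemma mean_const (hs : 0 ≤ s) (a : ℝ) : mean c s (fun _ => a) = a := by
  unfold mean
  rw [tsum_mul_right, (hasSum_mass c hs).tsum_eq, one_mul]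

/-- Monotonicity; the comparison is needed on the support only. -/
lemma mean_mono_of_mem (hs : 0 ≤ s) (hF : PolyGrowth F) (hG : PolyGrowth G)
    (h : ∀ x ∈ walkSupport c, F x ≤ G x) : mean c s F ≤ mean c s G := by
  refine (summable_mean c hs hF).tsum_le_tsum (fun x => ?_) (summable_mean c hs hG)
  by_cases hx : x ∈ walkSupport c
  · exact mul_le_mul_of_nonneg_left (h x hx) (mass_nonneg c hs x)
  · simp [mass_eq_zero c s hx]

lemma mean_mono (hs : 0 ≤ s) (hF : PolyGrowth F) (hG : PolyGrowth G) (h : ∀ x, F x ≤ G x) :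
    mean c s F ≤ mean c s G := mean_mono_of_mem hs hF hG fun x _ => h x

lemma mean_nonneg (hs : 0 ≤ s) (h : ∀ x, 0 ≤ F x) : 0 ≤ mean c s F :=
  tsum_nonneg fun x => mul_nonneg (mass_nonneg c hs x) (h x)

lemma mean_shift (j : ℤ) : ∑' x : ℤ, mass c s (x - j) * F x = mean c s fun x => F (x + j) := by
  unfold mean
  rw [← (Equiv.addRight j).tsum_eq]
  simp

lemma summable_shift (hs : 0 ≤ s) (hF : PolyGrowth F) (j : ℤ) :
    Summable fun x : ℤ => mass c s (x - j) * F x := by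
  rw [← (Equiv.addRight j).summable_iff]
  simpa [Function.comp_def] using summable_mean c hs (hF.shift j)

/-- The size-bias identity, from which all moments are computed. -/
lemma mean_cast_mul (hs : 0 ≤ s) (hF : PolyGrowth F) : mean c s (fun x => (x : ℝ) * F x) =
    s / 2 * (mean c s (fun x => F (x + 1)) + altJump c * mean c s fun x => F (x + altJump c)) := by
  rw [← mean_shift, ← mean_shift, ← tsum_mul_left, ← (summable_shift hs hF 1).tsum_add
    ((summable_shift hs hF _).mul_left _), ← tsum_mul_left]
  refine tsum_congr fun x => ?_
  have := mass_stein c hs x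
  linear_combination F x * this

lemma abs_mean_le (hs : 0 ≤ s) (hF : PolyGrowth F) : |mean c s F| ≤ mean c s fun x => |F x| := by
  have h := summable_mean c hs hF
  unfold mean
  have h2 : ∀ x, |mass c s x * F x| = mass c s x * |F x| := fun x => by
    rw [abs_mul, abs_of_nonneg (mass_nonneg c hs x)]
  simp only [← h2]
  exact norm_tsum_le_tsum_norm h.norm

/-- Cauchy–Schwarz. -/
lemma sq_mean_mul_le (hs : 0 ≤ s) (hF : PolyGrowth F) (hG : PolyGrowth G) :
    (mean c s fun x => F x * G x) ^ 2 ≤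
      (mean c s fun x => F x ^ 2) * mean c s fun x => G x ^ 2 := by
  have key : ∀ t : ℝ, 0 ≤ (mean c s fun x => G x ^ 2) * (t * t) +
      (2 * mean c s fun x => F x * G x) * t + mean c s fun x => F x ^ 2 := by
    intro t
    have h : 0 ≤ mean c s fun x => (t * t) * G x ^ 2 + (2 * t) * (F x * G x) + F x ^ 2 :=
      mean_nonneg hs fun x => by nlinarith [sq_nonneg (t * G x + F x)]
    rw [mean_add hs (((hG.pow 2).const_mul _).add ((hF.mul hG).const_mul _)) (hF.pow 2),
      mean_add hs ((hG.pow 2).const_mul _) ((hF.mul hG).const_mul _), mean_const_mul,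
      mean_const_mul] at h
    linarith
  have := discrim_le_zero key
  unfold discrim at this
  nlinarith

end mean

/-! ### Entropy, varentropy and entropy production -/

/-- Entropy of the rate-one walk at time `s`. -/
noncomputable def entropy (c : WalkCase) (s : ℝ) : ℝ := mean c s (info c s)

/-- Variance of the information content of the rate-one walk at time `s`. -/
noncomputable def varentropy (c : WalkCase) (s : ℝ) : ℝ :=
  mean c s fun x => (info c s x - entropy c s) ^ 2

/-- The time derivative of the entropy `∑ₓ (∂ₛ P(X_s = x)) (- log P(X_s = x))`, rearranged by means
of the forward equation as the mean increment of the information content in a jump. -/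
noncomputable def entropyDeriv (c : WalkCase) (s : ℝ) : ℝ :=
  (mean c s (fun x => info c s (x + 1)) + mean c s (fun x => info c s (x + altJump c))) / 2 -
    entropy c s

lemma polyGrowth_info (c : WalkCase) {s : ℝ} (hs : 0 ≤ s) : PolyGrowth (info c s) := by
  rcases hs.eq_or_lt with rfl | hs
  · have h : ∀ x, info c 0 x = 0 := by
      intro x
      have : mass c 0 x = stepMass c 0 x := by
        unfold mass
        rw [tsum_eq_single 0 (by intro m hm; simp [hm])]
        simp
      rw [info, this, stepMass]
      split_ifs <;> simp
    rw [funext h]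
    exact polyGrowth_const 0
  · refine ⟨s + (|Real.log s| + 2), 1, fun x => ?_⟩
    rw [abs_of_nonneg (info_nonneg c hs.le x), pow_one]
    refine (info_le c hs x).trans ?_
    have := abs_nonneg (Real.log s)
    nlinarith [sq_nonneg (x : ℝ), mul_nonneg hs.le (sq_nonneg (x : ℝ))]

lemma varentropy_eq (c : WalkCase) {s : ℝ} (hs : 0 ≤ s) :
    varentropy c s = (mean c s fun x => info c s x ^ 2) - entropy c s ^ 2 := by
  have hQ := polyGrowth_info c hs
  have : ∀ x, (info c s x - entropy c s) ^ 2 =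
      info c s x ^ 2 - (2 * entropy c s) * info c s x + entropy c s ^ 2 := fun x => by ring
  unfold varentropy
  simp only [this]
  rw [mean_add hs ((hQ.pow 2).sub (hQ.const_mul _)) (polyGrowth_const _),
    mean_sub hs (hQ.pow 2) (hQ.const_mul _), mean_const_mul, mean_const hs]
  unfold entropy
  ring

/-! ### From measures to sums -/

lemma infoContent_eq (c : WalkCase) (k : ℕ) {t : ℝ} (ht : 0 ≤ t) :
    infoContent c k t = info c (t / k) := by
  ext x
  rw [infoContent, info, coordLaw_real_singleton c k ht]

lemma integrable_coordLaw (c : WalkCase) (k : ℕ) {t : ℝ} (ht : 0 ≤ t) {F : ℤ → ℝ}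
    (hF : PolyGrowth F) : Integrable F (coordLaw c k t) := by
  refine ⟨Measurable.of_discrete.aestronglyMeasurable, ?_⟩
  rw [HasFiniteIntegral, lintegral_countable']
  have h := (summable_mean c (s := t / k) (by positivity) hF).norm
  have e : ∀ x, ‖F x‖ₑ * (coordLaw c k t) {x} = ENNReal.ofReal ‖mass c (t / k) x * F x‖ := by
    intro x
    have hm := mass_nonneg c (s := t / k) (by positivity) x
    have : (coordLaw c k t) {x} = ENNReal.ofReal (mass c (t / k) x) := by
      rw [← coordLaw_real_singleton c k ht, ofReal_measureReal]
    rw [norm_mul, ENNReal.ofReal_mul (norm_nonneg _), mul_comm, this, Real.norm_of_nonneg hm,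
      ofReal_norm]
  simp only [e]
  rw [← ENNReal.ofReal_tsum_of_nonneg (fun _ => norm_nonneg _) h]
  exact ENNReal.ofReal_lt_top

lemma integral_coordLaw (c : WalkCase) (k : ℕ) {t : ℝ} (ht : 0 ≤ t) {F : ℤ → ℝ}
    (hF : PolyGrowth F) : ∫ x, F x ∂(coordLaw c k t) = mean c (t / k) F := by
  rw [integral_countable (integrable_coordLaw c k ht hF)]
  simp [coordLaw_real_singleton c k ht, mean]

lemma memLp_infoContent (c : WalkCase) (k : ℕ) {t : ℝ} (ht : 0 ≤ t) :
    MemLp (infoContent c k t) 2 (coordLaw c k t) := by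
  rw [infoContent_eq c k ht, 
    memLp_two_iff_integrable_sq Measurable.of_discrete.aestronglyMeasurable]
  exact integrable_coordLaw c k ht ((polyGrowth_info c (by positivity)).pow 2)

lemma meanInfo_eq (c : WalkCase) (k : ℕ) {t : ℝ} (ht : 0 ≤ t) :
    meanInfo c k t = entropy c (t / k) := by
  rw [meanInfo, infoContent_eq c k ht, integral_coordLaw c k ht (polyGrowth_info c (by positivity)),
    entropy]

lemma varInfo_eq (c : WalkCase) (k : ℕ) {t : ℝ} (ht : 0 ≤ t) :
    varInfo c k t = varentropy c (t / k) := by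
  have h := meanInfo_eq c k ht
  rw [varInfo, variance_eq_integral Measurable.of_discrete.aemeasurable]
  rw [meanInfo] at h
  rw [h, infoContent_eq c k ht, integral_coordLaw c k ht
    (((polyGrowth_info c (by positivity)).sub (polyGrowth_const _)).pow 2), varentropy]

/-! ### Regularity and monotonicity of the entropy -/

lemma info_le_locally (c : WalkCase) {a b : ℝ} (ha : 0 < a) :
    ∃ K : ℝ, 0 ≤ K ∧ ∀ r ∈ Icc a b, ∀ x : ℤ, info c r x ≤ K * (1 + (x : ℝ) ^ 2) := by
  refine ⟨|b| + (|Real.log a| + |Real.log b| + 2), by positivity, fun r hr x => ?_⟩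
  have h := info_le c (ha.trans_le hr.1) x
  have h1 : |Real.log r| ≤ |Real.log a| + |Real.log b| := by
    have h1 := Real.log_le_log ha hr.1
    have h2 := Real.log_le_log (ha.trans_le hr.1) hr.2
    rw [abs_le]
    constructor <;>
      linarith [neg_abs_le (Real.log a), le_abs_self (Real.log b), abs_nonneg (Real.log a),
        abs_nonneg (Real.log b)]
  have h2 : r ≤ |b| := hr.2.trans (le_abs_self b)
  have h3 := sq_nonneg (x : ℝ)
  nlinarith [abs_nonneg (Real.log r), mul_nonneg (abs_nonneg b) h3,
    mul_le_mul_of_nonneg_right h1 h3, abs_nonneg (Real.log a), abs_nonneg (Real.log b)]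

lemma continuousOn_mass (c : WalkCase) (x : ℤ) : ContinuousOn (fun r => mass c r x) (Ioi 0) :=
  fun _ hr => (hasDerivAt_mass c hr x).continuousAt.continuousWithinAt

lemma continuousOn_info (c : WalkCase) (x : ℤ) : ContinuousOn (fun r => info c r x) (Ioi 0) := by
  by_cases hx : x ∈ walkSupport c
  · exact ((continuousOn_mass c x).log fun r hr => (mass_pos c hr hx).ne').neg
  · have : (fun r => info c r x) = fun _ => 0 := by
      ext r; simp [info, mass_eq_zero c r hx]
    rw [this]; exact continuousOn_const

/-- Continuity in time of an expectation, from locally uniform polynomial growth. -/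
lemma continuousOn_mean (c : WalkCase) {F : ℝ → ℤ → ℝ}
    (hF : ∀ x, ContinuousOn (fun r => F r x) (Ioi 0))
    (hb : ∀ a b : ℝ, 0 < a → ∃ (C : ℝ) (n : ℕ), 0 ≤ C ∧
      ∀ r ∈ Icc a b, ∀ x : ℤ, |F r x| ≤ C * (1 + (x : ℝ) ^ 2) ^ n) :
    ContinuousOn (fun r => mean c r (F r)) (Ioi 0) := by
  intro s hs
  have hs' : (0 : ℝ) < s := hs
  obtain ⟨C, n, hC, h⟩ := hb (s / 2) (s + 1) (by positivity)
  have hcont : ContinuousOn (fun r => mean c r (F r)) (Icc (s / 2) (s + 1)) := by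
    refine continuousOn_tsum (u := fun x : ℤ => Real.exp ((s + 1) * Real.exp 1) * C *
      ((1 + (x : ℝ) ^ 2) ^ n * Real.exp (-|(x : ℝ)|))) (fun x => ?_)
      ((summable_poly_mul_exp_neg_abs n).mul_left _) (fun x r hr => ?_)
    · exact ((continuousOn_mass c x).mul (hF x)).mono fun r hr =>
        lt_of_lt_of_le (half_pos hs') hr.1
    · have hr0 : 0 ≤ r := (half_pos hs').le.trans hr.1
      rw [norm_mul, Real.norm_of_nonneg (mass_nonneg c hr0 x), Real.norm_eq_abs]
      calc mass c r x * |F r x|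
          ≤ (Real.exp ((s + 1) * Real.exp 1) * Real.exp (- |(x : ℝ)|)) *
            (C * (1 + (x : ℝ) ^ 2) ^ n) :=
            mul_le_mul (mass_le_exp_neg_abs c hr0 hr.2 x) (h r hr x) (abs_nonneg _) (by positivity)
        _ = _ := by ring
  exact (hcont.continuousAt (Icc_mem_nhds (by linarith) (by linarith))).continuousWithinAt

lemma continuousOn_entropy (c : WalkCase) : ContinuousOn (entropy c) (Ioi 0) := by
  refine continuousOn_mean c (continuousOn_info c) fun a b ha => ?_
  obtain ⟨K, hK, h⟩ := info_le_locally c (b := b) ha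
  refine ⟨K, 1, hK, fun r hr x => ?_⟩
  rw [abs_of_nonneg (info_nonneg c (ha.le.trans hr.1) x), pow_one]
  exact h r hr x

lemma continuousOn_mean_info_shift (c : WalkCase) (j : ℤ) :
    ContinuousOn (fun s => mean c s fun x => info c s (x + j)) (Ioi 0) := by
  refine continuousOn_mean c (fun x => continuousOn_info c (x + j)) fun a b ha => ?_
  obtain ⟨K, hK, h⟩ := info_le_locally c (b := b) ha
  refine ⟨K * (2 * (1 + (j : ℝ) ^ 2)), 1, by positivity, fun r hr x => ?_⟩
  rw [abs_of_nonneg (info_nonneg c (ha.le.trans hr.1) _), pow_one, mul_assoc]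
  refine (h r hr _).trans (mul_le_mul_of_nonneg_left ?_ hK)
  push_cast
  nlinarith [sq_nonneg ((x : ℝ) - j), sq_nonneg ((x : ℝ) * j)]

lemma continuousOn_entropyDeriv (c : WalkCase) : ContinuousOn (entropyDeriv c) (Ioi 0) :=
  (((continuousOn_mean_info_shift c 1).add (continuousOn_mean_info_shift c _)).div_const 2).sub
    (continuousOn_entropy c)

lemma continuousOn_varentropy (c : WalkCase) : ContinuousOn (varentropy c) (Ioi 0) := by
  have h1 : ContinuousOn (fun s => mean c s fun x => info c s x ^ 2) (Ioi 0) := by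
    refine continuousOn_mean c (fun x => (continuousOn_info c x).pow 2) fun a b ha => ?_
    obtain ⟨K, hK, h⟩ := info_le_locally c (b := b) ha
    refine ⟨K ^ 2, 2, by positivity, fun r hr x => ?_⟩
    rw [abs_of_nonneg (sq_nonneg _), ← mul_pow]
    have := info_nonneg c (ha.le.trans hr.1) x
    gcongr
    exact h r hr x
  exact (h1.sub ((continuousOn_entropy c).pow 2)).congr fun s hs => varentropy_eq c (le_of_lt hs)

/-- The infinitesimal generator of the walk applied to its mass function. -/
noncomputable def massDeriv (c : WalkCase) (s : ℝ) (x : ℤ) : ℝ :=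
  (mass c s (x - 1) + mass c s (x - altJump c)) / 2 - mass c s x

lemma tsum_massDeriv_mul (c : WalkCase) {s : ℝ} (hs : 0 ≤ s) {F : ℤ → ℝ} (hF : PolyGrowth F) :
    Summable (fun x => massDeriv c s x * F x) ∧ ∑' x, massDeriv c s x * F x =
      (mean c s (fun x => F (x + 1)) + mean c s (fun x => F (x + altJump c))) / 2 - mean c s F := by
  have h1 := summable_shift (c := c) hs hF 1
  have h2 := summable_shift (c := c) hs hF (altJump c)
  have h3 := summable_mean c hs hF
  have e : (fun x => massDeriv c s x * F x) = fun x => (mass c s (x - 1) * F x +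
      mass c s (x - altJump c) * F x) / 2 - mass c s x * F x := by
    ext x; rw [massDeriv]; ring
  rw [e]
  refine ⟨((h1.add h2).div_const 2).sub h3, ?_⟩
  rw [((h1.add h2).div_const 2).tsum_sub h3, tsum_div_const, h1.tsum_add h2, mean_shift, mean_shift]
  rfl

lemma hasDerivAt_entropy (c : WalkCase) {s : ℝ} (hs : 0 < s) :
    HasDerivAt (entropy c) (entropyDeriv c s) s := by
  obtain ⟨K, hK, hb⟩ := info_le_locally c (a := s / 2) (b := s + 1) (by positivity)
  set B := Real.exp ((s + 1) * Real.exp 1) with hB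
  have hd : ∀ (x : ℤ), ∀ r ∈ Ioo (s / 2) (s + 1), HasDerivAt (fun r => mass c r x * info c r x)
      (massDeriv c r x * (info c r x - 1)) r := by
    intro x r hr
    have hr0 : 0 < r := (half_pos hs).trans hr.1
    have h := hasDerivAt_mass c hr0 x
    by_cases hx : x ∈ walkSupport c
    · have hp := mass_pos c hr0 hx
      have h2 := h.mul (h.log hp.ne').neg
      convert! h2 using 1
      simp only [massDeriv, info, Pi.neg_apply]
      field_simp
      ring
    · have h0 : (fun r => mass c r x) = fun _ => 0 := funext fun r => mass_eq_zero c r hx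
      have h1 : massDeriv c r x = 0 := by
        rw [h0] at h
        exact h.unique (hasDerivAt_const r 0)
      simp only [mass_eq_zero c _ hx, h1, zero_mul]
      exact hasDerivAt_const r 0
  have hdecay : ∀ r ∈ Ioo (s / 2) (s + 1), ∀ x j : ℤ, |j| ≤ 1 →
      mass c r (x - j) ≤ B * Real.exp 1 * Real.exp (-|(x : ℝ)|) := by
    intro r hr x j hj
    refine (mass_le_exp_neg_abs c ((half_pos hs).le.trans hr.1.le) hr.2.le (x - j)).trans ?_
    rw [mul_assoc, ← Real.exp_add 1]
    refine mul_le_mul_of_nonneg_left (Real.exp_le_exp.2 ?_) (Real.exp_pos _).le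
    have hj' : |(j : ℝ)| ≤ 1 := by exact_mod_cast hj
    have := abs_sub_abs_le_abs_sub (x : ℝ) j
    push_cast
    linarith
  have hj1 : |altJump c| ≤ 1 := by rcases altJump_cases c with h | h <;> simp [h]
  have h := hasDerivAt_tsum_of_isPreconnected
    (u := fun x : ℤ => (2 * (B * Real.exp 1)) * (K + 1) *
      ((1 + (x : ℝ) ^ 2) ^ 1 * Real.exp (-|(x : ℝ)|)))
    ((summable_poly_mul_exp_neg_abs 1).mul_left _) isOpen_Ioo isPreconnected_Ioo hd
    (fun x r hr => ?_) (y₀ := s) ⟨by linarith, by linarith⟩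
    (summable_mean c hs.le (polyGrowth_info c hs.le)) (y := s) ⟨by linarith, by linarith⟩
  -- the constant `1` does not contribute, since the total mass is conserved
  · have e : (∑' x, massDeriv c s x * (info c s x - 1)) = entropyDeriv c s := by
      rw [(tsum_massDeriv_mul c hs.le ((polyGrowth_info c hs.le).sub (polyGrowth_const 1))).2,
        mean_sub hs.le ((polyGrowth_info c hs.le).shift _) (polyGrowth_const 1),
        mean_sub hs.le ((polyGrowth_info c hs.le).shift _) (polyGrowth_const 1),
        mean_sub hs.le (polyGrowth_info c hs.le) (polyGrowth_const 1), mean_const hs.le,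
        entropyDeriv, entropy]
      ring
    rwa [e] at h
  · have hr0 : 0 ≤ r := (half_pos hs).le.trans hr.1.le
    rw [norm_mul, Real.norm_eq_abs, Real.norm_eq_abs]
    have h1 : |massDeriv c r x| ≤ 2 * (B * Real.exp 1 * Real.exp (-|(x : ℝ)|)) := by
      have a1 := hdecay r hr x 1 (by simp)
      have a2 := hdecay r hr x _ hj1
      have a3 := hdecay r hr x 0 (by simp)
      rw [sub_zero] at a3
      have b1 := mass_nonneg c hr0 (x - 1)
      have b2 := mass_nonneg c hr0 (x - altJump c)
      have b3 := mass_nonneg c hr0 x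
      rw [massDeriv, abs_le]
      constructor <;> linarith
    have h2 : |info c r x - 1| ≤ (K + 1) * (1 + (x : ℝ) ^ 2) ^ 1 := by
      have a1 := hb r ⟨hr.1.le, hr.2.le⟩ x
      have a2 := info_nonneg c hr0 x
      have a3 := sq_nonneg (x : ℝ)
      rw [abs_le]
      constructor <;> nlinarith
    calc _ ≤ 2 * (B * Real.exp 1 * Real.exp (-|(x : ℝ)|)) * ((K + 1) * (1 + (x : ℝ) ^ 2) ^ 1) :=
          mul_le_mul h1 h2 (abs_nonneg _) (by positivity)
      _ = _ := by ring

/-- The mass function is not constant on `ℕ`, as it is summable and positive. -/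
lemma exists_mass_succ_ne (c : WalkCase) {s : ℝ} (hs : 0 < s) :
    ∃ n : ℕ, mass c s (n + 1) ≠ mass c s n := by
  by_contra! h
  have h1 : ∀ n : ℕ, mass c s n = mass c s 0 := by
    intro n
    induction n with
    | zero => simp
    | succ n ih => push_cast; rw [h n, ih]
  have h2 : Tendsto (fun n : ℕ => mass c s n) atTop (𝓝 0) :=
    ((hasSum_mass c hs.le).summable.comp_injective Nat.cast_injective).tendsto_atTop_zero
  have h3 : mass c s 0 = 0 := by
    simp only [h1] at h2
    exact tendsto_nhds_unique tendsto_const_nhds h2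
  exact (mass_pos c hs (x := 0) (by cases c <;> simp [walkSupport])).ne' h3

lemma natCast_mem_walkSupport (c : WalkCase) (n : ℕ) : (n : ℤ) ∈ walkSupport c := by
  cases c <;> simp [walkSupport]

/-- Strict monotonicity of the entropy: `log z ≥ 1 - 1 / z` applied to ratios of neighbouring
masses bounds each summand from below by a term of a telescoping sum. -/
lemma entropyDeriv_pos (c : WalkCase) {s : ℝ} (hs : 0 < s) : 0 < entropyDeriv c s := by
  have hQ := polyGrowth_info c hs.le
  have hadd : ∀ x ∈ walkSupport c, x + 1 ∈ walkSupport c ∧ x + altJump c ∈ walkSupport c := by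
    intro x hx
    cases c with
    | undirected => simp [walkSupport]
    | directed =>
      have : (0 : ℤ) ≤ x := hx
      simp only [walkSupport, altJump, mem_Ici]; omega
  have key : ∀ x y : ℤ, (x ∈ walkSupport c → y ∈ walkSupport c) →
      mass c s x - mass c s y ≤ mass c s x * (info c s y - info c s x) := by
    intro x y hxy
    by_cases hx : x ∈ walkSupport c
    · have px := mass_pos c hs hx
      have py := mass_pos c hs (hxy hx)
      have h := Real.log_le_sub_one_of_pos (div_pos py px)
      rw [Real.log_div py.ne' px.ne'] at h
      have h2 := mul_le_mul_of_nonneg_left h px.le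
      have h3 : mass c s x * (mass c s y / mass c s x - 1) = mass c s y - mass c s x := by
        field_simp
      unfold info
      linarith
    · rw [mass_eq_zero c s hx]
      have := mass_nonneg c hs.le y
      linarith
  have hkey1 : ∀ x : ℤ, mass c s x - mass c s (x + 1) ≤
      mass c s x * (info c s (x + 1) - info c s x) := fun x => key _ _ fun hx => (hadd x hx).1
  have hkey2 : ∀ x : ℤ, mass c s x - mass c s (x + altJump c) ≤
      mass c s x * (info c s (x + altJump c) - info c s x) :=
    fun x => key _ _ fun hx => (hadd x hx).2
  have hsum : ∀ j : ℤ, HasSum (fun x => mass c s x - mass c s (x + j)) 0 := by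
    intro j
    have h := hasSum_mass c hs.le
    have h2 : HasSum (fun x => mass c s (x + j)) 1 := by
      rw [← (Equiv.addRight j).hasSum_iff] at h
      simpa [Function.comp_def] using h
    simpa using h.sub h2
  have hm : ∀ j : ℤ, HasSum (fun x => mass c s x * (info c s (x + j) - info c s x))
      (mean c s (fun x => info c s (x + j)) - entropy c s) := by
    intro j
    have h := (summable_mean c hs.le ((hQ.shift j).sub hQ)).hasSum
    rwa [show (∑' x, mass c s x * (info c s (x + j) - info c s x)) = _ from
      mean_sub hs.le (hQ.shift j) hQ] at h
  obtain ⟨n, hn⟩ := exists_mass_succ_ne c hs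
  have hstrict : mass c s n - mass c s (n + 1) < mass c s n * (info c s (n + 1) - info c s n) := by
    have px := mass_pos c hs (natCast_mem_walkSupport c n)
    have py := mass_pos c hs (natCast_mem_walkSupport c (n + 1))
    push_cast at py
    have h := Real.log_lt_sub_one_of_pos (div_pos py px)
      (by intro h; exact hn ((div_eq_one_iff_eq px.ne').1 h))
    rw [Real.log_div py.ne' px.ne'] at h
    have h2 := mul_lt_mul_of_pos_left h px
    have h3 : mass c s n * (mass c s (n + 1) / mass c s n - 1) =
        mass c s (n + 1) - mass c s n := by
      field_simp
    unfold info
    linarith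
  have hlt := hasSum_lt hkey1 hstrict (hsum 1) (hm 1)
  have hle := hasSum_le hkey2 (hsum _) (hm _)
  unfold entropyDeriv
  linarith

/-- The information content is not constant on the support, because the mass function is not. -/
lemma varentropy_pos (c : WalkCase) {s : ℝ} (hs : 0 < s) : 0 < varentropy c s := by
  obtain ⟨n, hn⟩ := exists_mass_succ_ne c hs
  have hp : ∀ m : ℕ, 0 < mass c s m := fun m => mass_pos c hs (natCast_mem_walkSupport c m)
  have hne : ∃ m : ℕ, info c s m ≠ entropy c s := by
    by_contra! h
    have h1 := (h (n + 1)).trans (h n).symm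
    unfold info at h1
    have h2 := Real.log_injOn_pos (hp (n + 1)) (hp n) (neg_injective h1)
    exact hn (by exact_mod_cast h2)
  obtain ⟨m, hm⟩ := hne
  have hnn : ∀ x, 0 ≤ mass c s x * (info c s x - entropy c s) ^ 2 := fun x =>
    mul_nonneg (mass_nonneg c hs.le x) (sq_nonneg _)
  have hp2 := ((polyGrowth_info c hs.le).sub (polyGrowth_const (entropy c s))).pow 2
  refine (summable_mean c hs.le hp2).tsum_pos hnn m (mul_pos (hp m) ?_)
  have := sub_ne_zero.2 hm
  positivity

/-! ### Displacements of size at most one -/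

/-- Entropy of a single jump. -/
noncomputable def jumpEntropy : WalkCase → ℝ
  | .undirected => Real.log 2
  | .directed => 0

lemma jumpEntropy_nonneg (c : WalkCase) : 0 ≤ jumpEntropy c := by
  cases c
  · exact Real.log_nonneg (by norm_num)
  · exact le_rfl

lemma jumpEntropy_le_one (c : WalkCase) : jumpEntropy c ≤ 1 := by
  cases c
  · exact Real.log_two_lt_d9.le.trans (by norm_num)
  · exact zero_le_one

lemma mean_cast_mul_undirected {s : ℝ} (hs : 0 ≤ s) {F : ℤ → ℝ} (hF : PolyGrowth F) :
    mean .undirected s (fun x => (x : ℝ) * F x) =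
      s / 2 * mean .undirected s (fun x => F (x + 1) - F (x - 1)) := by
  have h := mean_cast_mul (c := .undirected) hs hF
  have h2 := mean_sub (c := .undirected) hs (hF.shift 1) (hF.shift (-1))
  simp only [altJump] at h
  simp only [← sub_eq_add_neg] at h h2
  rw [h, h2]; push_cast; ring

lemma mean_cast_mul_directed {s : ℝ} (hs : 0 ≤ s) {F : ℤ → ℝ} (hF : PolyGrowth F) :
    mean .directed s (fun x => (x : ℝ) * F x) = s * mean .directed s (fun x => F (x + 1)) := by
  have h := mean_cast_mul (c := .directed) hs hF
  simp only [altJump] at h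
  rw [h]; push_cast; ring

lemma mean_cast_sq_undirected {s : ℝ} (hs : 0 ≤ s) :
    mean .undirected s (fun x => (x : ℝ) ^ 2) = s := by
  have h := mean_cast_mul_undirected hs polyGrowth_cast
  have e : (fun x : ℤ => ((x + 1 : ℤ) : ℝ) - ((x - 1 : ℤ) : ℝ)) = fun _ => 2 := by
    ext x; push_cast; ring
  rw [e, mean_const hs] at h
  simp only [sq]; linarith

lemma mean_cast_directed {s : ℝ} (hs : 0 ≤ s) : mean .directed s (fun x => (x : ℝ)) = s := by
  have h := mean_cast_mul_directed hs (polyGrowth_const 1)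
  simpa [mean_const hs] using h

lemma mean_cast_sq_directed {s : ℝ} (hs : 0 ≤ s) :
    mean .directed s (fun x => (x : ℝ) ^ 2) = s ^ 2 + s := by
  have h := mean_cast_mul_directed hs polyGrowth_cast
  push_cast at h
  rw [mean_add hs polyGrowth_cast (polyGrowth_const 1), mean_cast_directed hs, mean_const hs] at h
  simp only [sq]; linarith

/-- The weight `x² (x² - 1)` vanishes on `{0, 1, -1}`, so that its expectation, which is of second
order in small times, controls the event of at least two net jumps. -/
lemma mean_tail_weight_le (c : WalkCase) {s : ℝ} (hs : 0 ≤ s) (hs1 : s ≤ 1) :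
    mean c s (fun x => (x : ℝ) ^ 2 * ((x : ℝ) ^ 2 - 1)) ≤ 13 * s ^ 2 := by
  have hX := polyGrowth_cast
  have e0 : (fun x : ℤ => (x : ℝ) ^ 2 * ((x : ℝ) ^ 2 - 1)) =
      fun x : ℤ => (x : ℝ) * ((x : ℝ) ^ 3 - x) := by ext x; ring
  rw [e0]
  cases c with
  | undirected =>
    rw [mean_cast_mul_undirected hs ((hX.pow 3).sub hX)]
    have e : (fun x : ℤ => (((x + 1 : ℤ) : ℝ) ^ 3 - ((x + 1 : ℤ) : ℝ)) -
        (((x - 1 : ℤ) : ℝ) ^ 3 - ((x - 1 : ℤ) : ℝ))) = fun x : ℤ => 6 * (x : ℝ) ^ 2 := by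
      ext x; push_cast; ring
    rw [e, mean_const_mul, mean_cast_sq_undirected hs]
    nlinarith [sq_nonneg s]
  | directed =>
    rw [mean_cast_mul_directed hs ((hX.pow 3).sub hX)]
    have e : (fun x : ℤ => ((x + 1 : ℤ) : ℝ) ^ 3 - ((x + 1 : ℤ) : ℝ)) =
        fun x : ℤ => (x : ℝ) * (x ^ 2 + 3 * x + 2) := by
      ext x; push_cast; ring
    rw [e, mean_cast_mul_directed hs (((hX.pow 2).add (hX.const_mul 3)).add (polyGrowth_const 2))]
    have e : (fun x : ℤ => ((x + 1 : ℤ) : ℝ) ^ 2 + 3 * ((x + 1 : ℤ) : ℝ) + 2) =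
        fun x : ℤ => (x : ℝ) ^ 2 + 5 * x + 6 := by
      ext x; push_cast; ring
    rw [e, mean_add hs ((hX.pow 2).add (hX.const_mul 5)) (polyGrowth_const 6),
      mean_add hs (hX.pow 2) (hX.const_mul 5), mean_const_mul, mean_const hs,
      mean_cast_sq_directed hs, mean_cast_directed hs]
    nlinarith [sq_nonneg s, mul_nonneg hs (sq_nonneg s),
      mul_nonneg (sq_nonneg s) (sub_nonneg.2 hs1),
      mul_nonneg (mul_nonneg hs (sq_nonneg s)) (sub_nonneg.2 hs1)]

lemma mean_cast_sq_bounds (c : WalkCase) {s : ℝ} (hs : 0 ≤ s) :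
    s ≤ mean c s (fun x => (x : ℝ) ^ 2) ∧ mean c s (fun x => (x : ℝ) ^ 2) ≤ s + s ^ 2 := by
  cases c with
  | undirected => rw [mean_cast_sq_undirected hs]; constructor <;> nlinarith
  | directed => rw [mean_cast_sq_directed hs]; constructor <;> nlinarith

/-- Part of an expectation that comes from the event of at least two net jumps. -/
noncomputable def tailMean (c : WalkCase) (s : ℝ) (F : ℤ → ℝ) : ℝ :=
  mean c s fun x => if 2 ≤ |x| then F x else 0

lemma PolyGrowth.ite {F : ℤ → ℝ} (hF : PolyGrowth F) (p : ℤ → Prop) [DecidablePred p] :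
    PolyGrowth fun x => if p x then F x else 0 := by
  refine hF.mono fun x => ?_
  split_ifs <;> simp

lemma mean_single (c : WalkCase) (s : ℝ) (F : ℤ → ℝ) (j : ℤ) :
    mean c s (fun x => if x = j then F x else 0) = mass c s j * F j := by
  unfold mean
  rw [tsum_eq_single j (by intro x hx; simp [hx])]
  simp

lemma mean_eq_add_tailMean (c : WalkCase) {s : ℝ} (hs : 0 ≤ s) {F : ℤ → ℝ} (hF : PolyGrowth F) :
    mean c s F = mass c s 0 * F 0 + (mass c s 1 * F 1 + mass c s (-1) * F (-1)) +
      tailMean c s F := by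
  have e : F = fun x => (if x = 0 then F x else 0) + ((if x = 1 then F x else 0) +
      (if x = -1 then F x else 0)) + (if 2 ≤ |x| then F x else 0) := by
    ext x
    by_cases h0 : x = 0
    · simp [h0]
    by_cases h1 : x = 1
    · simp [h1]
    by_cases h2 : x = -1
    · simp [h2]
    have : 2 ≤ |x| := by
      rcases abs_cases x with h | h <;> omega
    simp [h0, h1, h2, this]
  conv_lhs => rw [e]
  rw [mean_add hs ((hF.ite _).add ((hF.ite _).add (hF.ite _))) (hF.ite _),
    mean_add hs (hF.ite _) ((hF.ite _).add (hF.ite _)), mean_add hs (hF.ite _) (hF.ite _),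
    mean_single, mean_single, mean_single, tailMean]

/-- Where `|x| ≥ 2`, the bound `x ^ 4` is at most `4 / 3` times the weight `x² (x² - 1)`. -/
lemma abs_tailMean_le (c : WalkCase) {s : ℝ} (hs : 0 ≤ s) (hs1 : s ≤ 1) {F : ℤ → ℝ}
    (hF : PolyGrowth F) {K : ℝ} (hK : 0 ≤ K) (h : ∀ x : ℤ, 2 ≤ |x| → |F x| ≤ K * (x : ℝ) ^ 4) :
    |tailMean c s F| ≤ 18 * K * s ^ 2 := by
  have hX := polyGrowth_cast
  have hG : PolyGrowth fun x : ℤ => K * (4 / 3) * ((x : ℝ) ^ 2 * ((x : ℝ) ^ 2 - 1)) :=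
    ((hX.pow 2).mul ((hX.pow 2).sub (polyGrowth_const 1))).const_mul _
  have h1 : mean c s (fun x => |if 2 ≤ |x| then F x else 0|) ≤
      mean c s fun x => K * (4 / 3) * ((x : ℝ) ^ 2 * ((x : ℝ) ^ 2 - 1)) := by
    refine mean_mono hs ((hF.ite fun x => 2 ≤ |x|).mono fun x => by simp) hG fun x => ?_
    split_ifs with hx
    · refine (h x hx).trans ?_
      have : (4 : ℝ) ≤ (x : ℝ) ^ 2 := by
        have h2 : (2 : ℝ) ≤ |(x : ℝ)| := by exact_mod_cast hx
        rw [← sq_abs]; nlinarith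
      rw [mul_assoc]
      refine mul_le_mul_of_nonneg_left ?_ hK
      nlinarith
    · rw [abs_zero]
      rcases eq_or_ne x 0 with h0 | h0
      · simp [h0]
      · have : (1 : ℝ) ≤ (x : ℝ) ^ 2 := by
          have : 1 ≤ x ^ 2 := by have := sq_pos_of_ne_zero h0; omega
          exact_mod_cast this
        have := sub_nonneg.2 this
        positivity
  rw [mean_const_mul] at h1
  have h2 := abs_mean_le (c := c) hs (hF.ite fun x => 2 ≤ |x|)
  have h3 := mul_le_mul_of_nonneg_left (mean_tail_weight_le c hs hs1)
    (by positivity : 0 ≤ K * (4 / 3))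
  unfold tailMean
  nlinarith [sq_nonneg s, mul_nonneg hK (sq_nonneg s)]

/-- Probability of a net displacement of size one. -/
noncomputable def unitMass (c : WalkCase) (s : ℝ) : ℝ := mass c s 1 + mass c s (-1)

lemma one_le_cast_sq {x : ℤ} (hx : x ≠ 0) : (1 : ℝ) ≤ (x : ℝ) ^ 2 := by
  have : 1 ≤ x ^ 2 := by have := sq_pos_of_ne_zero hx; omega
  exact_mod_cast this

lemma cast_sq_le_pow_four (x : ℤ) : (x : ℝ) ^ 2 ≤ (x : ℝ) ^ 4 := by
  rcases eq_or_ne x 0 with h0 | h0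
  · simp [h0]
  · nlinarith [one_le_cast_sq h0]

lemma abs_unitMass_sub_le (c : WalkCase) {s : ℝ} (hs : 0 ≤ s) (hs1 : s ≤ 1) :
    |unitMass c s - s| ≤ 19 * s ^ 2 := by
  have h := mean_eq_add_tailMean c hs (polyGrowth_cast.pow 2)
  have ht := abs_tailMean_le c hs hs1 (polyGrowth_cast.pow 2) zero_le_one (fun x _ => by
    rw [abs_of_nonneg (sq_nonneg _), one_mul]; exact cast_sq_le_pow_four x)
  obtain ⟨h1, h2⟩ := mean_cast_sq_bounds c hs
  rw [abs_le] at ht ⊢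
  norm_num at h
  unfold unitMass
  constructor <;> linarith

lemma abs_mass_zero_sub_le (c : WalkCase) {s : ℝ} (hs : 0 ≤ s) (hs1 : s ≤ 1) :
    |mass c s 0 - (1 - s)| ≤ 37 * s ^ 2 := by
  have h := mean_eq_add_tailMean c hs (polyGrowth_const 1)
  have ht := abs_tailMean_le c hs hs1 (polyGrowth_const 1) zero_le_one (fun x hx => by
    have h0 : x ≠ 0 := by rintro rfl; simp at hx
    rw [abs_one, one_mul]; exact (one_le_cast_sq h0).trans (cast_sq_le_pow_four x))
  have h1 := abs_unitMass_sub_le c hs hs1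
  rw [mean_const hs] at h
  unfold unitMass at h1
  rw [abs_le] at ht h1 ⊢
  constructor <;> linarith

lemma unitMass_pos (c : WalkCase) {s : ℝ} (hs : 0 < s) : 0 < unitMass c s :=
  add_pos_of_pos_of_nonneg (mass_pos c hs (natCast_mem_walkSupport c 1)) (mass_nonneg c hs.le _)

/-- The (common) information content of the sites at distance one that the walk can reach. -/
lemma info_one (c : WalkCase) {s : ℝ} (hs : 0 < s) :
    info c s 1 = jumpEntropy c - Real.log (unitMass c s) := by
  cases c with
  | undirected =>
    have hp : 0 < mass .undirected s 1 := mass_pos _ hs (by simp [walkSupport])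
    rw [unitMass, mass_neg_undirected, ← two_mul, Real.log_mul two_ne_zero hp.ne', info,
      jumpEntropy]
    ring
  | directed =>
    rw [unitMass, mass_directed_of_neg s (show (-1 : ℤ) < 0 by norm_num), info, jumpEntropy]
    simp

lemma info_altJump (c : WalkCase) (s : ℝ) : info c s (altJump c) = info c s 1 := by
  cases c
  · simp [info, altJump, mass_neg_undirected]
  · simp [altJump]

lemma unit_terms_eq (c : WalkCase) (s : ℝ) (f : ℝ → ℝ) :
    mass c s 1 * f (info c s 1) + mass c s (-1) * f (info c s (-1)) =
      unitMass c s * f (info c s 1) := by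
  cases c with
  | undirected => simp only [unitMass, info, mass_neg_undirected]; ring
  | directed => simp [unitMass, mass_directed_of_neg s (show (-1 : ℤ) < 0 by norm_num)]

lemma info_le_of_small (c : WalkCase) {s : ℝ} (hs : 0 < s) (hs1 : s ≤ 1) {x : ℤ} (hx : x ≠ 0) :
    info c s x ≤ (3 - Real.log s) * (x : ℝ) ^ 2 := by
  have h := info_le c hs x
  rw [abs_of_nonpos (Real.log_nonpos hs.le hs1)] at h
  nlinarith [one_le_cast_sq hx]

/-! ### Small times -/

lemma tendsto_mul_log_sq : Tendsto (fun s : ℝ => s * (Real.log s) ^ 2) (𝓝[>] 0) (𝓝 0) := by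
  have h := tendsto_log_mul_rpow_nhdsGT_zero (r := 1 / 2) (by norm_num)
  have h2 := h.pow 2
  rw [zero_pow two_ne_zero] at h2
  refine h2.congr' ?_
  filter_upwards [self_mem_nhdsWithin] with s hs
  have : (0 : ℝ) < s := hs
  rw [mul_pow, ← Real.sqrt_eq_rpow, Real.sq_sqrt this.le, mul_comm]

lemma tendsto_mul_log : Tendsto (fun s : ℝ => s * Real.log s) (𝓝[>] 0) (𝓝 0) := by
  have := tendsto_log_mul_rpow_nhdsGT_zero (r := 1) (by norm_num)
  simpa [mul_comm] using this

lemma tendsto_id_zero : Tendsto (fun s : ℝ => s) (𝓝[>] 0) (𝓝 0) :=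
  tendsto_id.mono_left nhdsWithin_le_nhds

lemma eventually_small : ∀ᶠ s : ℝ in 𝓝[>] 0, 0 < s ∧ s ≤ 1 := by
  filter_upwards [Ioo_mem_nhdsGT (zero_lt_one : (0 : ℝ) < 1)] with s hs
  exact ⟨hs.1, hs.2.le⟩

/-- Any quantity of order `s (1 + |log s|)²` is negligible at small times. -/
lemma tendsto_zero_of_le_small {F : ℝ → ℝ} (K : ℝ)
    (h : ∀ s : ℝ, 0 < s → s ≤ 1 → |F s| ≤ K * (s * (3 - Real.log s) ^ 2)) :
    Tendsto F (𝓝[>] 0) (𝓝 0) := by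
  have h1 : Tendsto (fun s : ℝ => K * (s * (3 - Real.log s) ^ 2)) (𝓝[>] 0) (𝓝 0) := by
    have := (((tendsto_id_zero.const_mul 9).sub (tendsto_mul_log.const_mul 6)).add
      tendsto_mul_log_sq).const_mul K
    simp only [mul_zero, sub_zero, add_zero] at this
    refine this.congr fun s => by ring
  refine squeeze_zero_norm' ?_ h1
  filter_upwards [eventually_small] with s hs
  exact h s hs.1 hs.2

lemma tendsto_unitMass_div (c : WalkCase) :
    Tendsto (fun s => unitMass c s / s) (𝓝[>] 0) (𝓝 1) := by
  have : Tendsto (fun s => unitMass c s / s - 1) (𝓝[>] 0) (𝓝 0) := by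
    refine tendsto_zero_of_le_small 19 fun s hs hs1 => ?_
    have h := abs_unitMass_sub_le c hs.le hs1
    have hl := Real.log_nonpos hs.le hs1
    have e : unitMass c s / s - 1 = (unitMass c s - s) / s := by field_simp
    rw [e, abs_div, abs_of_pos hs, div_le_iff₀ hs]
    nlinarith [sq_nonneg s, mul_nonneg (sq_nonneg s) (neg_nonneg.2 hl),
      mul_nonneg (sq_nonneg s) (sq_nonneg (Real.log s))]
  simpa using this.add_const 1

lemma tendsto_unitMass_div_mul_log (c : WalkCase) :
    Tendsto (fun s => (unitMass c s / s - 1) * (3 - Real.log s) ^ 2) (𝓝[>] 0) (𝓝 0) := by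
  refine tendsto_zero_of_le_small 19 fun s hs hs1 => ?_
  have h := abs_unitMass_sub_le c hs.le hs1
  have e : unitMass c s / s - 1 = (unitMass c s - s) / s := by field_simp
  rw [e, abs_mul, abs_div, abs_of_pos hs, abs_of_nonneg (sq_nonneg (3 - Real.log s)), ← mul_assoc]
  refine mul_le_mul_of_nonneg_right ?_ (sq_nonneg _)
  rw [div_le_iff₀ hs]
  nlinarith

/-- `log (unitMass / s) · log s → 0`. -/
lemma tendsto_log_unitMass_div_mul_log (c : WalkCase) :
    Tendsto (fun s => Real.log (unitMass c s / s) * (3 - Real.log s)) (𝓝[>] 0) (𝓝 0) := by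
  have hev : ∀ᶠ s in 𝓝[>] (0 : ℝ), (1 / 2 : ℝ) < unitMass c s / s :=
    (tendsto_unitMass_div c).eventually (lt_mem_nhds (by norm_num))
  have h0 := ((tendsto_unitMass_div_mul_log c).norm).const_mul 2
  rw [norm_zero, mul_zero] at h0
  refine squeeze_zero_norm' ?_ h0
  filter_upwards [hev, eventually_small] with s h hs
  have hl := Real.log_nonpos hs.1.le hs.2
  have hp : 0 < unitMass c s / s := by linarith
  set y := unitMass c s / s
  have h1 : |Real.log y| ≤ 2 * |y - 1| := by
    have a1 := Real.log_le_sub_one_of_pos hp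
    have a2 := Real.one_sub_inv_le_log_of_pos hp
    have a3 : |1 - y⁻¹| ≤ 2 * |y - 1| := by
      have : 1 - y⁻¹ = (y - 1) * y⁻¹ := by field_simp
      rw [this, abs_mul, abs_of_pos (inv_pos.2 hp), mul_comm]
      gcongr
      rw [inv_le_comm₀ hp two_pos]; linarith
    rw [abs_le]
    constructor
    · linarith [neg_abs_le (1 - y⁻¹)]
    · linarith [le_abs_self (y - 1), abs_nonneg (y - 1)]
  rw [norm_mul, norm_mul, Real.norm_eq_abs, Real.norm_eq_abs, Real.norm_eq_abs,
    Real.norm_eq_abs, ← mul_assoc,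
    abs_of_nonneg (sq_nonneg (3 - Real.log s))]
  refine mul_le_mul h1 ?_ (abs_nonneg _) (by positivity)
  rw [abs_of_nonneg (by linarith)]
  nlinarith

lemma tendsto_log_unitMass_div (c : WalkCase) :
    Tendsto (fun s => Real.log (unitMass c s / s)) (𝓝[>] 0) (𝓝 0) := by
  simpa using (tendsto_unitMass_div c).log one_ne_zero

lemma tendsto_mass_zero (c : WalkCase) : Tendsto (fun s => mass c s 0) (𝓝[>] 0) (𝓝 1) := by
  have : Tendsto (fun s => mass c s 0 - 1) (𝓝[>] 0) (𝓝 0) := by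
    refine tendsto_zero_of_le_small 38 fun s hs hs1 => ?_
    have h := abs_mass_zero_sub_le c hs.le hs1
    have hl := Real.log_nonpos hs.le hs1
    rw [abs_le] at h ⊢
    constructor <;> nlinarith [sq_nonneg s, mul_nonneg hs.le (neg_nonneg.2 hl),
      mul_nonneg hs.le (sq_nonneg (Real.log s)), mul_nonneg hs.le (sub_nonneg.2 hs1)]
  simpa using this.add_const 1

lemma tendsto_info_zero_div (c : WalkCase) :
    Tendsto (fun s => info c s 0 / s) (𝓝[>] 0) (𝓝 1) := by
  have h1 : Tendsto (fun s => (1 - mass c s 0) / s) (𝓝[>] 0) (𝓝 1) := by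
    have : Tendsto (fun s => (1 - mass c s 0) / s - 1) (𝓝[>] 0) (𝓝 0) := by
      refine tendsto_zero_of_le_small 37 fun s hs hs1 => ?_
      have h := abs_mass_zero_sub_le c hs.le hs1
      have hl := Real.log_nonpos hs.le hs1
      have e : (1 - mass c s 0) / s - 1 = -(mass c s 0 - (1 - s)) / s := by field_simp; ring
      rw [e, abs_div, abs_neg, abs_of_pos hs, div_le_iff₀ hs]
      nlinarith [sq_nonneg s, mul_nonneg (sq_nonneg s) (neg_nonneg.2 hl),
        mul_nonneg (sq_nonneg s) (sq_nonneg (Real.log s))]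
    simpa using this.add_const 1
  have h2 : Tendsto (fun s => (1 - mass c s 0) / s / mass c s 0) (𝓝[>] 0) (𝓝 1) := by
    have := h1.div (tendsto_mass_zero c) one_ne_zero
    rwa [div_one] at this
  refine tendsto_of_tendsto_of_tendsto_of_le_of_le' h1 h2 ?_ ?_
  · filter_upwards [eventually_small] with s hs
    have hp : 0 < mass c s 0 := mass_pos c hs.1 (natCast_mem_walkSupport c 0)
    have := Real.log_le_sub_one_of_pos hp
    refine div_le_div_of_nonneg_right ?_ hs.1.le
    unfold info; linarith
  · filter_upwards [eventually_small] with s hs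
    have hp : 0 < mass c s 0 := mass_pos c hs.1 (natCast_mem_walkSupport c 0)
    have := Real.one_sub_inv_le_log_of_pos hp
    rw [div_right_comm]
    refine div_le_div_of_nonneg_right ?_ hs.1.le
    have e : (1 - mass c s 0) / mass c s 0 = (mass c s 0)⁻¹ - 1 := by field_simp
    rw [e]
    unfold info; linarith

lemma info_one_eq (c : WalkCase) {s : ℝ} (hs : 0 < s) :
    info c s 1 = jumpEntropy c - Real.log s - Real.log (unitMass c s / s) := by
  rw [info_one c hs, Real.log_div (unitMass_pos c hs).ne' hs.ne']
  ring

/-- `H(s) = s log (1 / s) + (1 + h) s + o(s)`, where `h` is the entropy of a jump. The main terms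
are the contributions of no jump, which is `s + o(s)`, and of one jump. -/
lemma tendsto_entropy_small (c : WalkCase) :
    Tendsto (fun s => entropy c s / s + Real.log s) (𝓝[>] 0) (𝓝 (1 + jumpEntropy c)) := by
  -- at least two net jumps, then one jump
  have htail : Tendsto (fun s => tailMean c s (info c s) / s) (𝓝[>] 0) (𝓝 0) := by
    refine tendsto_zero_of_le_small 18 fun s hs hs1 => ?_
    have hl := Real.log_nonpos hs.le hs1
    have h := abs_tailMean_le c hs.le hs1 (polyGrowth_info c hs.le) (K := 3 - Real.log s)
      (by linarith) (fun x hx => by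
        have h0 : x ≠ 0 := by rintro rfl; simp at hx
        rw [abs_of_nonneg (info_nonneg c hs.le x)]
        refine (info_le_of_small c hs hs1 h0).trans ?_
        exact mul_le_mul_of_nonneg_left (cast_sq_le_pow_four x) (by linarith))
    rw [abs_div, abs_of_pos hs, div_le_iff₀ hs]
    refine h.trans ?_
    have : 3 - Real.log s ≤ (3 - Real.log s) ^ 2 := by nlinarith
    nlinarith [mul_le_mul_of_nonneg_right this (sq_nonneg s)]
  have hA : Tendsto (fun s => (unitMass c s / s - 1) * (- Real.log s)) (𝓝[>] 0) (𝓝 0) := by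
    have h0 := (tendsto_unitMass_div_mul_log c).norm
    rw [norm_zero] at h0
    refine squeeze_zero_norm' ?_ h0
    filter_upwards [eventually_small] with s hs
    have hl := Real.log_nonpos hs.1.le hs.2
    simp only [Real.norm_eq_abs]
    rw [abs_mul, abs_mul, abs_of_nonneg (neg_nonneg.2 hl),
      abs_of_nonneg (sq_nonneg (3 - Real.log s))]
    refine mul_le_mul_of_nonneg_left ?_ (abs_nonneg _)
    nlinarith
  have h1 := ((tendsto_mass_zero c).mul (tendsto_info_zero_div c))
  have h2 := (tendsto_unitMass_div c).mul
    ((tendsto_log_unitMass_div c).const_sub (jumpEntropy c))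
  have h3 := (((h1.add hA).add h2).add htail)
  rw [show (1 * 1 + 0 + 1 * (jumpEntropy c - 0) + 0 : ℝ) = 1 + jumpEntropy c by ring] at h3
  refine h3.congr' ?_
  filter_upwards [eventually_small] with s hs
  have hs0 := hs.1.ne'
  have hu := unit_terms_eq c s id
  simp only [id] at hu
  rw [entropy, mean_eq_add_tailMean c hs.1.le (polyGrowth_info c hs.1.le), hu, info_one_eq c hs.1]
  field_simp
  ring

lemma tendsto_entropy_sq_div_small (c : WalkCase) :
    Tendsto (fun s => entropy c s ^ 2 / s) (𝓝[>] 0) (𝓝 0) := by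
  have h := tendsto_entropy_small c
  have h2 : Tendsto (fun s => (entropy c s / s + Real.log s) ^ 2 * s -
      2 * (entropy c s / s + Real.log s) * (s * Real.log s) + s * Real.log s ^ 2)
      (𝓝[>] 0) (𝓝 0) := by
    have := (((h.pow 2).mul tendsto_id_zero).sub ((h.const_mul 2).mul tendsto_mul_log)).add
      tendsto_mul_log_sq
    simpa using this
  refine h2.congr' ?_
  filter_upwards [eventually_small] with s hs
  have hs0 := hs.1.ne'
  field_simp
  ring

lemma tendsto_entropy_zero (c : WalkCase) : Tendsto (entropy c) (𝓝[>] 0) (𝓝 0) := by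
  have h := ((tendsto_entropy_small c).mul tendsto_id_zero).sub tendsto_mul_log
  rw [mul_zero, sub_zero] at h
  refine h.congr' ?_
  filter_upwards [eventually_small] with s hs
  have hs0 := hs.1.ne'
  field_simp
  ring

/-- Only the start from the origin matters, for which a jump creates the information content of a
site at distance one. -/
lemma tendsto_entropyDeriv_small (c : WalkCase) :
    Tendsto (fun s => entropyDeriv c s + Real.log s) (𝓝[>] 0) (𝓝 (jumpEntropy c)) := by
  -- the contribution of the walk having left the origin
  have hrest : ∀ j : ℤ, |j| = 1 → Tendsto (fun s => mean c s fun x =>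
      if x ≠ 0 then info c s (x + j) else 0) (𝓝[>] 0) (𝓝 0) := by
    intro j hj
    refine tendsto_zero_of_le_small 10 fun s hs hs1 => ?_
    have hl := Real.log_nonpos hs.le hs1
    have hX := polyGrowth_cast
    rw [abs_of_nonneg (mean_nonneg hs.le fun x => by
      split_ifs
      · exact info_nonneg c hs.le _
      · exact le_rfl)]
    have h : mean c s (fun x => if x ≠ 0 then info c s (x + j) else 0) ≤
        mean c s fun x => 5 * (3 - Real.log s) * (x : ℝ) ^ 2 := by
      refine mean_mono hs.le (((polyGrowth_info c hs.le).shift j).ite _)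
        ((hX.pow 2).const_mul _) fun x => ?_
      split_ifs with hx
      · have h1 := info_le c hs (x + j)
        rw [abs_of_nonpos hl] at h1
        have hx1 := one_le_cast_sq hx
        have hj2 : (j : ℝ) ^ 2 = 1 := by
          have : ((|j| : ℤ) : ℝ) = 1 := by rw [hj]; simp
          rw [← sq_abs]; push_cast at this; rw [this]; norm_num
        push_cast at h1
        have h2 : ((x : ℝ) + j) ^ 2 ≤ 4 * (x : ℝ) ^ 2 := by
          nlinarith [sq_nonneg ((x : ℝ) - j)]
        nlinarith [mul_le_mul_of_nonneg_left h2 (by linarith : 0 ≤ -Real.log s + 2),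
          mul_nonneg (neg_nonneg.2 hl) (sq_nonneg (x : ℝ))]
      · have := sq_nonneg (x : ℝ)
        have : 0 ≤ 3 - Real.log s := by linarith
        positivity
    rw [mean_const_mul] at h
    have h2 := (mean_cast_sq_bounds c hs.le).2
    have h3 : mean c s (fun x => (x : ℝ) ^ 2) ≤ 2 * s := by nlinarith
    have h4 : 3 - Real.log s ≤ (3 - Real.log s) ^ 2 := by nlinarith
    nlinarith [mul_le_mul_of_nonneg_left h3 (by linarith : 0 ≤ 5 * (3 - Real.log s)),
      mul_le_mul_of_nonneg_right h4 hs.le]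
  have hdec : ∀ j : ℤ, ∀ s : ℝ, 0 < s → mean c s (fun x => info c s (x + j)) =
      mass c s 0 * info c s j + mean c s fun x => if x ≠ 0 then info c s (x + j) else 0 := by
    intro j s hs
    have hQ := (polyGrowth_info c hs.le).shift j
    have h := mean_single c s (fun x => info c s (x + j)) 0
    rw [zero_add] at h
    rw [← h, ← mean_add hs.le (hQ.ite _) (hQ.ite _)]
    congr 1
    ext x
    by_cases hx : x = 0 <;> simp [hx]
  have hm : Tendsto (fun s => (mass c s 0 - 1) * info c s 1) (𝓝[>] 0) (𝓝 0) := by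
    refine tendsto_zero_of_le_small 38 fun s hs hs1 => ?_
    have hl := Real.log_nonpos hs.le hs1
    have h := abs_mass_zero_sub_le c hs.le hs1
    have h1 : |mass c s 0 - 1| ≤ 38 * s := by
      rw [abs_le] at h ⊢
      constructor <;> nlinarith
    have h2 := info_le_of_small c hs hs1 one_ne_zero
    have h3 := info_nonneg c hs.le 1
    rw [abs_mul, abs_of_nonneg h3, ← mul_assoc]
    refine mul_le_mul h1 (h2.trans ?_) h3 (by positivity)
    push_cast
    nlinarith
  have hA : |altJump c| = 1 := by rcases altJump_cases c with h | h <;> simp [h]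
  have h3 := ((hm.add ((tendsto_log_unitMass_div c).const_sub (jumpEntropy c))).add
    (((hrest 1 (by simp)).add (hrest _ hA)).div_const 2)).sub (tendsto_entropy_zero c)
  rw [show (0 + (jumpEntropy c - 0) + (0 + 0) / 2 - 0 : ℝ) = jumpEntropy c by ring] at h3
  refine h3.congr' ?_
  filter_upwards [eventually_small] with s hs
  have h1 := info_one_eq c hs.1
  rw [entropyDeriv, hdec 1 s hs.1, hdec _ s hs.1, info_altJump]
  linear_combination -h1

/-- The variance is, up to `o(s)`, the second moment of the information content on the event of one
jump. -/
lemma tendsto_varentropy_small (c : WalkCase) :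
    Tendsto (fun s => varentropy c s / s - (jumpEntropy c - Real.log s) ^ 2) (𝓝[>] 0) (𝓝 0) := by
  have htail : Tendsto (fun s => tailMean c s (fun x => info c s x ^ 2) / s) (𝓝[>] 0) (𝓝 0) := by
    refine tendsto_zero_of_le_small 18 fun s hs hs1 => ?_
    have hl := Real.log_nonpos hs.le hs1
    have h := abs_tailMean_le c hs.le hs1 ((polyGrowth_info c hs.le).pow 2)
      (K := (3 - Real.log s) ^ 2) (sq_nonneg _) (fun x hx => by
        have h0 : x ≠ 0 := by rintro rfl; simp at hx
        rw [abs_of_nonneg (sq_nonneg _)]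
        have h1 := info_le_of_small c hs hs1 h0
        have h2 := info_nonneg c hs.le x
        calc info c s x ^ 2 ≤ ((3 - Real.log s) * (x : ℝ) ^ 2) ^ 2 := by gcongr
          _ = _ := by ring)
    rw [abs_div, abs_of_pos hs, div_le_iff₀ hs]
    refine h.trans (le_of_eq (by ring))
  have hj0 := jumpEntropy_nonneg c
  have hj1 := jumpEntropy_le_one c
  have hA : Tendsto (fun s => (unitMass c s / s - 1) * (jumpEntropy c - Real.log s) ^ 2)
      (𝓝[>] 0) (𝓝 0) := by
    have h0 := (tendsto_unitMass_div_mul_log c).norm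
    rw [norm_zero] at h0
    refine squeeze_zero_norm' ?_ h0
    filter_upwards [eventually_small] with s hs
    have hl := Real.log_nonpos hs.1.le hs.2
    simp only [Real.norm_eq_abs]
    rw [abs_mul, abs_mul, abs_of_nonneg (sq_nonneg (jumpEntropy c - Real.log s)),
      abs_of_nonneg (sq_nonneg (3 - Real.log s))]
    refine mul_le_mul_of_nonneg_left ?_ (abs_nonneg _)
    nlinarith
  have hB : Tendsto (fun s => Real.log (unitMass c s / s) * (jumpEntropy c - Real.log s))
      (𝓝[>] 0) (𝓝 0) := by
    have h0 := (tendsto_log_unitMass_div_mul_log c).norm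
    rw [norm_zero] at h0
    refine squeeze_zero_norm' ?_ h0
    filter_upwards [eventually_small] with s hs
    have hl := Real.log_nonpos hs.1.le hs.2
    simp only [Real.norm_eq_abs]
    rw [abs_mul, abs_mul, abs_of_nonneg (show 0 ≤ 3 - Real.log s by linarith),
      abs_of_nonneg (show 0 ≤ jumpEntropy c - Real.log s by linarith)]
    refine mul_le_mul_of_nonneg_left ?_ (abs_nonneg _)
    linarith
  have h0 : Tendsto (fun s => mass c s 0 * (info c s 0 / s) ^ 2 * s) (𝓝[>] 0) (𝓝 0) := by
    simpa using ((tendsto_mass_zero c).mul ((tendsto_info_zero_div c).pow 2)).mul tendsto_id_zero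
  have h1 : Tendsto (fun s => unitMass c s / s * (-2 * (Real.log (unitMass c s / s) *
      (jumpEntropy c - Real.log s)) + Real.log (unitMass c s / s) ^ 2)) (𝓝[>] 0) (𝓝 0) := by
    simpa using (tendsto_unitMass_div c).mul
      ((hB.const_mul (-2)).add ((tendsto_log_unitMass_div c).pow 2))
  have h3 := ((((h0.add hA).add h1).add htail).sub (tendsto_entropy_sq_div_small c))
  rw [show (0 + 0 + 0 + 0 - 0 : ℝ) = 0 by ring] at h3
  refine h3.congr' ?_
  filter_upwards [eventually_small] with s hs
  have hs0 := hs.1.ne'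
  have hu := unit_terms_eq c s (fun y => y ^ 2)
  rw [varentropy_eq c hs.1.le, mean_eq_add_tailMean c hs.1.le ((polyGrowth_info c hs.1.le).pow 2),
    hu, info_one_eq c hs.1]
  field_simp
  ring

/-! ### Large times -/

lemma mean_finset_sum {c : WalkCase} {s : ℝ} (hs : 0 ≤ s) {ι : Type*} (A : Finset ι)
    {F : ι → ℤ → ℝ} (hF : ∀ i, PolyGrowth (F i)) :
    mean c s (fun x => ∑ i ∈ A, F i x) = ∑ i ∈ A, mean c s (F i) := by
  unfold mean
  simp only [Finset.mul_sum]
  exact Summable.tsum_finsetSum fun i _ => summable_mean c hs (hF i)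

/-- If the information content is within `o(1)`, in `L²`, of the quadratic
`a + D² / (2 s)` where `D` has the second and fourth moments of the centred walk, then
the entropy is `a + 1 / 2 + o(1)` and the varentropy tends to `1 / 2`. -/
lemma tendsto_of_quadratic_info (c : WalkCase) (D : ℝ → ℤ → ℝ) (a : ℝ → ℝ)
    (hD : ∀ s, PolyGrowth (D s))
    (h2 : ∀ s, 0 < s → mean c s (fun x => D s x ^ 2) = s)
    (h4 : ∀ s, 0 < s → mean c s (fun x => D s x ^ 4) = 3 * s ^ 2 + s)
    (hW : Tendsto (fun s => mean c s fun x => (info c s x - a s - D s x ^ 2 / (2 * s)) ^ 2)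
      atTop (𝓝 0)) :
    Tendsto (fun s => entropy c s - a s) atTop (𝓝 (1 / 2)) ∧
      Tendsto (varentropy c) atTop (𝓝 (1 / 2)) := by
  set W : ℝ → ℤ → ℝ := fun s x => info c s x - a s - D s x ^ 2 / (2 * s) with hWdef
  have hWp : ∀ s, 0 < s → PolyGrowth (W s) := fun s hs =>
    ((polyGrowth_info c hs.le).sub (polyGrowth_const _)).sub (((hD s).pow 2).div_const _)
  set m : ℝ → ℝ := fun s => mean c s (W s) with hm
  have hmW : Tendsto m atTop (𝓝 0) := by
    have h : Tendsto (fun s => √(mean c s fun x => W s x ^ 2)) atTop (𝓝 0) := by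
      simpa using hW.sqrt
    refine squeeze_zero_norm' ?_ h
    filter_upwards [eventually_gt_atTop 0] with s hs
    have := sq_mean_mul_le (c := c) hs.le (hWp s hs) (polyGrowth_const 1)
    simp only [mul_one, one_pow, mean_const hs.le] at this
    exact Real.abs_le_sqrt this
  have hZ : ∀ s, 0 < s → mean c s (fun x => D s x ^ 2 / (2 * s)) = 1 / 2 := by
    intro s hs
    have : (fun x => D s x ^ 2 / (2 * s)) = fun x => (2 * s)⁻¹ * D s x ^ 2 := by
      ext x; rw [div_eq_inv_mul]
    rw [this, mean_const_mul, h2 s hs]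
    field_simp
  have hH : ∀ s, 0 < s → entropy c s = a s + 1 / 2 + m s := by
    intro s hs
    have e : info c s = fun x => (a s + D s x ^ 2 / (2 * s)) + W s x := by
      ext x; simp only [hWdef]; ring
    rw [entropy, e, mean_add hs.le ((polyGrowth_const _).add (((hD s).pow 2).div_const _))
      (hWp s hs), mean_add hs.le (polyGrowth_const _) (((hD s).pow 2).div_const _),
      mean_const hs.le, hZ s hs]
  have hV2 : ∀ s, 0 < s → mean c s (fun x => (D s x ^ 2 / (2 * s) - 1 / 2) ^ 2) =
      1 / 2 + (4 * s)⁻¹ := by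
    intro s hs
    have e : (fun x => (D s x ^ 2 / (2 * s) - 1 / 2) ^ 2) =
        fun x => ((4 * s ^ 2)⁻¹ * D s x ^ 4 - D s x ^ 2 / (2 * s)) + 1 / 4 := by
      ext x; field_simp; ring
    rw [e, mean_add hs.le ((((hD s).pow 4).const_mul _).sub (((hD s).pow 2).div_const _))
      (polyGrowth_const _), mean_sub hs.le (((hD s).pow 4).const_mul _)
      (((hD s).pow 2).div_const _), mean_const hs.le, hZ s hs, mean_const_mul, h4 s hs]
    field_simp
    ring
  have hWV : ∀ s, 0 < s → mean c s (fun x => (W s x - m s) ^ 2) ≤ mean c s fun x => W s x ^ 2 := by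
    intro s hs
    have e : (fun x => (W s x - m s) ^ 2) =
        fun x => W s x ^ 2 - (2 * m s) * W s x + m s ^ 2 := by ext x; ring
    rw [e, mean_add hs.le (((hWp s hs).pow 2).sub ((hWp s hs).const_mul _)) (polyGrowth_const _),
      mean_sub hs.le ((hWp s hs).pow 2) ((hWp s hs).const_mul _), mean_const_mul, mean_const hs.le]
    have : mean c s (W s) = m s := rfl
    rw [this]
    nlinarith [sq_nonneg (m s)]
  have hWVt : Tendsto (fun s => mean c s fun x => (W s x - m s) ^ 2) atTop (𝓝 0) := by
    refine squeeze_zero' ?_ ?_ hW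
    · filter_upwards [eventually_gt_atTop 0] with s hs
      exact mean_nonneg hs.le fun x => sq_nonneg _
    · filter_upwards [eventually_gt_atTop 0] with s hs
      exact hWV s hs
  have hinv : Tendsto (fun s : ℝ => 1 / 2 + (4 * s)⁻¹) atTop (𝓝 (1 / 2)) := by
    simpa using (tendsto_inv_atTop_zero.comp
      (tendsto_id.const_mul_atTop (by norm_num : (0 : ℝ) < 4))).const_add (1 / 2 : ℝ)
  constructor
  · have : Tendsto (fun s => 1 / 2 + m s) atTop (𝓝 (1 / 2)) := by
      simpa using hmW.const_add (1 / 2 : ℝ)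
    refine this.congr' ?_
    filter_upwards [eventually_gt_atTop 0] with s hs
    rw [hH s hs]; ring
  · have hcross : Tendsto (fun s => mean c s fun x =>
        (D s x ^ 2 / (2 * s) - 1 / 2) * (W s x - m s)) atTop (𝓝 0) := by
      have h : Tendsto (fun s => √((1 / 2 + (4 * s)⁻¹) * mean c s fun x => (W s x - m s) ^ 2))
          atTop (𝓝 0) := by
        simpa using (hinv.mul hWVt).sqrt
      refine squeeze_zero_norm' ?_ h
      filter_upwards [eventually_gt_atTop 0] with s hs
      have := sq_mean_mul_le (c := c) hs.le
        ((((hD s).pow 2).div_const (2 * s)).sub (polyGrowth_const (1 / 2)))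
        ((hWp s hs).sub (polyGrowth_const (m s)))
      rw [hV2 s hs] at this
      exact Real.abs_le_sqrt this
    have h := (hinv.add (hcross.const_mul 2)).add hWVt
    simp only [mul_zero, add_zero] at h
    refine h.congr' ?_
    filter_upwards [eventually_gt_atTop 0] with s hs
    have hp1 := (((hD s).pow 2).div_const (2 * s)).sub (polyGrowth_const (1 / 2))
    have hp2 := (hWp s hs).sub (polyGrowth_const (m s))
    have e : (fun x => (info c s x - entropy c s) ^ 2) = fun x =>
        (D s x ^ 2 / (2 * s) - 1 / 2) ^ 2 +
        2 * ((D s x ^ 2 / (2 * s) - 1 / 2) * (W s x - m s)) + (W s x - m s) ^ 2 := by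
      ext x
      rw [hH s hs]
      simp only [hWdef]
      ring
    rw [varentropy, e, mean_add hs.le ((hp1.pow 2).add ((hp1.mul hp2).const_mul 2)) (hp2.pow 2),
      mean_add hs.le (hp1.pow 2) ((hp1.mul hp2).const_mul 2), mean_const_mul, hV2 s hs]

/-! ### Large times: the Poisson process -/

lemma polyGrowth_centred (s : ℝ) : PolyGrowth fun x => (x : ℝ) - s :=
  polyGrowth_cast.sub (polyGrowth_const s)

/-- Recursion for the central moments of the Poisson distribution. -/
lemma poisson_central_moment_succ {s : ℝ} (hs : 0 ≤ s) (n : ℕ) :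
    mean .directed s (fun x => ((x : ℝ) - s) ^ (n + 1)) =
      s * ∑ j ∈ Finset.range n, (n.choose j : ℝ) * mean .directed s fun x => ((x : ℝ) - s) ^ j := by
  have hp := polyGrowth_centred s
  have e : (fun x : ℤ => ((x : ℝ) - s) ^ (n + 1)) =
      fun x : ℤ => (x : ℝ) * ((x : ℝ) - s) ^ n - s * ((x : ℝ) - s) ^ n := by
    ext x; ring
  have e2 : (fun x : ℤ => (((x + 1 : ℤ) : ℝ) - s) ^ n) = fun x : ℤ =>
      (∑ j ∈ Finset.range n, (n.choose j : ℝ) * ((x : ℝ) - s) ^ j) + ((x : ℝ) - s) ^ n := by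
    ext x
    have : ((x + 1 : ℤ) : ℝ) - s = ((x : ℝ) - s) + 1 := by push_cast; ring
    rw [this, add_pow, Finset.sum_range_succ]
    simp [mul_comm]
  have hsum : PolyGrowth fun x : ℤ =>
      ∑ j ∈ Finset.range n, (n.choose j : ℝ) * ((x : ℝ) - s) ^ j := by
    induction (Finset.range n) using Finset.induction_on with
    | empty => simpa using polyGrowth_const 0
    | insert a A ha ih =>
      simp only [Finset.sum_insert ha]
      exact ((hp.pow a).const_mul _).add ih
  have hcast : PolyGrowth fun x : ℤ => (x : ℝ) * ((x : ℝ) - s) ^ n := polyGrowth_cast.mul (hp.pow n)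
  rw [e, mean_sub hs hcast ((hp.pow n).const_mul s), mean_cast_mul_directed hs (hp.pow n), e2,
    mean_add hs hsum (hp.pow n), mean_const_mul, mean_finset_sum hs _
      (fun j => (hp.pow j).const_mul _)]
  simp only [mean_const_mul]
  ring

lemma poisson_central_moment_zero {s : ℝ} (hs : 0 ≤ s) :
    mean .directed s (fun x => ((x : ℝ) - s) ^ 0) = 1 := by simpa using mean_const hs 1

lemma poisson_central_moments {s : ℝ} (hs : 0 ≤ s) :
    mean .directed s (fun x => ((x : ℝ) - s) ^ 1) = 0 ∧
    mean .directed s (fun x => ((x : ℝ) - s) ^ 2) = s ∧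
    mean .directed s (fun x => ((x : ℝ) - s) ^ 3) = s ∧
    mean .directed s (fun x => ((x : ℝ) - s) ^ 4) = 3 * s ^ 2 + s ∧
    mean .directed s (fun x => ((x : ℝ) - s) ^ 6) = 15 * s ^ 3 + 25 * s ^ 2 + s ∧
    mean .directed s (fun x => ((x : ℝ) - s) ^ 8) =
      105 * s ^ 4 + 490 * s ^ 3 + 119 * s ^ 2 + s := by
  have m0 := poisson_central_moment_zero hs
  have m1 := poisson_central_moment_succ hs 0
  have m2 := poisson_central_moment_succ hs 1
  have m3 := poisson_central_moment_succ hs 2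
  have m4 := poisson_central_moment_succ hs 3
  have m5 := poisson_central_moment_succ hs 4
  have m6 := poisson_central_moment_succ hs 5
  have m7 := poisson_central_moment_succ hs 6
  have m8 := poisson_central_moment_succ hs 7
  simp only [Finset.sum_range_zero, zero_add] at m1
  simp only [Finset.sum_range_succ, Finset.sum_range_zero, Nat.reduceAdd, m0, zero_add] at m2
  simp only [Finset.sum_range_succ, Finset.sum_range_zero, Nat.reduceAdd, m0, m1, zero_add] at m3
  simp only [Finset.sum_range_succ, Finset.sum_range_zero, Nat.reduceAdd, m0, m1, m2,
    zero_add] at m4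
  simp only [Finset.sum_range_succ, Finset.sum_range_zero, Nat.reduceAdd, m0, m1, m2, m3,
    zero_add] at m5
  simp only [Finset.sum_range_succ, Finset.sum_range_zero, Nat.reduceAdd, m0, m1, m2, m3, m4,
    zero_add] at m6
  simp only [Finset.sum_range_succ, Finset.sum_range_zero, Nat.reduceAdd, m0, m1, m2, m3, m4, m5,
    zero_add] at m7
  simp only [Finset.sum_range_succ, Finset.sum_range_zero, Nat.reduceAdd, m0, m1, m2, m3, m4, m5,
    m6, zero_add] at m8
  norm_num [Nat.choose] at m1 m2 m3 m4 m5 m6 m7 m8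
  refine ⟨by simpa using m1, m2, ?_, ?_, ?_, ?_⟩
  · rw [m3]
  · rw [m4]; ring
  · rw [m6]; ring
  · rw [m8]; ring

/-- Size-biasing turns division by `X + 1` into a shift. -/
lemma mean_shift_mul_div_le {s : ℝ} (hs : 0 ≤ s) {F : ℤ → ℝ} (hF : PolyGrowth F)
    (h0 : ∀ x, 0 ≤ F x) :
    mean .directed s (fun x => F (x + 1) * (s / ((x : ℝ) + 1))) ≤ mean .directed s F := by
  have hG : PolyGrowth fun x : ℤ => F x / (x : ℝ) := by
    refine hF.mono fun x => ?_
    rcases eq_or_ne x 0 with h | h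
    · simp [h]
    · rw [abs_div]
      refine div_le_self (abs_nonneg _) ?_
      exact_mod_cast Int.one_le_abs h
  have h := mean_cast_mul_directed hs hG
  have e : mean .directed s (fun x => F (x + 1) * (s / ((x : ℝ) + 1))) =
      mean .directed s fun x => (x : ℝ) * (F x / (x : ℝ)) := by
    rw [h, ← mean_const_mul]
    congr 1
    ext x
    push_cast
    ring
  rw [e]
  refine mean_mono hs (polyGrowth_cast.mul hG) hF fun x => ?_
  rcases eq_or_ne x 0 with h | h
  · simpa [h] using h0 0
  · have : (x : ℝ) ≠ 0 := by exact_mod_cast h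
    rw [mul_div_cancel₀ _ this]

/-- A function that vanishes at `1` and increases away from it is nonnegative. -/
lemma nonneg_of_deriv_mul_sub_one_nonneg {f f' : ℝ → ℝ} (hf : ∀ z, 0 < z → HasDerivAt f (f' z) z)
    (h1 : f 1 = 0) (hs : ∀ z, 0 < z → 0 ≤ f' z * (z - 1)) {z : ℝ} (hz : 0 < z) : 0 ≤ f z := by
  have key : ∀ y w : ℝ, 0 < y → y < w → ∃ ξ ∈ Ioo y w, f w - f y = f' ξ * (w - y) := by
    intro y w hy hyw
    obtain ⟨ξ, hξ, h⟩ := exists_hasDerivAt_eq_slope f f' hyw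
      (fun t ht => (hf t (hy.trans_le ht.1)).continuousAt.continuousWithinAt)
      (fun t ht => hf t (hy.trans ht.1))
    refine ⟨ξ, hξ, ?_⟩
    have : w - y ≠ 0 := by linarith [sub_pos.2 hyw]
    rw [h]; field_simp
  rcases lt_trichotomy z 1 with h | h | h
  · obtain ⟨ξ, hξ, e⟩ := key z 1 hz h
    have := hs ξ (hz.trans hξ.1)
    have h2 : f' ξ ≤ 0 := by
      by_contra! h3
      nlinarith [mul_pos h3 (sub_pos.2 hξ.2)]
    nlinarith [mul_nonneg (neg_nonneg.2 h2) (sub_pos.2 h).le]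
  · rw [h, h1]
  · obtain ⟨ξ, hξ, e⟩ := key 1 z one_pos h
    have := hs ξ (one_pos.trans hξ.1)
    have h2 : 0 ≤ f' ξ := by
      by_contra! h3
      nlinarith [mul_pos (neg_pos.2 h3) (sub_pos.2 hξ.1)]
    nlinarith [mul_nonneg h2 (sub_pos.2 h).le]

lemma hasDerivAt_log_cubic {z : ℝ} (hz : 0 < z) : HasDerivAt
    (fun z : ℝ => (z - 1) - (z - 1) ^ 2 / 2 + (z - 1) ^ 3 / 3 - Real.log z)
    ((z - 1) ^ 3 / z) z := by
  have h0 := (hasDerivAt_id z).sub_const (1 : ℝ)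
  have h := ((h0.sub ((h0.pow 2).div_const 2)).add ((h0.pow 3).div_const 3)).sub
    (Real.hasDerivAt_log hz.ne')
  convert! h using 1
  simp
  field_simp
  ring

/-- The cubic Taylor polynomial of the logarithm is an upper bound on the whole half-line. -/
lemma log_le_cubic {z : ℝ} (hz : 0 < z) :
    Real.log z ≤ (z - 1) - (z - 1) ^ 2 / 2 + (z - 1) ^ 3 / 3 := by
  have := nonneg_of_deriv_mul_sub_one_nonneg (fun z hz => hasDerivAt_log_cubic hz) (by simp)
    (fun z hz => by
      have : (z - 1) ^ 3 / z * (z - 1) = ((z - 1) ^ 2) ^ 2 / z := by ring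
      rw [this]; positivity) hz
  linarith

/-- The error term `(z - 1) ^ 4 / z` makes the Taylor bound valid down to `0`; the factor `1 / z`
is harmless after size-biasing. -/
lemma cubic_sub_le_log {z : ℝ} (hz : 0 < z) :
    (z - 1) - (z - 1) ^ 2 / 2 + (z - 1) ^ 3 / 3 - (z - 1) ^ 4 / z ≤ Real.log z := by
  have h : ∀ z : ℝ, 0 < z → HasDerivAt (fun z : ℝ => (z - 1) ^ 4 / z -
      ((z - 1) - (z - 1) ^ 2 / 2 + (z - 1) ^ 3 / 3 - Real.log z))
      ((z - 1) ^ 3 * (2 * z + 1) / z ^ 2) z := by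
    intro z hz
    have h0 := (hasDerivAt_id z).sub_const (1 : ℝ)
    have h := ((h0.pow 4).div (hasDerivAt_id z) hz.ne').sub (hasDerivAt_log_cubic hz)
    convert! h using 1
    simp
    field_simp
    ring
  have := nonneg_of_deriv_mul_sub_one_nonneg h (by simp) (fun z hz => by
    have : (z - 1) ^ 3 * (2 * z + 1) / z ^ 2 * (z - 1) =
      ((z - 1) ^ 2) ^ 2 * (2 * z + 1) / z ^ 2 := by ring
    rw [this]; positivity) hz
  linarith

/-- This is `u² ≤ sinh² u` at `u = log z / 2`. -/
lemma sq_log_le {z : ℝ} (hz : 0 < z) : Real.log z ^ 2 ≤ z - 2 + z⁻¹ := by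
  have h1 : |Real.log z / 2| ≤ |Real.sinh (Real.log z / 2)| := by
    rw [Real.abs_sinh]
    exact Real.self_le_sinh_iff.2 (abs_nonneg _)
  have h2 := sq_le_sq.2 h1
  have h3 : (2 * Real.sinh (Real.log z / 2)) ^ 2 = z - 2 + z⁻¹ := by
    have e1 : Real.exp (Real.log z / 2) ^ 2 = z := by
      rw [← Real.exp_nat_mul]; push_cast; rw [mul_div_cancel₀ _ two_ne_zero, Real.exp_log hz]
    have e2 : Real.exp (-(Real.log z / 2)) ^ 2 = z⁻¹ := by
      rw [Real.exp_neg, inv_pow, e1]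
    have e3 : Real.exp (Real.log z / 2) * Real.exp (-(Real.log z / 2)) = 1 := by
      rw [← Real.exp_add]; simp
    rw [Real.sinh_eq]
    linear_combination e1 + e2 - 2 * e3
  nlinarith

/-- Quadratic approximation of the Poisson rate function. -/
lemma sq_poisson_rate_le {s : ℝ} (hs : 0 < s) (n : ℕ) :
    ((n : ℝ) * Real.log (n / s) - n + s - ((n : ℝ) - s) ^ 2 / (2 * s)) ^ 2 ≤
      ((n : ℝ) - s) ^ 6 / s ^ 4 + ((n : ℝ) - s) ^ 8 / s ^ 6 := by
  -- both sides are functions of the relative deviation `w = n / s - 1`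
  set z : ℝ := n / s with hz
  set w : ℝ := z - 1 with hw
  have hn : (n : ℝ) = s * z := by rw [hz]; field_simp
  have hD : (n : ℝ) - s = s * w := by rw [hw, hn]; ring
  have hz0 : 0 ≤ z := by positivity
  have hlow : -w ^ 3 / 6 - 2 * w ^ 4 / 3 ≤ z * Real.log z - w - w ^ 2 / 2 := by
    rcases hz0.eq_or_lt with h | h
    · have : w = -1 := by rw [hw, ← h]; ring
      rw [this, ← h]; norm_num
    · have h1 := mul_le_mul_of_nonneg_left (cubic_sub_le_log h) hz0
      have h2 : z * ((z - 1) ^ 4 / z) = w ^ 4 := by rw [hw]; field_simp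
      rw [mul_sub, h2, ← hw] at h1
      have : z = 1 + w := by rw [hw]; ring
      rw [this] at h1 ⊢
      linarith
  have hup : z * Real.log z - w - w ^ 2 / 2 ≤ -w ^ 3 / 6 + w ^ 4 / 3 := by
    rcases hz0.eq_or_lt with h | h
    · have : w = -1 := by rw [hw, ← h]; ring
      rw [this, ← h]; norm_num
    · have h1 := mul_le_mul_of_nonneg_left (log_le_cubic h) hz0
      rw [← hw] at h1
      have : z = 1 + w := by rw [hw]; ring
      rw [this] at h1 ⊢
      linarith
  have e1 : (n : ℝ) * Real.log z - n + s - ((n : ℝ) - s) ^ 2 / (2 * s) =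
      s * (z * Real.log z - w - w ^ 2 / 2) := by
    rw [hD, hn, hw]; field_simp; ring
  have e2 : ((n : ℝ) - s) ^ 6 / s ^ 4 + ((n : ℝ) - s) ^ 8 / s ^ 6 = s ^ 2 * (w ^ 6 + w ^ 8) := by
    rw [hD]; field_simp
  rw [e1, e2, mul_pow]
  refine mul_le_mul_of_nonneg_left ?_ (sq_nonneg s)
  set y := z * Real.log z - w - w ^ 2 / 2
  have h3 : (y + w ^ 3 / 6) ^ 2 ≤ (2 * w ^ 4 / 3) ^ 2 := by
    have : 0 ≤ w ^ 4 := by positivity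
    apply sq_le_sq'
    · linarith
    · linarith
  nlinarith [sq_nonneg (y + 2 * (w ^ 3 / 6)), sq_nonneg (w ^ 3), sq_nonneg (w ^ 4)]

/-- Deviation of `log n!` from a version of Stirling's formula that is valid at `0` as well. -/
noncomputable def stirlingError (n : ℕ) : ℝ :=
  Real.log n ! + n - n * Real.log n - Real.log (n + 1) / 2 - Real.log (2 * Real.pi) / 2

lemma tendsto_stirlingError : Tendsto stirlingError atTop (𝓝 0) := by
  have h1 : Tendsto (fun n : ℕ => Real.log (Stirling.stirlingSeq n)) atTop
      (𝓝 (Real.log (√Real.pi))) :=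
    (Stirling.tendsto_stirlingSeq_sqrt_pi).log (by positivity)
  have h2 : Tendsto (fun n : ℕ => Real.log ((n : ℝ) / (n + 1)) / 2) atTop (𝓝 0) := by
    have := ((tendsto_natCast_div_add_atTop (1 : ℝ)).log one_ne_zero).div_const 2
    simpa using this
  have h3 := (h1.sub_const (Real.log (√Real.pi))).add h2
  rw [sub_self, add_zero] at h3
  refine h3.congr' ?_
  filter_upwards [eventually_ge_atTop 1] with n hn
  have hn0 : (n : ℝ) ≠ 0 := by positivity
  rw [Stirling.log_stirlingSeq_formula, stirlingError, Real.log_sqrt Real.pi_pos.le,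
    Real.log_div hn0 (by positivity), Real.log_div hn0 (by positivity), Real.log_exp,
    Real.log_mul two_ne_zero hn0, Real.log_mul two_ne_zero (by positivity)]
  ring

lemma info_directed {s : ℝ} (hs : 0 < s) (n : ℕ) :
    info .directed s n = s - n * Real.log s + Real.log n ! := by
  rw [info, mass_directed_natCast, Real.log_div (by positivity) (by positivity),
    Real.log_mul (by positivity) (by positivity), Real.log_exp, Real.log_pow]
  ring

/-- The information content minus its quadratic approximation splits into an error in the rate
function, an error in the formula of Stirling and the fluctuation of the prefactor. -/
lemma info_directed_eq {s : ℝ} (hs : 0 < s) (n : ℕ) :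
    info .directed s n - Real.log (2 * Real.pi * s) / 2 - ((n : ℝ) - s) ^ 2 / (2 * s) =
      ((n : ℝ) * Real.log (n / s) - n + s - ((n : ℝ) - s) ^ 2 / (2 * s)) + stirlingError n +
        Real.log ((n + 1) / s) / 2 := by
  have e : (n : ℝ) * Real.log (n / s) = n * Real.log n - n * Real.log s := by
    rcases Nat.eq_zero_or_pos n with h | h
    · simp [h]
    · rw [Real.log_div (by positivity) hs.ne']; ring
  rw [info_directed hs, e, stirlingError, Real.log_div (by positivity) hs.ne',
    Real.log_mul (by positivity) hs.ne']
  ring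

/-- A function vanishing at infinity has vanishing mean along the Poisson process. -/
lemma tendsto_mean_sq_of_tendsto_zero {b : ℕ → ℝ} (hb : Tendsto b atTop (𝓝 0)) :
    PolyGrowth (fun x => b x.toNat ^ 2) ∧
      Tendsto (fun s => mean .directed s fun x => b x.toNat ^ 2) atTop (𝓝 0) := by
  obtain ⟨B, hB⟩ := hb.norm.bddAbove_range
  have hB' : ∀ n, b n ^ 2 ≤ B ^ 2 := fun n => by
    have : |b n| ≤ B := hB ⟨n, rfl⟩
    rw [← sq_abs]; gcongr
  have hp : PolyGrowth (fun x => b x.toNat ^ 2) :=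
    (polyGrowth_const (B ^ 2)).mono fun x => by
      rw [abs_of_nonneg (sq_nonneg _), abs_of_nonneg (sq_nonneg _)]; exact hB' _
  refine ⟨hp, ?_⟩
  rw [Metric.tendsto_atTop]
  intro ε hε
  have h2 : Tendsto (fun n => b n ^ 2) atTop (𝓝 0) := by simpa using hb.pow 2
  obtain ⟨M, hM⟩ := eventually_atTop.1 (h2.eventually (gt_mem_nhds (half_pos hε)))
  refine ⟨max (2 * M + 1) ((8 * B ^ 2 + 1) / ε), fun s hs => ?_⟩
  have hs1 : (2 * M + 1 : ℝ) ≤ s := (le_max_left _ _).trans hs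
  have hs2 : (8 * B ^ 2 + 1) / ε ≤ s := (le_max_right _ _).trans hs
  have hM0 : (0 : ℝ) ≤ M := Nat.cast_nonneg M
  have hs0 : 0 < s := by linarith
  have hD := polyGrowth_centred s
  rw [Real.dist_eq, sub_zero, abs_of_nonneg (mean_nonneg hs0.le fun x => sq_nonneg _)]
  have h3 : mean .directed s (fun x => b x.toNat ^ 2) ≤
      mean .directed s fun x => ε / 2 + (4 * B ^ 2 / s ^ 2) * ((x : ℝ) - s) ^ 2 := by
    refine mean_mono_of_mem hs0.le hp ((polyGrowth_const _).add ((hD.pow 2).const_mul _))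
      fun x hx => ?_
    lift x to ℕ using hx
    rw [Int.toNat_natCast, Int.cast_natCast]
    -- sites beyond `M` have a small value, the others are far from the mean `s`
    rcases le_or_gt M x with h | h
    · have := hM x h
      have : 0 ≤ 4 * B ^ 2 / s ^ 2 * ((x : ℝ) - s) ^ 2 := by positivity
      linarith
    · have h4 : (x : ℝ) ≤ M := by exact_mod_cast h.le
      have h5 : s ^ 2 / 4 ≤ ((x : ℝ) - s) ^ 2 := by nlinarith
      have h6 : B ^ 2 ≤ 4 * B ^ 2 / s ^ 2 * ((x : ℝ) - s) ^ 2 := by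
        calc B ^ 2 = 4 * B ^ 2 / s ^ 2 * (s ^ 2 / 4) := by field_simp
          _ ≤ _ := by gcongr
      linarith [hB' x]
  rw [mean_add hs0.le (polyGrowth_const _) ((hD.pow 2).const_mul _), mean_const hs0.le,
    mean_const_mul, (poisson_central_moments hs0.le).2.1] at h3
  have h4 : 4 * B ^ 2 / s ^ 2 * s = 4 * B ^ 2 / s := by field_simp
  have h5 : 4 * B ^ 2 / s < ε / 2 := by
    rw [div_le_iff₀ hε] at hs2
    rw [div_lt_iff₀ hs0]
    linarith
  linarith

lemma polyGrowth_div_succ (s : ℝ) : PolyGrowth fun x : ℤ => s / ((x : ℝ) + 1) := by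
  refine (polyGrowth_const s).mono fun x => ?_
  rcases eq_or_ne (x + 1) 0 with h | h
  · have : (x : ℝ) + 1 = 0 := by exact_mod_cast h
    simp [this]
  · rw [abs_div]
    refine div_le_self (abs_nonneg _) ?_
    exact_mod_cast Int.one_le_abs h

/-- The information content of the Poisson process is quadratic up to `o(1)` in `L²`. -/
lemma tendsto_info_directed_sub : Tendsto (fun s => mean .directed s fun x =>
    (info .directed s x - Real.log (2 * Real.pi * s) / 2 - ((x : ℝ) - s) ^ 2 / (2 * s)) ^ 2)
    atTop (𝓝 0) := by
  obtain ⟨hbp, hb⟩ := tendsto_mean_sq_of_tendsto_zero tendsto_stirlingError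
  have hR : Tendsto (fun s : ℝ => 2269 / s) atTop (𝓝 0) := tendsto_const_nhds.div_atTop tendsto_id
  have hR2 := (hR.add (hb.const_mul 3))
  rw [mul_zero, add_zero] at hR2
  refine squeeze_zero' ?_ ?_ hR2
  · filter_upwards [eventually_ge_atTop 0] with s hs
    exact mean_nonneg hs fun x => sq_nonneg _
  filter_upwards [eventually_ge_atTop 1] with s hs1
  have hs : 0 < s := by linarith
  have hD := polyGrowth_centred s
  have hX := polyGrowth_cast
  have hZ : PolyGrowth fun x : ℤ => ((x : ℝ) + 1) / s - 2 + s / ((x : ℝ) + 1) :=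
    (((hX.add (polyGrowth_const 1)).div_const s).sub (polyGrowth_const 2)).add
      (polyGrowth_div_succ s)
  have hpow : PolyGrowth fun x : ℤ => ((x : ℝ) - s) ^ 6 / s ^ 4 + ((x : ℝ) - s) ^ 8 / s ^ 6 :=
    ((hD.pow 6).div_const _).add ((hD.pow 8).div_const _)
  have hle : mean .directed s (fun x =>
      (info .directed s x - Real.log (2 * Real.pi * s) / 2 - ((x : ℝ) - s) ^ 2 / (2 * s)) ^ 2) ≤
      mean .directed s fun x => 3 * (((x : ℝ) - s) ^ 6 / s ^ 4 + ((x : ℝ) - s) ^ 8 / s ^ 6) +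
        3 * stirlingError x.toNat ^ 2 + (((x : ℝ) + 1) / s - 2 + s / ((x : ℝ) + 1)) := by
    refine mean_mono_of_mem hs.le ((((polyGrowth_info _ hs.le).sub (polyGrowth_const _)).sub
      ((hD.pow 2).div_const _)).pow 2) (((hpow.const_mul 3).add (hbp.const_mul 3)).add hZ)
      fun x hx => ?_
    lift x to ℕ using hx
    rw [Int.toNat_natCast, Int.cast_natCast, info_directed_eq hs]
    have h1 := sq_poisson_rate_le hs x
    have h2 := sq_log_le (z := ((x : ℝ) + 1) / s) (by positivity)
    rw [inv_div] at h2
    set A := (x : ℝ) * Real.log (x / s) - x + s - ((x : ℝ) - s) ^ 2 / (2 * s)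
    set B := stirlingError x
    set C := Real.log (((x : ℝ) + 1) / s)
    -- `(A + B + C / 2)² ≤ 3 A² + 3 B² + 3 C² / 4`
    nlinarith [sq_nonneg (A - B), sq_nonneg (A - C / 2), sq_nonneg (B - C / 2), sq_nonneg C]
  refine hle.trans ?_
  obtain ⟨_, m2, _, m4, m6, m8⟩ := poisson_central_moments hs.le
  have hdiv : ∀ (F : ℤ → ℝ) (r : ℝ), mean .directed s (fun x => F x / r) =
      mean .directed s F / r := by
    intro F r
    simp only [div_eq_inv_mul]
    exact mean_const_mul _
  have hsb := mean_shift_mul_div_le hs.le (polyGrowth_const 1) (fun _ => zero_le_one)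
  simp only [one_mul, mean_const hs.le] at hsb
  rw [mean_add hs.le ((hpow.const_mul 3).add (hbp.const_mul 3)) hZ,
    mean_add hs.le (hpow.const_mul 3) (hbp.const_mul 3), mean_const_mul, mean_const_mul,
    mean_add hs.le ((hD.pow 6).div_const _) ((hD.pow 8).div_const _), hdiv, hdiv, m6, m8,
    mean_add hs.le (((hX.add (polyGrowth_const 1)).div_const s).sub (polyGrowth_const 2))
      (polyGrowth_div_succ s), mean_sub hs.le ((hX.add (polyGrowth_const 1)).div_const s)
      (polyGrowth_const 2), hdiv, mean_add hs.le hX (polyGrowth_const 1), mean_const hs.le,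
    mean_const hs.le, mean_cast_directed hs.le]
  have e6 : (15 * s ^ 3 + 25 * s ^ 2 + s) / s ^ 4 ≤ 41 / s := by
    rw [div_le_div_iff₀ (by positivity) hs]
    nlinarith [pow_pos hs 2, pow_pos hs 3, mul_nonneg (pow_pos hs 3).le (sub_nonneg.2 hs1),
      mul_nonneg (pow_pos hs 2).le (sub_nonneg.2 hs1)]
  have e8 : (105 * s ^ 4 + 490 * s ^ 3 + 119 * s ^ 2 + s) / s ^ 6 ≤ 715 / s := by
    rw [div_le_div_iff₀ (by positivity) (by positivity)]
    have a0 : s ^ 2 ≤ s ^ 6 := pow_le_pow_right₀ hs1 (by norm_num)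
    have a1 : s ^ 5 ≤ s ^ 6 := pow_le_pow_right₀ hs1 (by norm_num)
    have a2 : s ^ 4 ≤ s ^ 6 := pow_le_pow_right₀ hs1 (by norm_num)
    have a3 : s ^ 3 ≤ s ^ 6 := pow_le_pow_right₀ hs1 (by norm_num)
    nlinarith
  have e1 : (s + 1) / s = 1 + 1 / s := by field_simp
  have e2 : 2269 / s = 3 * (41 / s + 715 / s) + 1 / s := by ring
  rw [e1, e2]
  linarith

/-- Fisher information asymptotics for the Poisson process. -/
lemma tendsto_mul_entropyDeriv_directed :
    Tendsto (fun s => s * entropyDeriv .directed s) atTop (𝓝 (1 / 2)) := by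
  have hX := polyGrowth_cast
  have hform : ∀ s : ℝ, 0 < s → entropyDeriv .directed s =
      mean .directed s fun x => info .directed s (x + 1) - info .directed s x := by
    intro s hs
    have hQ := polyGrowth_info .directed hs.le
    rw [mean_sub hs.le (hQ.shift 1) hQ, entropyDeriv, entropy]
    simp only [altJump]
    ring
  -- the increment of the information content at `n` is `log ((n + 1) / s)`
  have hdiff : ∀ s : ℝ, 0 < s → ∀ n : ℕ, info .directed s ((n : ℤ) + 1) - info .directed s n =
      Real.log (((n : ℝ) + 1) / s) := by
    intro s hs n
    have h := info_directed hs (n + 1)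
    push_cast at h
    rw [h, info_directed hs, Nat.factorial_succ]
    push_cast
    rw [Real.log_mul (by positivity) (by positivity), Real.log_div (by positivity) hs.ne']
    ring
  set w : ℝ → ℤ → ℝ := fun s x => ((x : ℝ) + 1) / s - 1 with hw
  have hwp : ∀ s, PolyGrowth (w s) := fun s =>
    ((hX.add (polyGrowth_const 1)).div_const s).sub (polyGrowth_const 1)
  have hcubp : ∀ s, PolyGrowth fun x => w s x - w s x ^ 2 / 2 + w s x ^ 3 / 3 := fun s =>
    ((hwp s).sub (((hwp s).pow 2).div_const 2)).add (((hwp s).pow 3).div_const 3)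
  have hcub : ∀ s, 0 < s → mean .directed s (fun x => w s x - w s x ^ 2 / 2 + w s x ^ 3 / 3) =
      1 / (2 * s) + (5 / 6) / s ^ 2 + (1 / 3) / s ^ 3 := by
    intro s hs
    have hD := polyGrowth_centred s
    obtain ⟨m1, m2, m3, _⟩ := poisson_central_moments hs.le
    have e : (fun x => w s x - w s x ^ 2 / 2 + w s x ^ 3 / 3) = fun x : ℤ =>
        ((s⁻¹ - s⁻¹ ^ 2 + s⁻¹ ^ 3) * ((x : ℝ) - s) ^ 1 +
          (s⁻¹ ^ 3 - s⁻¹ ^ 2 / 2) * ((x : ℝ) - s) ^ 2) +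
        (s⁻¹ ^ 3 / 3 * ((x : ℝ) - s) ^ 3 + (s⁻¹ - s⁻¹ ^ 2 / 2 + s⁻¹ ^ 3 / 3)) := by
      ext x
      simp only [hw]
      field_simp
      ring
    rw [e, mean_add hs.le (((hD.pow 1).const_mul _).add ((hD.pow 2).const_mul _))
      (((hD.pow 3).const_mul _).add (polyGrowth_const _)),
      mean_add hs.le ((hD.pow 1).const_mul _) ((hD.pow 2).const_mul _),
      mean_add hs.le ((hD.pow 3).const_mul _) (polyGrowth_const _),
      mean_const_mul, mean_const_mul, mean_const_mul, mean_const hs.le, m1, m2, m3]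
    field_simp
    ring
  -- the quartic error in the Taylor expansion, with the denominator removed by size-biasing
  have hQ4 : ∀ s, 0 < s →
      mean .directed s (fun x => w s x ^ 4 * (s / ((x : ℝ) + 1))) ≤ 3 / s ^ 2 + 1 / s ^ 3 := by
    intro s hs
    have hD := polyGrowth_centred s
    have h := mean_shift_mul_div_le hs.le (F := fun x => ((s ^ 4)⁻¹ * ((x : ℝ) - s) ^ 4))
      ((hD.pow 4).const_mul _) (fun x => by positivity)
    rw [mean_const_mul, (poisson_central_moments hs.le).2.2.2.1] at h
    have e : (fun x : ℤ => (s ^ 4)⁻¹ * (((x + 1 : ℤ) : ℝ) - s) ^ 4 * (s / ((x : ℝ) + 1))) =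
        fun x => w s x ^ 4 * (s / ((x : ℝ) + 1)) := by
      ext x
      have : ((x + 1 : ℤ) : ℝ) - s = s * w s x := by
        simp only [hw]; push_cast; field_simp
      rw [this]
      field_simp
    rw [e] at h
    refine h.trans (le_of_eq ?_)
    field_simp
  have hupper : ∀ s, 0 < s → s * entropyDeriv .directed s ≤
      1 / 2 + (5 / 6) / s + (1 / 3) / s ^ 2 := by
    intro s hs
    have hQ := polyGrowth_info .directed hs.le
    have h : entropyDeriv .directed s ≤ 1 / (2 * s) + (5 / 6) / s ^ 2 + (1 / 3) / s ^ 3 := by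
      rw [hform s hs, ← hcub s hs]
      refine mean_mono_of_mem hs.le ((hQ.shift 1).sub hQ) (hcubp s) fun x hx => ?_
      lift x to ℕ using hx
      rw [hdiff s hs]
      exact log_le_cubic (by positivity)
    calc _ ≤ s * (1 / (2 * s) + (5 / 6) / s ^ 2 + (1 / 3) / s ^ 3) := by gcongr
      _ = _ := by field_simp
  have hlower : ∀ s, 0 < s → 1 / 2 - (13 / 6) / s - (2 / 3) / s ^ 2 ≤
      s * entropyDeriv .directed s := by
    intro s hs
    have hQ := polyGrowth_info .directed hs.le
    have hp4 : PolyGrowth fun x => w s x ^ 4 * (s / ((x : ℝ) + 1)) :=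
      ((hwp s).pow 4).mul (polyGrowth_div_succ s)
    have h : (1 / (2 * s) + (5 / 6) / s ^ 2 + (1 / 3) / s ^ 3) - (3 / s ^ 2 + 1 / s ^ 3) ≤
        entropyDeriv .directed s := by
      refine (sub_le_sub_left (hQ4 s hs) _).trans ?_
      rw [hform s hs, ← hcub s hs, ← mean_sub hs.le (hcubp s) hp4]
      refine mean_mono_of_mem hs.le ((hcubp s).sub hp4) ((hQ.shift 1).sub hQ) fun x hx => ?_
      lift x to ℕ using hx
      rw [hdiff s hs]
      have := cubic_sub_le_log (z := ((x : ℝ) + 1) / s) (by positivity)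
      simp only [hw, Int.cast_natCast]
      rwa [← inv_div ((x : ℝ) + 1) s, ← div_eq_mul_inv]
    calc _ = s * ((1 / (2 * s) + (5 / 6) / s ^ 2 + (1 / 3) / s ^ 3) -
          (3 / s ^ 2 + 1 / s ^ 3)) := by field_simp; ring
      _ ≤ _ := by gcongr
  have hinv : ∀ a : ℝ, Tendsto (fun s : ℝ => a / s) atTop (𝓝 0) := fun a =>
    tendsto_const_nhds.div_atTop tendsto_id
  have hinv2 : ∀ a : ℝ, Tendsto (fun s : ℝ => a / s ^ 2) atTop (𝓝 0) := fun a =>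
    tendsto_const_nhds.div_atTop (tendsto_pow_atTop two_ne_zero)
  have t1 := ((hinv (13 / 6)).const_sub (1 / 2)).sub (hinv2 (2 / 3))
  have t2 := ((hinv (5 / 6)).const_add (1 / 2)).add (hinv2 (1 / 3))
  rw [sub_zero, sub_zero] at t1
  rw [add_zero, add_zero] at t2
  refine tendsto_of_tendsto_of_tendsto_of_le_of_le' t1 t2 ?_ ?_
  · filter_upwards [eventually_gt_atTop 0] with s hs using hlower s hs
  · filter_upwards [eventually_gt_atTop 0] with s hs using hupper s hs

lemma tendsto_large_directed :
    Tendsto (fun s => entropy .directed s - Real.log (2 * Real.pi * s) / 2) atTop (𝓝 (1 / 2)) ∧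
      Tendsto (varentropy .directed) atTop (𝓝 (1 / 2)) :=
  tendsto_of_quadratic_info .directed (fun s x => (x : ℝ) - s)
    (fun s => Real.log (2 * Real.pi * s) / 2) polyGrowth_centred
    (fun _ hs => (poisson_central_moments hs.le).2.1)
    (fun _ hs => (poisson_central_moments hs.le).2.2.2.1) tendsto_info_directed_sub

/-! ### Large times: the simple random walk -/

/-- Ratio of consecutive masses of the simple random walk (a quotient of Bessel functions). -/
noncomputable def massRatio (s : ℝ) (n : ℕ) : ℝ :=
  mass .undirected s (n + 1) / mass .undirected s n

lemma mass_undirected_pos {s : ℝ} (hs : 0 < s) (x : ℤ) : 0 < mass .undirected s x :=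
  mass_pos _ hs (by simp [walkSupport])

lemma massRatio_pos {s : ℝ} (hs : 0 < s) (n : ℕ) : 0 < massRatio s n :=
  div_pos (mass_undirected_pos hs _) (mass_undirected_pos hs _)

/-- The three-term recursion of the modified Bessel functions `I_n(s)`, to which the masses are
proportional. -/
lemma mass_undirected_rec {s : ℝ} (hs : 0 < s) (n : ℕ) :
    mass .undirected s n - mass .undirected s (n + 2) =
    2 * (n + 1) / s * mass .undirected s (n + 1) := by
  have h := mass_stein .undirected hs.le (n + 1)
  simp only [altJump] at h
  rw [add_sub_cancel_right, show (n : ℤ) + 1 - -1 = n + 2 by ring] at h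
  push_cast at h
  field_simp
  linarith

/-- The continued fraction recursion for the ratios. -/
lemma inv_massRatio {s : ℝ} (hs : 0 < s) (n : ℕ) :
    (massRatio s n)⁻¹ = 2 * (n + 1) / s + massRatio s (n + 1) := by
  have h := mass_undirected_rec hs n
  have h1 := mass_undirected_pos hs (n + 1)
  have e : ((n + 1 : ℕ) : ℤ) + 1 = n + 2 := by push_cast; ring
  rw [massRatio, massRatio, e, inv_div]
  push_cast
  rw [div_eq_iff h1.ne', add_mul, div_mul_cancel₀ _ h1.ne']
  linarith

lemma massRatio_mul_le_one {s : ℝ} (hs : 0 < s) (n : ℕ) :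
    massRatio s n * massRatio s (n + 1) ≤ 1 := by
  have h := inv_massRatio hs n
  have h1 := massRatio_pos hs n
  have h2 : 0 ≤ 2 * ((n : ℝ) + 1) / s := by positivity
  have h3 : massRatio s (n + 1) ≤ (massRatio s n)⁻¹ := by linarith
  calc _ ≤ massRatio s n * (massRatio s n)⁻¹ := by gcongr
    _ = 1 := mul_inv_cancel₀ h1.ne'

lemma massRatio_sub_eq {s : ℝ} (hs : 0 < s) (n : ℕ) : massRatio s n - massRatio s (n + 1) =
    massRatio s n * massRatio s (n + 1) *
      (2 / s - (massRatio s (n + 1) - massRatio s (n + 2))) := by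
  have h1 := inv_massRatio hs n
  have h2 := inv_massRatio hs (n + 1)
  have p1 := (massRatio_pos hs n).ne'
  have p2 := (massRatio_pos hs (n + 1)).ne'
  have e : 2 / s - (massRatio s (n + 1) - massRatio s (n + 2)) =
      (massRatio s (n + 1))⁻¹ - (massRatio s n)⁻¹ := by
    rw [h1, h2]; push_cast; ring
  rw [e]
  field_simp

/-- Log-concavity of the mass function in quantitative form. The recursion for the differences
of ratios is solved downwards, from sites where the ratio is at most `2 / s`. -/
lemma massRatio_sub_mem {s : ℝ} (hs : 0 < s) (n : ℕ) : 0 ≤ massRatio s n - massRatio s (n + 1) ∧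
    massRatio s n - massRatio s (n + 1) ≤ 2 / s := by
  -- both bounds propagate from `m + 1` to `m`
  have hstep : ∀ m : ℕ, massRatio s (m + 1) - massRatio s (m + 2) ≤ 2 / s →
      0 ≤ massRatio s m - massRatio s (m + 1) := by
    intro m hm
    rw [massRatio_sub_eq hs]
    exact mul_nonneg (mul_pos (massRatio_pos hs _) (massRatio_pos hs _)).le (by linarith)
  have hstep2 : ∀ m : ℕ, 0 ≤ massRatio s (m + 1) - massRatio s (m + 2) →
      massRatio s (m + 1) - massRatio s (m + 2) ≤ 2 / s →
      massRatio s m - massRatio s (m + 1) ≤ 2 / s := by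
    intro m h0 hm
    rw [massRatio_sub_eq hs]
    refine (mul_le_of_le_one_left (by linarith) (massRatio_mul_le_one hs m)).trans (by linarith)
  obtain ⟨N, hN⟩ := exists_nat_ge (s ^ 2)
  have hlarge : ∀ m : ℕ, N ≤ m → massRatio s m - massRatio s (m + 1) ≤ 2 / s := by
    intro m hm
    have h1 := inv_massRatio hs m
    have h2 := massRatio_pos hs (m + 1)
    have h3 := massRatio_pos hs m
    have hm' : s ^ 2 ≤ m := hN.trans (by exact_mod_cast hm)
    have h4 : s ≤ (massRatio s m)⁻¹ := by
      have : s ≤ 2 * ((m : ℝ) + 1) / s := by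
        rw [le_div_iff₀ hs]; nlinarith
      linarith
    have h5 : massRatio s m ≤ s⁻¹ := by
      rwa [le_inv_comm₀ hs h3] at h4
    have h6 : s⁻¹ ≤ 2 / s := by
      rw [inv_eq_one_div]; gcongr; norm_num
    linarith
  have hall : ∀ j m : ℕ, N ≤ m + j → 0 ≤ massRatio s m - massRatio s (m + 1) ∧
      massRatio s m - massRatio s (m + 1) ≤ 2 / s := by
    intro j
    induction j with
    | zero => exact fun m hm => ⟨hstep m (hlarge (m + 1) (by omega)), hlarge m hm⟩
    | succ j ih =>
      intro m hm
      have h := ih (m + 1) (by omega)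
      exact ⟨hstep m h.2, hstep2 m h.1 h.2⟩
  exact hall N n (by omega)

lemma massRatio_antitone {s : ℝ} (hs : 0 < s) : Antitone (massRatio s) :=
  antitone_nat_of_succ_le fun n => by linarith [(massRatio_sub_mem hs n).1]

lemma massRatio_le_one {s : ℝ} (hs : 0 < s) (n : ℕ) : massRatio s n ≤ 1 := by
  refine (massRatio_antitone hs (Nat.zero_le n)).trans ?_
  have h := inv_massRatio hs 0
  have h2 := (massRatio_sub_mem hs 0).2
  have h3 := massRatio_pos hs 0
  have h4 : massRatio s 0 ≤ (massRatio s 0)⁻¹ := by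
    rw [h]; push_cast; simp only [zero_add, mul_one] at *; linarith
  by_contra! h5
  have := inv_lt_one_of_one_lt₀ h5
  linarith

/-- Increment of the information content between the neighbouring sites `n` and `n + 1`. -/
lemma info_succ_sub {s : ℝ} (hs : 0 < s) (n : ℕ) :
    info .undirected s (n + 1) - info .undirected s n = -Real.log (massRatio s n) := by
  rw [massRatio, Real.log_div (mass_undirected_pos hs _).ne' (mass_undirected_pos hs _).ne']
  unfold info; ring

/-- Since the ratios decrease, the recursion bounds `1 / r - r = 2 sinh (- log r)` on both sides. -/
lemma sinh_info_step {s : ℝ} (hs : 0 < s) (n : ℕ) :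
    (n : ℝ) / s ≤ Real.sinh (-Real.log (massRatio s n)) ∧
    Real.sinh (-Real.log (massRatio s n)) ≤ (n + 1) / s := by
  have hp := massRatio_pos hs n
  rw [Real.sinh_eq, neg_neg, Real.exp_neg, Real.exp_log hp]
  constructor
  · cases n with
    | zero =>
      have h := massRatio_le_one hs 0
      have := one_le_inv_iff₀.2 ⟨hp, h⟩
      simp only [Nat.cast_zero, zero_div]
      linarith
    | succ n =>
      have h1 := inv_massRatio hs n
      have h2 := inv_anti₀ hp (massRatio_antitone hs n.le_succ)
      have : 2 * ((n : ℝ) + 1) / s = 2 * (((n + 1 : ℕ) : ℝ) / s) := by push_cast; ring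
      linarith
  · have h1 := inv_massRatio hs n
    have h2 := (massRatio_sub_mem hs n).1
    have : 2 * ((n : ℝ) + 1) / s = 2 * (((n : ℝ) + 1) / s) := by ring
    linarith

/-- A Taylor bound, by comparison of derivatives. -/
lemma sub_cube_le_arsinh {y : ℝ} (hy : 0 ≤ y) : y - y ^ 3 ≤ Real.arsinh y := by
  have hd : ∀ x : ℝ, HasDerivAt (fun x => Real.arsinh x - (x - x ^ 3))
      ((√(1 + x ^ 2))⁻¹ - (1 - 3 * x ^ 2)) x := by
    intro x
    have h := (Real.hasDerivAt_arsinh x).sub ((hasDerivAt_id x).sub (hasDerivAt_pow 3 x))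
    convert! h using 1
  have hm : Monotone (fun x => Real.arsinh x - (x - x ^ 3)) := by
    refine monotone_of_deriv_nonneg (fun x => (hd x).differentiableAt) fun x => ?_
    rw [(hd x).deriv]
    have h1 : √(1 + x ^ 2) ≤ 1 + x ^ 2 := by
      rw [Real.sqrt_le_left (by positivity)]
      nlinarith [sq_nonneg x, sq_nonneg (x ^ 2)]
    have h2 : (1 + x ^ 2)⁻¹ ≤ (√(1 + x ^ 2))⁻¹ := inv_anti₀ (by positivity) h1
    have h3 : 1 - x ^ 2 ≤ (1 + x ^ 2)⁻¹ := by
      rw [inv_eq_one_div, le_div_iff₀ (by positivity)]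
      nlinarith [sq_nonneg (x ^ 2)]
    nlinarith [sq_nonneg x]
  have := hm hy
  simp at this
  linarith

lemma info_step_bounds {s : ℝ} (hs : 0 < s) (n : ℕ) : 0 ≤ -Real.log (massRatio s n) ∧
    -Real.log (massRatio s n) ≤ (n + 1) / s ∧
    (n : ℝ) / s - ((n : ℝ) / s) ^ 3 ≤ -Real.log (massRatio s n) := by
  obtain ⟨h1, h2⟩ := sinh_info_step hs n
  have h0 : 0 ≤ -Real.log (massRatio s n) :=
    neg_nonneg.2 (Real.log_nonpos (massRatio_pos hs n).le (massRatio_le_one hs n))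
  refine ⟨h0, (Real.self_le_sinh_iff.2 h0).trans h2, ?_⟩
  refine (sub_cube_le_arsinh (by positivity)).trans ?_
  rw [← Real.arsinh_sinh (-Real.log (massRatio s n))]
  exact Real.arsinh_le_arsinh.2 h1

/-- The increments add up to a quadratic, with errors that are negligible on the scale `n ∼ √s`. -/
lemma info_natCast_bounds {s : ℝ} (hs : 0 < s) (n : ℕ) :
    info .undirected s n ≤ info .undirected s 0 + ((n : ℝ) ^ 2 + n) / (2 * s) ∧
    info .undirected s 0 + ((n : ℝ) ^ 2 - n) / (2 * s) - (n : ℝ) ^ 4 / s ^ 3 ≤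
      info .undirected s n := by
  induction n with
  | zero => simp
  | succ n ih =>
    have h := info_succ_sub hs n
    obtain ⟨_, h2, h3⟩ := info_step_bounds hs n
    push_cast
    have e1 : (((n : ℝ) + 1) ^ 2 + (n + 1)) / (2 * s) =
        ((n : ℝ) ^ 2 + n) / (2 * s) + (n + 1) / s := by field_simp; ring
    have e2 : (((n : ℝ) + 1) ^ 2 - (n + 1)) / (2 * s) =
        ((n : ℝ) ^ 2 - n) / (2 * s) + n / s := by field_simp; ring
    have e3 : (n : ℝ) ^ 4 / s ^ 3 + ((n : ℝ) / s) ^ 3 ≤ ((n : ℝ) + 1) ^ 4 / s ^ 3 := by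
      rw [div_pow, ← add_div]
      gcongr
      have : (0 : ℝ) ≤ n := Nat.cast_nonneg n
      nlinarith [pow_nonneg this 3, pow_nonneg this 2]
    rw [e1, e2]
    constructor
    · linarith [ih.1]
    · linarith [ih.2]

lemma info_neg_undirected (s : ℝ) (x : ℤ) : info .undirected s (-x) = info .undirected s x := by
  rw [info, mass_neg_undirected, info]

lemma abs_info_sub_le {s : ℝ} (hs : 0 < s) (x : ℤ) :
    |info .undirected s x - info .undirected s 0 - (x : ℝ) ^ 2 / (2 * s)| ≤
      |(x : ℝ)| / (2 * s) + (x : ℝ) ^ 4 / s ^ 3 := by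
  have key : ∀ n : ℕ, |info .undirected s n - info .undirected s 0 - (n : ℝ) ^ 2 / (2 * s)| ≤
      (n : ℝ) / (2 * s) + (n : ℝ) ^ 4 / s ^ 3 := by
    intro n
    obtain ⟨h1, h2⟩ := info_natCast_bounds hs n
    rw [add_div] at h1
    rw [sub_div] at h2
    have : 0 ≤ (n : ℝ) ^ 4 / s ^ 3 := by positivity
    rw [abs_le]
    constructor <;> linarith
  rcases Int.natAbs_eq x with h | h
  · rw [h]; simpa using key x.natAbs
  · have := key x.natAbs
    rw [h, info_neg_undirected]
    simpa [Even.neg_pow (by decide : Even 4)] using this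

lemma moments_undirected {s : ℝ} (hs : 0 < s) :
    mean .undirected s (fun x => (x : ℝ) ^ 4) = 3 * s ^ 2 + s ∧
    mean .undirected s (fun x => (x : ℝ) ^ 8) = 105 * s ^ 4 + 210 * s ^ 3 + 63 * s ^ 2 + s := by
  have hX := polyGrowth_cast
  have m2 := mean_cast_sq_undirected hs.le
  have m4 : mean .undirected s (fun x => (x : ℝ) ^ 4) = 3 * s ^ 2 + s := by
    have h := mean_cast_mul_undirected hs.le (hX.pow 3)
    have e : (fun x : ℤ => ((x + 1 : ℤ) : ℝ) ^ 3 - ((x - 1 : ℤ) : ℝ) ^ 3) =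
        fun x : ℤ => 6 * (x : ℝ) ^ 2 + 2 := by ext x; push_cast; ring
    have e' : (fun x : ℤ => (x : ℝ) * (x : ℝ) ^ 3) = fun x : ℤ => (x : ℝ) ^ 4 := by ext x; ring
    rw [e, e', mean_add hs.le ((hX.pow 2).const_mul 6) (polyGrowth_const 2), mean_const_mul, m2,
      mean_const hs.le] at h
    rw [h]; ring
  have m6 : mean .undirected s (fun x => (x : ℝ) ^ 6) = 15 * s ^ 3 + 15 * s ^ 2 + s := by
    have h := mean_cast_mul_undirected hs.le (hX.pow 5)
    have e : (fun x : ℤ => ((x + 1 : ℤ) : ℝ) ^ 5 - ((x - 1 : ℤ) : ℝ) ^ 5) =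
        fun x : ℤ => (10 * (x : ℝ) ^ 4 + 20 * (x : ℝ) ^ 2) + 2 := by ext x; push_cast; ring
    have e' : (fun x : ℤ => (x : ℝ) * (x : ℝ) ^ 5) = fun x : ℤ => (x : ℝ) ^ 6 := by ext x; ring
    rw [e, e', mean_add hs.le (((hX.pow 4).const_mul _).add ((hX.pow 2).const_mul _))
      (polyGrowth_const 2), mean_add hs.le ((hX.pow 4).const_mul _) ((hX.pow 2).const_mul _),
      mean_const_mul, mean_const_mul, m2, m4, mean_const hs.le] at h
    rw [h]; ring
  refine ⟨m4, ?_⟩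
  have h := mean_cast_mul_undirected hs.le (hX.pow 7)
  have e : (fun x : ℤ => ((x + 1 : ℤ) : ℝ) ^ 7 - ((x - 1 : ℤ) : ℝ) ^ 7) =
      fun x : ℤ => (14 * (x : ℝ) ^ 6 + 70 * (x : ℝ) ^ 4) + (42 * (x : ℝ) ^ 2 + 2) := by
    ext x; push_cast; ring
  have e' : (fun x : ℤ => (x : ℝ) * (x : ℝ) ^ 7) = fun x : ℤ => (x : ℝ) ^ 8 := by ext x; ring
  rw [e, e', mean_add hs.le (((hX.pow 6).const_mul _).add ((hX.pow 4).const_mul _))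
    (((hX.pow 2).const_mul _).add (polyGrowth_const 2)),
    mean_add hs.le ((hX.pow 6).const_mul _) ((hX.pow 4).const_mul _),
    mean_add hs.le ((hX.pow 2).const_mul _) (polyGrowth_const 2),
    mean_const_mul, mean_const_mul, mean_const_mul, m2, m4, m6, mean_const hs.le] at h
  rw [h]; ring

/-- The information content of the simple random walk, relative to the origin, is quadratic up to
`o(1)` in `L²`. -/
lemma tendsto_info_undirected_sub : Tendsto (fun s => mean .undirected s fun x =>
    (info .undirected s x - info .undirected s 0 - (x : ℝ) ^ 2 / (2 * s)) ^ 2) atTop (𝓝 0) := by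
  have hX := polyGrowth_cast
  have h1 : Tendsto (fun s : ℝ => 1000 / s) atTop (𝓝 0) := tendsto_const_nhds.div_atTop tendsto_id
  refine squeeze_zero' ?_ ?_ h1
  · filter_upwards [eventually_ge_atTop 0] with s hs
    exact mean_nonneg hs fun x => sq_nonneg _
  filter_upwards [eventually_ge_atTop 1] with s hs1
  have hs : 0 < s := by linarith
  have h : mean .undirected s (fun x =>
      (info .undirected s x - info .undirected s 0 - (x : ℝ) ^ 2 / (2 * s)) ^ 2) ≤
      mean .undirected s fun x => (1 / (2 * s ^ 2)) * (x : ℝ) ^ 2 + (2 / s ^ 6) * (x : ℝ) ^ 8 := by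
    refine mean_mono hs.le ((((polyGrowth_info _ hs.le).sub (polyGrowth_const _)).sub
      ((hX.pow 2).div_const _)).pow 2) (((hX.pow 2).const_mul _).add ((hX.pow 8).const_mul _))
      fun x => ?_
    have h1 := sq_le_sq' (by linarith [neg_le_of_abs_le (abs_info_sub_le hs x)])
      (le_of_abs_le (abs_info_sub_le hs x))
    refine h1.trans ?_
    set A := |(x : ℝ)| / (2 * s)
    set B := (x : ℝ) ^ 4 / s ^ 3
    have e : (1 / (2 * s ^ 2)) * (x : ℝ) ^ 2 + (2 / s ^ 6) * (x : ℝ) ^ 8 =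
        2 * A ^ 2 + 2 * B ^ 2 := by
      simp only [A, B, div_pow, sq_abs]
      field_simp
    rw [e]
    nlinarith [sq_nonneg (A - B)]
  refine h.trans ?_
  rw [mean_add hs.le ((hX.pow 2).const_mul _) ((hX.pow 8).const_mul _), mean_const_mul,
    mean_const_mul, mean_cast_sq_undirected hs.le, (moments_undirected hs).2]
  have e1 : 1 / (2 * s ^ 2) * s ≤ 1 / s := by
    rw [div_mul_eq_mul_div, div_le_div_iff₀ (by positivity) hs]; nlinarith
  have e2 : 2 / s ^ 6 * (105 * s ^ 4 + 210 * s ^ 3 + 63 * s ^ 2 + s) ≤ 758 / s := by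
    rw [div_mul_eq_mul_div, div_le_div_iff₀ (by positivity) hs]
    have a0 : s ^ 2 ≤ s ^ 6 := pow_le_pow_right₀ hs1 (by norm_num)
    have a1 : s ^ 5 ≤ s ^ 6 := pow_le_pow_right₀ hs1 (by norm_num)
    have a2 : s ^ 4 ≤ s ^ 6 := pow_le_pow_right₀ hs1 (by norm_num)
    have a3 : s ^ 3 ≤ s ^ 6 := pow_le_pow_right₀ hs1 (by norm_num)
    nlinarith
  have e3 : 1 / s + 758 / s ≤ 1000 / s := by
    rw [← add_div]; gcongr; norm_num
  linarith

lemma summable_gaussian {b : ℝ} (hb : 0 < b) :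
    Summable fun n : ℤ => Real.exp (-(b * (n : ℝ) ^ 2)) := by
  have h := (summable_poly_mul_exp_neg_abs 0).mul_left (Real.exp (1 / (4 * b)))
  refine Summable.of_nonneg_of_le (fun n => (Real.exp_pos _).le) (fun n => ?_) h
  rw [pow_zero, one_mul, ← Real.exp_add]
  refine Real.exp_le_exp.2 ?_
  have h2 : b * (n : ℝ) ^ 2 - |(n : ℝ)| + 1 / (4 * b) = (2 * b * |(n : ℝ)| - 1) ^ 2 / (4 * b) := by
    rw [← sq_abs (n : ℝ)]; field_simp; ring
  have : 0 ≤ (2 * b * |(n : ℝ)| - 1) ^ 2 / (4 * b) := by positivity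
  linarith

/-- Poisson summation for Gaussian sums. -/
lemma tsum_gaussian {b : ℝ} (hb : 0 < b) : ∑' n : ℤ, Real.exp (-(b * (n : ℝ) ^ 2)) =
    √(Real.pi / b) * ∑' n : ℤ, Real.exp (-(Real.pi ^ 2 / b * (n : ℝ) ^ 2)) := by
  have h := Real.tsum_exp_neg_mul_int_sq (a := b / Real.pi) (by positivity)
  have e1 : ∀ n : ℤ, -Real.pi * (b / Real.pi) * (n : ℝ) ^ 2 = -(b * (n : ℝ) ^ 2) := by
    intro n; field_simp
  have e2 : ∀ n : ℤ, -Real.pi / (b / Real.pi) * (n : ℝ) ^ 2 =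
      -(Real.pi ^ 2 / b * (n : ℝ) ^ 2) := by
    intro n; field_simp
  simp only [e1, e2] at h
  rw [h, ← Real.sqrt_eq_rpow, one_div, ← Real.sqrt_inv, inv_div]

lemma one_le_tsum_gaussian {b : ℝ} (hb : 0 < b) : 1 ≤ ∑' n : ℤ, Real.exp (-(b * (n : ℝ) ^ 2)) := by
  have := (summable_gaussian hb).le_tsum 0 (fun n _ => (Real.exp_pos _).le)
  simpa using this

lemma tendsto_tsum_gaussian : Tendsto (fun b : ℝ => ∑' n : ℤ, Real.exp (-(b * (n : ℝ) ^ 2)))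
    atTop (𝓝 1) := by
  have h := tendsto_tsum_of_dominated_convergence (𝓕 := atTop)
    (f := fun (b : ℝ) (n : ℤ) => Real.exp (-(b * (n : ℝ) ^ 2)))
    (g := fun n : ℤ => if n = 0 then (1 : ℝ) else 0) (summable_gaussian one_pos) (fun n => ?_) ?_
  · simpa using h
  · by_cases hn : n = 0
    · simp [hn]
    · simp only [hn, if_false]
      refine Real.tendsto_exp_neg_atTop_nhds_zero.comp (tendsto_id.atTop_mul_const ?_)
      have : (n : ℝ) ≠ 0 := by exact_mod_cast hn
      positivity
  · filter_upwards [eventually_ge_atTop 1] with b hb n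
    rw [Real.norm_of_nonneg (Real.exp_pos _).le]
    exact Real.exp_le_exp.2 (by nlinarith [sq_nonneg (n : ℝ)])

lemma exp_neg_info (c : WalkCase) {s : ℝ} (hs : 0 < s) {x : ℤ} (hx : x ∈ walkSupport c) :
    Real.exp (-info c s x) = mass c s x := by
  rw [info, neg_neg, Real.exp_log (mass_pos c hs hx)]

/-- The return probability of the simple random walk is asymptotic to `1 / √(2 π s)`, in
logarithmic form. The mass function is compared with a Gaussian sum, by means of the bounds on the
information content relative to the origin. -/
lemma tendsto_info_zero_undirected :
    Tendsto (fun s => info .undirected s 0 - Real.log (2 * Real.pi * s) / 2) atTop (𝓝 0) := by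
  have hX := polyGrowth_cast
  -- the excess over the quadratic has vanishing mean
  set W : ℝ → ℤ → ℝ := fun s x =>
    info .undirected s x - info .undirected s 0 - (x : ℝ) ^ 2 / (2 * s) with hW
  have hWp : ∀ s, 0 < s → PolyGrowth (W s) := fun s hs =>
    ((polyGrowth_info _ hs.le).sub (polyGrowth_const _)).sub ((hX.pow 2).div_const _)
  have hmW : Tendsto (fun s => mean .undirected s (W s)) atTop (𝓝 0) := by
    have h : Tendsto (fun s => √(mean .undirected s fun x => W s x ^ 2)) atTop (𝓝 0) := by
      simpa using tendsto_info_undirected_sub.sqrt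
    refine squeeze_zero_norm' ?_ h
    filter_upwards [eventually_gt_atTop 0] with s hs
    have := sq_mean_mul_le (c := .undirected) hs.le (hWp s hs) (polyGrowth_const 1)
    simp only [mul_one, one_pow, mean_const hs.le] at this
    exact Real.abs_le_sqrt this
  have hm : ∀ s : ℝ, 0 < s → ∀ x : ℤ, mass .undirected s x =
      Real.exp (-info .undirected s 0) * Real.exp (-((2 * s)⁻¹ * (x : ℝ) ^ 2)) *
        Real.exp (-W s x) := by
    intro s hs x
    rw [← exp_neg_info .undirected hs (x := x) (mem_univ x), ← Real.exp_add, ← Real.exp_add]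
    congr 1
    simp only [hW]
    field_simp
    ring
  -- `1 + E[W] ≤ E[exp W]`, and `E[exp W]` is a Gaussian sum, evaluated by Poisson summation
  have hupper : ∀ᶠ s in atTop, info .undirected s 0 - Real.log (2 * Real.pi * s) / 2 ≤
      Real.log (∑' n : ℤ, Real.exp (-(2 * Real.pi ^ 2 * s * (n : ℝ) ^ 2))) -
        Real.log (1 + mean .undirected s (W s)) := by
    have hev : ∀ᶠ s in atTop, -1 < mean .undirected s (W s) :=
      hmW.eventually (lt_mem_nhds (by norm_num))
    filter_upwards [eventually_gt_atTop 0, hev] with s hs hmean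
    have hb : (0 : ℝ) < (2 * s)⁻¹ := by positivity
    have hsum := (summable_gaussian hb).mul_left (Real.exp (-info .undirected s 0))
    have hle : mean .undirected s (fun x => 1 + W s x) ≤
        ∑' x : ℤ, Real.exp (-info .undirected s 0) * Real.exp (-((2 * s)⁻¹ * (x : ℝ) ^ 2)) := by
      refine (summable_mean _ hs.le ((polyGrowth_const 1).add (hWp s hs))).tsum_le_tsum
        (fun x => ?_) hsum
      calc mass .undirected s x * (1 + W s x) ≤ mass .undirected s x * Real.exp (W s x) := by
            refine mul_le_mul_of_nonneg_left ?_ (mass_nonneg _ hs.le x)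
            linarith [Real.add_one_le_exp (W s x)]
        _ = _ := by
            rw [hm s hs x, mul_assoc, ← Real.exp_add (-W s x), neg_add_cancel,
              Real.exp_zero, mul_one]
    have hgauss := tsum_gaussian hb
    have e1 : Real.pi / (2 * s)⁻¹ = 2 * Real.pi * s := by field_simp
    have e2 : Real.pi ^ 2 / (2 * s)⁻¹ = 2 * Real.pi ^ 2 * s := by field_simp
    rw [e1, e2] at hgauss
    rw [mean_add hs.le (polyGrowth_const 1) (hWp s hs), mean_const hs.le, tsum_mul_left,
      hgauss] at hle
    have hT := one_le_tsum_gaussian (b := 2 * Real.pi ^ 2 * s) (by positivity)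
    set T := ∑' n : ℤ, Real.exp (-(2 * Real.pi ^ 2 * s * (n : ℝ) ^ 2))
    have hlog := Real.log_le_log (by linarith) hle
    rw [Real.log_mul (Real.exp_pos _).ne' (by positivity), Real.log_exp,
      Real.log_mul (by positivity) (by positivity), Real.log_sqrt (by positivity)] at hlog
    linarith
  -- the masses, which add up to one, dominate a Gaussian sequence
  have hlower : ∀ s : ℝ, 1 ≤ s → -(1 / √s) ≤
      info .undirected s 0 - Real.log (2 * Real.pi * s) / 2 := by
    intro s hs1
    have hs : 0 < s := by linarith
    set t := √s with ht
    have ht0 : 0 < t := Real.sqrt_pos.2 hs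
    have hts : t ^ 2 = s := Real.sq_sqrt hs.le
    set b : ℝ := (1 + 1 / t) / (2 * s) with hbdef
    have hb : 0 < b := by positivity
    have hle : ∑' x : ℤ, Real.exp (-info .undirected s 0) * Real.exp (-(1 / (8 * t))) *
        Real.exp (-(b * (x : ℝ) ^ 2)) ≤ 1 := by
      conv_rhs => rw [← (hasSum_mass .undirected hs.le).tsum_eq]
      refine ((summable_gaussian hb).mul_left _).tsum_le_tsum (fun x => ?_)
        (hasSum_mass .undirected hs.le).summable
      rw [← exp_neg_info .undirected hs (x := x) (mem_univ x), ← Real.exp_add, ← Real.exp_add]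
      refine Real.exp_le_exp.2 ?_
      have key : ∀ n : ℕ, info .undirected s n ≤
          info .undirected s 0 + 1 / (8 * t) + b * (n : ℝ) ^ 2 := by
        intro n
        have h1 := (info_natCast_bounds hs n).1
        -- the linear term is absorbed by `n ≤ t / 4 + n² / t`
        have h2 : ((n : ℝ) ^ 2 + n) / (2 * s) ≤ 1 / (8 * t) + b * (n : ℝ) ^ 2 := by
          have e : 1 / (8 * t) + b * (n : ℝ) ^ 2 - ((n : ℝ) ^ 2 + n) / (2 * s) =
              (2 * n - t) ^ 2 / (8 * t * s) := by
            rw [hbdef, ← hts]; field_simp; ring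
          have : 0 ≤ (2 * (n : ℝ) - t) ^ 2 / (8 * t * s) := by positivity
          linarith
        linarith
      rcases Int.natAbs_eq x with h | h
      · have := key x.natAbs
        rw [h, Int.cast_natCast]; linarith
      · have := key x.natAbs
        rw [h, info_neg_undirected, Int.cast_neg, neg_sq, Int.cast_natCast]
        linarith
    rw [tsum_mul_left, tsum_gaussian hb] at hle
    have hT := one_le_tsum_gaussian (b := Real.pi ^ 2 / b) (by positivity)
    set T := ∑' n : ℤ, Real.exp (-(Real.pi ^ 2 / b * (n : ℝ) ^ 2))
    have h3 : Real.exp (-info .undirected s 0) * Real.exp (-(1 / (8 * t))) * √(Real.pi / b) ≤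
        1 := by
      refine le_trans ?_ hle
      refine mul_le_mul_of_nonneg_left ?_ (by positivity)
      exact le_mul_of_one_le_right (Real.sqrt_nonneg _) hT
    have h4 := Real.log_le_log (by positivity) h3
    have e1 : Real.pi / b = 2 * Real.pi * s / (1 + 1 / t) := by rw [hbdef]; field_simp
    rw [Real.log_one, Real.log_mul (by positivity) (by positivity), Real.log_mul (by positivity)
      (by positivity), Real.log_exp, Real.log_exp, Real.log_sqrt (by positivity), e1,
      Real.log_div (by positivity) (by positivity)] at h4
    have h5 := Real.log_le_sub_one_of_pos (show 0 < 1 + 1 / t by positivity)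
    have h6 : 1 / (8 * t) = 1 / t / 8 := by field_simp
    have h7 : 0 < 1 / t := by positivity
    rw [h6] at h4
    linarith
  have t1 : Tendsto (fun s : ℝ => -(1 / √s)) atTop (𝓝 0) := by
    have : Tendsto (fun s : ℝ => 1 / √s) atTop (𝓝 0) :=
      tendsto_const_nhds.div_atTop Real.tendsto_sqrt_atTop
    simpa using this.neg
  have t2 : Tendsto (fun s : ℝ => Real.log (∑' n : ℤ,
      Real.exp (-(2 * Real.pi ^ 2 * s * (n : ℝ) ^ 2))) -
        Real.log (1 + mean .undirected s (W s))) atTop (𝓝 0) := by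
    have h1 : Tendsto (fun s : ℝ => 2 * Real.pi ^ 2 * s) atTop atTop :=
      tendsto_id.const_mul_atTop (by positivity)
    have h2 := (tendsto_tsum_gaussian.comp h1).log one_ne_zero
    have h3 := (hmW.const_add 1).log (by norm_num)
    simpa using h2.sub h3
  refine tendsto_of_tendsto_of_tendsto_of_le_of_le' t1 t2 ?_ hupper
  filter_upwards [eventually_ge_atTop 1] with s hs using hlower s hs

lemma mean_undirected_eq {s : ℝ} (hs : 0 ≤ s) {F : ℤ → ℝ} (hF : PolyGrowth F) :
    Summable (fun n : ℕ => mass .undirected s n * F n) ∧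
    Summable (fun n : ℕ => mass .undirected s (n + 1) * F (-(n + 1))) ∧
    mean .undirected s F = (∑' n : ℕ, mass .undirected s n * F n) +
      ∑' n : ℕ, mass .undirected s (n + 1) * F (-(n + 1)) := by
  have h := summable_mean .undirected hs hF
  have hinj : Function.Injective fun n : ℕ => (-((n : ℤ) + 1)) := fun a b hab => by
    simp only at hab; omega
  have h1 := h.comp_injective (Nat.cast_injective (R := ℤ))
  have h2 := h.comp_injective hinj
  have h3 := tsum_of_nat_of_neg_add_one (f := fun x : ℤ => mass .undirected s x * F x) h1 h2
  simp only [Function.comp_def, mass_neg_undirected] at h1 h2 h3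
  exact ⟨h1, h2, h3⟩

/-- The summand of the Fisher information of the simple random walk. -/
noncomputable def fisherTerm (s : ℝ) (n : ℕ) : ℝ :=
  -Real.log (massRatio s n) * (1 - massRatio s n)

lemma mul_one_sub_exp_neg_bounds {u : ℝ} (h0 : 0 ≤ u) : 0 ≤ u * (1 - Real.exp (-u)) ∧
    u * (1 - Real.exp (-u)) ≤ u ^ 2 ∧ u ^ 2 - u ^ 3 / 2 ≤ u * (1 - Real.exp (-u)) := by
  have h1 : Real.exp (-u) ≤ 1 := Real.exp_le_one_iff.2 (by linarith)
  have h3 : 1 - Real.exp (-u) ≤ u := by linarith [Real.add_one_le_exp (-u)]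
  have h4 : u - u ^ 2 / 2 ≤ 1 - Real.exp (-u) := by
    have h5 := Real.quadratic_le_exp_of_nonneg h0
    have h7 : Real.exp (-u) * (1 + u + u ^ 2 / 2) ≤ 1 := by
      calc _ ≤ Real.exp (-u) * Real.exp u := mul_le_mul_of_nonneg_left h5 (Real.exp_pos _).le
        _ = 1 := by rw [← Real.exp_add]; simp
    by_contra! h8
    have h9 : 1 - u + u ^ 2 / 2 < Real.exp (-u) := by linarith
    have h10 := mul_lt_mul_of_pos_right h9 (show 0 < 1 + u + u ^ 2 / 2 by positivity)
    have h11 : (1 - u + u ^ 2 / 2) * (1 + u + u ^ 2 / 2) = 1 + (u ^ 2) ^ 2 / 4 := by ring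
    linarith [sq_nonneg (u ^ 2)]
  refine ⟨mul_nonneg h0 (by linarith), ?_, ?_⟩
  · rw [sq]; exact mul_le_mul_of_nonneg_left h3 h0
  · have := mul_le_mul_of_nonneg_left h4 h0
    linarith

/-- To leading order the summand is `(n / s)²`, the squared score of the Gaussian of variance
`s`. -/
lemma fisherTerm_bounds {s : ℝ} (hs : 0 < s) (n : ℕ) : 0 ≤ fisherTerm s n ∧
    fisherTerm s n ≤ ((n + 1) / s) ^ 2 ∧
    ((n : ℝ) / s) ^ 2 - 2 * ((n : ℝ) / s) ^ 4 - ((n + 1) / s) ^ 3 / 2 ≤ fisherTerm s n := by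
  obtain ⟨h0, h1, h2⟩ := info_step_bounds hs n
  have hr : massRatio s n = Real.exp (- -Real.log (massRatio s n)) := by
    rw [neg_neg, Real.exp_log (massRatio_pos hs n)]
  have hf : fisherTerm s n = -Real.log (massRatio s n) *
      (1 - Real.exp (- -Real.log (massRatio s n))) := by
    rw [← hr, fisherTerm]
  rw [hf]
  generalize -Real.log (massRatio s n) = u at h0 h1 h2
  obtain ⟨b0, b1, b2⟩ := mul_one_sub_exp_neg_bounds h0
  refine ⟨b0, b1.trans (pow_le_pow_left₀ h0 h1 2), le_trans ?_ b2⟩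
  have a2 : u ^ 3 ≤ ((n + 1) / s) ^ 3 := pow_le_pow_left₀ h0 h1 3
  have hy0 : 0 ≤ (n : ℝ) / s := by positivity
  generalize (n : ℝ) / s = y at h2 hy0
  have a1 : y ^ 2 - 2 * y ^ 4 ≤ u ^ 2 := by
    rcases le_or_gt y 1 with h | h
    · have h3 : 0 ≤ y - y ^ 3 := by
        have : y ^ 3 ≤ y := pow_le_of_le_one hy0 h (by norm_num)
        linarith
      have h5 : (y - y ^ 3) ^ 2 ≤ u ^ 2 := pow_le_pow_left₀ h3 h2 2
      nlinarith [sq_nonneg (y ^ 3)]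
    · have : y ^ 2 ≤ y ^ 4 := pow_le_pow_right₀ h.le (by norm_num)
      nlinarith [sq_nonneg u, sq_nonneg y]
  linarith

/-- The entropy production as a Fisher information, through summation by parts. -/
lemma two_mul_entropyDeriv_undirected {s : ℝ} (hs : 0 < s) :
    PolyGrowth (fun x => fisherTerm s x.natAbs) ∧ 2 * entropyDeriv .undirected s =
      mean .undirected s (fun x => fisherTerm s x.natAbs) +
        mass .undirected s 0 * fisherTerm s 0 := by
  have hQ := polyGrowth_info .undirected hs.le
  have hF : PolyGrowth (fun x => fisherTerm s x.natAbs) := by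
    refine ⟨2 / s ^ 2, 1, fun x => ?_⟩
    obtain ⟨h0, h1, _⟩ := fisherTerm_bounds hs x.natAbs
    rw [abs_of_nonneg h0]
    refine h1.trans ?_
    have hx : (x : ℝ) ^ 2 = (x.natAbs : ℝ) ^ 2 := by
      rw [Nat.cast_natAbs]; push_cast; rw [sq_abs]
    rw [hx, pow_one, div_pow, div_mul_eq_mul_div]
    gcongr
    nlinarith [sq_nonneg ((x.natAbs : ℝ) - 1)]
  refine ⟨hF, ?_⟩
  have hsymm : mean .undirected s (fun x => info .undirected s (x + -1)) =
      mean .undirected s (fun x => info .undirected s (x + 1)) := by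
    unfold mean
    rw [← (Equiv.neg ℤ).tsum_eq]
    refine tsum_congr fun x => ?_
    change mass .undirected s (-x) * info .undirected s (-x + -1) = _
    rw [mass_neg_undirected, ← neg_add, info_neg_undirected]
  have hD : entropyDeriv .undirected s =
      mean .undirected s fun x => info .undirected s (x + 1) - info .undirected s x := by
    rw [mean_sub hs.le (hQ.shift 1) hQ, entropyDeriv, entropy]
    simp only [altJump]
    rw [hsymm]
    ring
  obtain ⟨s1, s2, e1⟩ := mean_undirected_eq hs.le ((hQ.shift 1).sub hQ)
  obtain ⟨s3, _, e2⟩ := mean_undirected_eq hs.le hF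
  -- the sites `n` and `- (n + 1)` are paired: both jump across the edge between `|x|` equal to
  -- `n` and to `n + 1`
  have hS : entropyDeriv .undirected s = ∑' n : ℕ, mass .undirected s n * fisherTerm s n := by
    rw [hD, e1, ← s1.tsum_add s2]
    refine tsum_congr fun n => ?_
    have h1 := info_succ_sub hs n
    have h2 : info .undirected s (-((n : ℤ) + 1) + 1) = info .undirected s n := by
      rw [show -((n : ℤ) + 1) + 1 = -n by ring, info_neg_undirected]
    rw [h2, info_neg_undirected, h1, fisherTerm, ← h1]
    have h3 : mass .undirected s n * massRatio s n = mass .undirected s (n + 1) := by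
      rw [massRatio, mul_div_cancel₀ _ (mass_undirected_pos hs n).ne']
    linear_combination (info .undirected s (n + 1) - info .undirected s n) * h3
  have h4 : ∀ n : ℕ, (-((n : ℤ) + 1)).natAbs = n + 1 := fun n => by omega
  simp only [Int.natAbs_natCast, h4] at e2 s3
  rw [e2, ← hS]
  have h5 := s3.tsum_eq_zero_add
  rw [← hS] at h5
  push_cast at h5
  linarith

/-- Fisher information asymptotics for the simple random walk. -/
lemma tendsto_mul_entropyDeriv_undirected :
    Tendsto (fun s => s * entropyDeriv .undirected s) atTop (𝓝 (1 / 2)) := by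
  have hX := polyGrowth_cast
  have hbound : ∀ s : ℝ, 1 ≤ s → 1 / 2 - 8 / √s ≤ s * entropyDeriv .undirected s ∧
      s * entropyDeriv .undirected s ≤ 1 / 2 + 2 / √s := by
    intro s hs1
    have hs : 0 < s := by linarith
    obtain ⟨hF, hD⟩ := two_mul_entropyDeriv_undirected hs
    set t := √s with ht
    have ht0 : 0 < t := Real.sqrt_pos.2 hs
    have hts : s = t ^ 2 := (Real.sq_sqrt hs.le).symm
    have ht1 : 1 ≤ t := by rw [ht]; exact Real.one_le_sqrt.2 hs1
    have hx : ∀ x : ℤ, (x : ℝ) ^ 2 = (x.natAbs : ℝ) ^ 2 := fun x => by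
      rw [Nat.cast_natAbs]; push_cast; rw [sq_abs]
    have hx4 : ∀ x : ℤ, (x : ℝ) ^ 4 = (x.natAbs : ℝ) ^ 4 := fun x => by
      have := hx x
      calc (x : ℝ) ^ 4 = ((x : ℝ) ^ 2) ^ 2 := by ring
        _ = _ := by rw [this]; ring
    have hm0 : 0 ≤ mass .undirected s 0 ∧ mass .undirected s 0 ≤ 1 :=
      ⟨mass_nonneg _ hs.le 0, mass_le_one _ hs.le 0⟩
    have hf0 := fisherTerm_bounds hs 0
    have hm2 := mean_cast_sq_undirected hs.le
    have hm4 := (moments_undirected hs).1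
    constructor
    -- odd powers of `|x|` are bounded by even ones, at the scale `t = √s`
    · have h : mean .undirected s (fun x => (1 / s ^ 2 - t / s ^ 3) * (x : ℝ) ^ 2 +
          ((-(2 / s ^ 4 + 1 / (t * s ^ 3))) * (x : ℝ) ^ 4 - 2 / s ^ 3)) ≤
          mean .undirected s (fun x => fisherTerm s x.natAbs) := by
        refine mean_mono hs.le (((hX.pow 2).const_mul _).add (((hX.pow 4).const_mul _).sub
          (polyGrowth_const _))) hF fun x => ?_
        refine le_trans ?_ (fisherTerm_bounds hs x.natAbs).2.2
        rw [hx, hx4]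
        set n : ℝ := (x.natAbs : ℝ)
        have hn : 0 ≤ n := Nat.cast_nonneg _
        have h3 : (n + 1) ^ 3 ≤ 4 * (n ^ 3 + 1) := by
          nlinarith [mul_nonneg (by linarith : 0 ≤ n + 1) (sq_nonneg (n - 1))]
        have h4 : 2 * n ^ 3 ≤ n ^ 4 / t + t * n ^ 2 := by
          have : n ^ 4 / t + t * n ^ 2 - 2 * n ^ 3 = n ^ 2 * (n - t) ^ 2 / t := by
            field_simp; ring
          have : 0 ≤ n ^ 2 * (n - t) ^ 2 / t := by positivity
          linarith
        have h5 : ((n + 1) / s) ^ 3 / 2 ≤ (n ^ 4 / t + t * n ^ 2 + 2) / s ^ 3 := by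
          rw [div_pow, div_right_comm]
          gcongr
          linarith
        have e : (1 / s ^ 2 - t / s ^ 3) * n ^ 2 +
          ((-(2 / s ^ 4 + 1 / (t * s ^ 3))) * n ^ 4 - 2 / s ^ 3) =
          (n / s) ^ 2 - 2 * (n / s) ^ 4 - (n ^ 4 / t + t * n ^ 2 + 2) / s ^ 3 := by
          field_simp; ring
        rw [e]
        linarith
      rw [mean_add hs.le ((hX.pow 2).const_mul _) (((hX.pow 4).const_mul _).sub
          (polyGrowth_const _)), mean_sub hs.le ((hX.pow 4).const_mul _) (polyGrowth_const _),
          mean_const_mul, mean_const_mul, mean_const hs.le, hm2, hm4] at h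
      have h6 := mul_nonneg hm0.1 hf0.1
      have h7 : 1 - 16 / t ≤ s * ((1 / s ^ 2 - t / s ^ 3) * s +
          ((-(2 / s ^ 4 + 1 / (t * s ^ 3))) * (3 * s ^ 2 + s) - 2 / s ^ 3)) := by
        have e : s * ((1 / s ^ 2 - t / s ^ 3) * s +
          ((-(2 / s ^ 4 + 1 / (t * s ^ 3))) * (3 * s ^ 2 + s) - 2 / s ^ 3)) - (1 - 16 / t) =
          (12 * t ^ 3 - 6 * t ^ 2 - t - 4) / t ^ 4 := by
          rw [hts]; field_simp; ring
        have : 0 ≤ (12 * t ^ 3 - 6 * t ^ 2 - t - 4) / t ^ 4 := by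
          refine div_nonneg ?_ (by positivity)
          nlinarith [mul_nonneg (sq_nonneg t) (sub_nonneg.2 ht1), mul_nonneg ht0.le
            (sub_nonneg.2 ht1)]
        linarith
      have h8 := mul_le_mul_of_nonneg_left h hs.le
      have h9 : s * (2 * entropyDeriv .undirected s) =
        s * mean .undirected s (fun x => fisherTerm s x.natAbs) +
        s * (mass .undirected s 0 * fisherTerm s 0) := by rw [hD]; ring
      have h10 := mul_nonneg hs.le h6
      have h11 : 16 / t = 2 * (8 / t) := by ring
      linarith
    · have h : mean .undirected s (fun x => fisherTerm s x.natAbs) ≤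
          mean .undirected s (fun x => (1 / s ^ 2 + 1 / (t * s ^ 2)) * (x : ℝ) ^ 2 +
            (t + 1) / s ^ 2) := by
        refine mean_mono hs.le hF (((hX.pow 2).const_mul _).add (polyGrowth_const _)) fun x => ?_
        refine (fisherTerm_bounds hs x.natAbs).2.1.trans ?_
        rw [hx]
        set n : ℝ := (x.natAbs : ℝ)
        have e : (1 / s ^ 2 + 1 / (t * s ^ 2)) * n ^ 2 + (t + 1) / s ^ 2 - ((n + 1) / s) ^ 2 =
            (n - t) ^ 2 / (t * s ^ 2) := by field_simp; ring
        have : 0 ≤ (n - t) ^ 2 / (t * s ^ 2) := by positivity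
        linarith
      rw [mean_add hs.le ((hX.pow 2).const_mul _) (polyGrowth_const _), mean_const_mul,
        mean_const hs.le, hm2] at h
      have h6 : mass .undirected s 0 * fisherTerm s 0 ≤ 1 / s ^ 2 := by
        have := hf0.2.1
        rw [Nat.cast_zero, zero_add, div_pow, one_pow] at this
        calc _ ≤ 1 * fisherTerm s 0 := by
              gcongr
              · exact hf0.1
              · exact hm0.2
          _ ≤ _ := by rwa [one_mul]
      have h7 : s * (((1 / s ^ 2 + 1 / (t * s ^ 2)) * s + (t + 1) / s ^ 2) + 1 / s ^ 2) ≤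
          1 + 4 / t := by
        have e : 1 + 4 / t - s * (((1 / s ^ 2 + 1 / (t * s ^ 2)) * s + (t + 1) / s ^ 2) +
          1 / s ^ 2) = (2 * t - 2) / t ^ 2 := by
          rw [hts]; field_simp; ring
        have : 0 ≤ (2 * t - 2) / t ^ 2 := div_nonneg (by linarith) (by positivity)
        linarith
      have h8 : s * (2 * entropyDeriv .undirected s) ≤ s * (((1 / s ^ 2 + 1 / (t * s ^ 2)) * s +
          (t + 1) / s ^ 2) + 1 / s ^ 2) := by
        rw [hD]
        refine mul_le_mul_of_nonneg_left ?_ hs.le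
        linarith
      have h11 : 4 / t = 2 * (2 / t) := by ring
      linarith
  have hinv : ∀ a : ℝ, Tendsto (fun s : ℝ => a / √s) atTop (𝓝 0) := fun a =>
    tendsto_const_nhds.div_atTop Real.tendsto_sqrt_atTop
  have t1 := (hinv 8).const_sub (1 / 2)
  have t2 := (hinv 2).const_add (1 / 2)
  rw [sub_zero] at t1
  rw [add_zero] at t2
  refine tendsto_of_tendsto_of_tendsto_of_le_of_le' t1 t2 ?_ ?_
  · filter_upwards [eventually_ge_atTop 1] with s hs using (hbound s hs).1
  · filter_upwards [eventually_ge_atTop 1] with s hs using (hbound s hs).2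

lemma tendsto_large_undirected :
    Tendsto (fun s => entropy .undirected s - Real.log (2 * Real.pi * s) / 2) atTop (𝓝 (1 / 2)) ∧
      Tendsto (varentropy .undirected) atTop (𝓝 (1 / 2)) := by
  obtain ⟨h1, h2⟩ := tendsto_of_quadratic_info .undirected (fun _ x => (x : ℝ))
    (fun s => info .undirected s 0) (fun _ => polyGrowth_cast)
    (fun _ hs => mean_cast_sq_undirected hs.le) (fun _ hs => (moments_undirected hs).1)
    tendsto_info_undirected_sub
  refine ⟨?_, h2⟩
  have := h1.add tendsto_info_zero_undirected
  rw [add_zero] at this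
  exact this.congr fun s => by ring

/-- At large times both walks have the entropy, varentropy and entropy production of a Gaussian of
variance `s`. -/
lemma tendsto_large (c : WalkCase) :
    Tendsto (fun s => entropy c s - Real.log (2 * Real.pi * s) / 2) atTop (𝓝 (1 / 2)) ∧
      Tendsto (varentropy c) atTop (𝓝 (1 / 2)) ∧
      Tendsto (fun s => s * entropyDeriv c s) atTop (𝓝 (1 / 2)) := by
  cases c
  · exact ⟨tendsto_large_undirected.1, tendsto_large_undirected.2,
      tendsto_mul_entropyDeriv_undirected⟩
  · exact ⟨tendsto_large_directed.1, tendsto_large_directed.2, tendsto_mul_entropyDeriv_directed⟩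

/-! ### The inverse of the entropy -/

lemma mass_at_zero (c : WalkCase) (x : ℤ) : mass c 0 x = if x = 0 then 1 else 0 := by
  unfold mass
  rw [tsum_eq_single 0 (by intro m hm; simp [hm])]
  simp [stepMass]

lemma entropy_zero (c : WalkCase) : entropy c 0 = 0 := by
  have h (x : ℤ) : mass c 0 x * info c 0 x = 0 := by
    rw [info, mass_at_zero]
    split_ifs <;> simp
  simp [entropy, mean, h]

lemma continuousOn_entropy_Ici (c : WalkCase) : ContinuousOn (entropy c) (Ici 0) := by
  intro s hs
  rcases (show (0 : ℝ) ≤ s from hs).eq_or_lt with rfl | h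
  · rw [← continuousWithinAt_Ioi_iff_Ici, ContinuousWithinAt, entropy_zero]
    exact tendsto_entropy_zero c
  · exact (hasDerivAt_entropy c h).continuousAt.continuousWithinAt

lemma strictMonoOn_entropy (c : WalkCase) : StrictMonoOn (entropy c) (Ici 0) := by
  refine strictMonoOn_of_deriv_pos (convex_Ici 0) (continuousOn_entropy_Ici c) fun s hs => ?_
  rw [interior_Ici] at hs
  rw [(hasDerivAt_entropy c hs).deriv]
  exact entropyDeriv_pos c hs

lemma tendsto_entropy_atTop (c : WalkCase) : Tendsto (entropy c) atTop atTop := by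
  have h1 : Tendsto (fun s : ℝ => Real.log (2 * Real.pi * s) / 2) atTop atTop :=
    (Real.tendsto_log_atTop.comp (tendsto_id.const_mul_atTop (by positivity))).atTop_div_const
      two_pos
  refine ((tendsto_large c).1.add_atTop h1).congr fun s => by ring

lemma exists_entropy_eq (c : WalkCase) {h : ℝ} (hh : 0 ≤ h) : ∃ s, 0 ≤ s ∧ entropy c s = h := by
  obtain ⟨b, hb, hb0⟩ := (((tendsto_entropy_atTop c).eventually_ge_atTop h).and
    (eventually_ge_atTop (0 : ℝ))).exists
  have := intermediate_value_Icc hb0 ((continuousOn_entropy_Ici c).mono Icc_subset_Ici_self)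
  obtain ⟨s, hs, e⟩ := this ⟨by rwa [entropy_zero], hb⟩
  exact ⟨s, hs.1, e⟩

/-- The time at which the entropy of the rate-one walk equals `h`; the set has exactly one element
if `h ≥ 0`, because the entropy increases strictly from `0` to infinity. -/
noncomputable def entropyInv (c : WalkCase) (h : ℝ) : ℝ := sInf {s | 0 ≤ s ∧ entropy c s = h}

lemma entropyInv_entropy (c : WalkCase) {s : ℝ} (hs : 0 ≤ s) :
    entropyInv c (entropy c s) = s := by
  have : {r | 0 ≤ r ∧ entropy c r = entropy c s} = {s} := by
    ext r
    constructor
    · rintro ⟨h1, h2⟩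
      exact (strictMonoOn_entropy c).injOn h1 hs h2
    · rintro rfl
      exact ⟨hs, rfl⟩
  rw [entropyInv, this, csInf_singleton]

lemma entropyInv_spec (c : WalkCase) {h : ℝ} (hh : 0 ≤ h) :
    0 ≤ entropyInv c h ∧ entropy c (entropyInv c h) = h := by
  obtain ⟨s, hs, rfl⟩ := exists_entropy_eq c hh
  rw [entropyInv_entropy c hs]
  exact ⟨hs, rfl⟩

lemma entropyInv_pos (c : WalkCase) {h : ℝ} (hh : 0 < h) : 0 < entropyInv c h := by
  obtain ⟨h1, h2⟩ := entropyInv_spec c hh.le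
  refine lt_of_le_of_ne h1 fun h0 => ?_
  rw [← h0, entropy_zero] at h2
  exact hh.ne h2

section inverse_limits
variable {ι : Type*} {l : Filter ι} {u : ι → ℝ}

lemma tendsto_of_tendsto_entropy (c : WalkCase) (hu : ∀ᶠ i in l, 0 ≤ u i) {a : ℝ} (ha : 0 < a)
    (h : Tendsto (fun i => entropy c (u i)) l (𝓝 (entropy c a))) : Tendsto u l (𝓝 a) := by
  have hm := strictMonoOn_entropy c
  rw [tendsto_order]
  constructor
  · intro b hb
    have hb' : max b 0 < a := max_lt hb ha
    have hlt := hm (mem_Ici.2 (le_max_right b 0)) (mem_Ici.2 ha.le) hb'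
    filter_upwards [hu, h.eventually (lt_mem_nhds hlt)] with i hi h2
    exact (le_max_left b 0).trans_lt ((hm.lt_iff_lt (mem_Ici.2 (le_max_right b 0)) hi).1 h2)
  · intro b hb
    have hlt := hm (mem_Ici.2 ha.le) (mem_Ici.2 (ha.trans hb).le) hb
    filter_upwards [hu, h.eventually (gt_mem_nhds hlt)] with i hi h2
    exact (hm.lt_iff_lt hi (mem_Ici.2 (ha.trans hb).le)).1 h2

lemma tendsto_zero_of_tendsto_entropy (c : WalkCase) (hu : ∀ᶠ i in l, 0 < u i)
    (h : Tendsto (fun i => entropy c (u i)) l (𝓝 0)) : Tendsto u l (𝓝[>] 0) := by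
  have hm := strictMonoOn_entropy c
  rw [tendsto_nhdsWithin_iff]
  refine ⟨?_, hu⟩
  rw [tendsto_order]
  constructor
  · intro b hb
    filter_upwards [hu] with i hi
    exact hb.trans hi
  · intro b hb
    have hlt := hm (mem_Ici.2 le_rfl) (mem_Ici.2 hb.le) hb
    rw [entropy_zero] at hlt
    filter_upwards [hu, h.eventually (gt_mem_nhds hlt)] with i hi h2
    exact (hm.lt_iff_lt (mem_Ici.2 hi.le) (mem_Ici.2 hb.le)).1 h2

lemma tendsto_atTop_of_tendsto_entropy (c : WalkCase) (hu : ∀ᶠ i in l, 0 ≤ u i)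
    (h : Tendsto (fun i => entropy c (u i)) l atTop) : Tendsto u l atTop := by
  have hm := strictMonoOn_entropy c
  rw [tendsto_atTop]
  intro b
  have hb : (0 : ℝ) ≤ max b 0 := le_max_right b 0
  filter_upwards [hu, h.eventually_gt_atTop (entropy c (max b 0))] with i hi h2
  exact (le_max_left b 0).trans ((hm.lt_iff_lt (mem_Ici.2 hb) hi).1 h2).le

end inverse_limits

lemma continuousOn_entropyInv (c : WalkCase) : ContinuousOn (entropyInv c) (Ioi 0) := by
  intro h hh
  have hh' : (0 : ℝ) < h := hh
  refine tendsto_of_tendsto_entropy c ?_ (entropyInv_pos c hh') ?_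
  · filter_upwards [self_mem_nhdsWithin] with r hr
    exact (entropyInv_pos c hr).le
  · rw [(entropyInv_spec c hh'.le).2]
    have : Tendsto (fun r : ℝ => r) (𝓝[Ioi 0] h) (𝓝 h) := tendsto_id.mono_left nhdsWithin_le_nhds
    refine this.congr' ?_
    filter_upwards [self_mem_nhdsWithin] with r hr
    exact ((entropyInv_spec c (le_of_lt hr)).2).symm

/-! ### The window scale -/

/-- Logarithmic derivative of the entropy with respect to time, `s H'(s)`. -/
noncomputable def entropySlope (c : WalkCase) (s : ℝ) : ℝ := s * entropyDeriv c s

/-- The relative width of the cutoff window, up to the factor `1 / √k`: the standard deviation of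
the information content divided by `s H'(s)`. -/
noncomputable def windowScale (c : WalkCase) (s : ℝ) : ℝ := √(varentropy c s) / entropySlope c s

lemma entropySlope_pos (c : WalkCase) {s : ℝ} (hs : 0 < s) : 0 < entropySlope c s :=
  mul_pos hs (entropyDeriv_pos c hs)

lemma windowScale_pos (c : WalkCase) {s : ℝ} (hs : 0 < s) : 0 < windowScale c s :=
  div_pos (Real.sqrt_pos.2 (varentropy_pos c hs)) (entropySlope_pos c hs)

lemma continuousOn_entropySlope (c : WalkCase) : ContinuousOn (entropySlope c) (Ioi 0) :=
  continuousOn_id.mul (continuousOn_entropyDeriv c)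

lemma continuousOn_windowScale (c : WalkCase) : ContinuousOn (windowScale c) (Ioi 0) :=
  (continuousOn_varentropy c).sqrt.div (continuousOn_entropySlope c)
    fun _ hs => (entropySlope_pos c hs).ne'

lemma tendsto_windowScale_atTop (c : WalkCase) : Tendsto (windowScale c) atTop (𝓝 √2) := by
  obtain ⟨_, h1, h2⟩ := tendsto_large c
  have h := h1.sqrt.div h2 (by norm_num)
  have e : √(1 / 2 : ℝ) / (1 / 2) = √2 := by
    rw [div_eq_iff (by norm_num), Real.sqrt_eq_iff_mul_self_eq (by norm_num) (by positivity)]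
    nlinarith [Real.mul_self_sqrt (show (0 : ℝ) ≤ 2 by norm_num)]
  rw [e] at h
  exact h

lemma tendsto_neg_log_small : Tendsto (fun s : ℝ => -Real.log s) (𝓝[>] 0) atTop :=
  tendsto_neg_atBot_atTop.comp Real.tendsto_log_nhdsGT_zero

lemma eventually_neg_log_pos : ∀ᶠ s : ℝ in 𝓝[>] 0, 0 < s ∧ 0 < -Real.log s := by
  filter_upwards [eventually_small, tendsto_neg_log_small.eventually_gt_atTop 0] with s hs h
  exact ⟨hs.1, h⟩

lemma tendsto_div_neg_log {F : ℝ → ℝ} {a : ℝ}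
    (h : Tendsto (fun s => F s + Real.log s) (𝓝[>] 0) (𝓝 a)) :
    Tendsto (fun s => F s / -Real.log s) (𝓝[>] 0) (𝓝 1) := by
  have := (h.div_atTop tendsto_neg_log_small).add_const 1
  rw [zero_add] at this
  refine this.congr' ?_
  filter_upwards [eventually_neg_log_pos] with s hs
  have h0 : Real.log s ≠ 0 := (neg_pos.1 hs.2).ne
  field_simp
  ring

lemma tendsto_varentropy_div (c : WalkCase) :
    Tendsto (fun s => varentropy c s / s / (-Real.log s) ^ 2) (𝓝[>] 0) (𝓝 1) := by
  have h1 := (tendsto_varentropy_small c).div_atTop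
    ((tendsto_pow_atTop two_ne_zero).comp tendsto_neg_log_small)
  have h2 : Tendsto (fun s => jumpEntropy c / -Real.log s + 1) (𝓝[>] 0) (𝓝 1) := by
    simpa using (tendsto_const_nhds.div_atTop tendsto_neg_log_small).add_const 1
  have h3 := h1.add (h2.pow 2)
  rw [one_pow, zero_add] at h3
  refine h3.congr' ?_
  filter_upwards [eventually_neg_log_pos] with s hs
  have h0 : Real.log s ≠ 0 := (neg_pos.1 hs.2).ne
  simp only [Function.comp_apply]
  field_simp
  ring

lemma tendsto_windowScale_mul_sqrt (c : WalkCase) :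
    Tendsto (fun s => windowScale c s * √s) (𝓝[>] 0) (𝓝 1) := by
  have h1 := (tendsto_varentropy_div c).sqrt
  have h2 := tendsto_div_neg_log (tendsto_entropyDeriv_small c)
  have h3 := h1.div h2 one_ne_zero
  rw [Real.sqrt_one, div_one] at h3
  refine h3.congr' ?_
  filter_upwards [eventually_neg_log_pos] with s hs
  have hs0 := hs.1
  have hd := entropyDeriv_pos c hs.1
  have hsq : √s * √s = s := Real.mul_self_sqrt hs.1.le
  have hsp := Real.sqrt_pos.2 hs.1
  simp only [Pi.div_apply]
  rw [Real.sqrt_div' _ (sq_nonneg _), Real.sqrt_sq hs.2.le, Real.sqrt_div' _ hs.1.le, windowScale,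
    entropySlope]
  have hL := hs.2
  set L := -Real.log s
  rw [div_div_div_cancel_right₀ hL.ne', div_div, div_mul_eq_mul_div,
    div_eq_div_iff (by positivity) (by positivity)]
  linear_combination -(√(varentropy c s) * entropyDeriv c s) * hsq

/-- Second-order behaviour of the window scale at small times, as a function of the entropy; it
distinguishes the two walks. -/
lemma tendsto_entropy_windowScale (c : WalkCase) :
    Tendsto (fun s => entropy c s * windowScale c s ^ 2 - 2 * Real.log (windowScale c s))
      (𝓝[>] 0) (𝓝 (1 + jumpEntropy c)) := by
  set j := jumpEntropy c with hj
  have hA := tendsto_entropy_small c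
  have hB := tendsto_entropyDeriv_small c
  have hC := tendsto_varentropy_small c
  have hL := tendsto_neg_log_small
  have hq : Tendsto (fun s => (windowScale c s * √s) ^ 2) (𝓝[>] 0) (𝓝 1) := by
    simpa using (tendsto_windowScale_mul_sqrt c).pow 2
  have hr := (tendsto_div_neg_log hB).inv₀ one_ne_zero
  -- `L (q - 1) → 0` where `q = s G²` and `L = - log s`
  have hLq : Tendsto (fun s => (-Real.log s) * ((windowScale c s * √s) ^ 2 - 1)) (𝓝[>] 0)
      (𝓝 0) := by
    have h1 := hC.div_atTop hL
    have h2 := ((hB.const_add j).div_atTop hL).const_add 2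
    have h3 := (hr.pow 2).mul (h1.add ((hB.const_sub j).mul h2))
    rw [show ((1 : ℝ)⁻¹ ^ 2 * (0 + (j - jumpEntropy c) * (2 + 0))) = 0 by rw [hj]; ring] at h3
    refine h3.congr' ?_
    filter_upwards [eventually_neg_log_pos] with s hs
    have hs0 := hs.1
    have hd := (entropyDeriv_pos c hs.1).ne'
    have hl : Real.log s ≠ 0 := (neg_pos.1 hs.2).ne
    have hV := Real.sq_sqrt (varentropy_pos c hs.1).le
    rw [mul_pow, Real.sq_sqrt hs.1.le, windowScale, div_pow, hV, entropySlope]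
    field_simp
    ring
  have hlogq := hq.log one_ne_zero
  have h := (hLq.add (hA.mul hq)).sub hlogq
  rw [Real.log_one, zero_add, mul_one, sub_zero] at h
  refine h.congr' ?_
  filter_upwards [eventually_neg_log_pos] with s hs
  have hG := windowScale_pos c hs.1
  have hs0 := hs.1.ne'
  rw [mul_pow, Real.sq_sqrt hs.1.le, Real.log_mul (by positivity) hs0, Real.log_pow]
  push_cast
  field_simp
  ring

/-- To leading order, `H(s) ∼ s log (1 / s)`. -/
lemma tendsto_entropy_div_small (c : WalkCase) :
    Tendsto (fun s => entropy c s / s / -Real.log s) (𝓝[>] 0) (𝓝 1) :=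
  tendsto_div_neg_log (tendsto_entropy_small c)

lemma entropy_pos (c : WalkCase) {s : ℝ} (hs : 0 < s) : 0 < entropy c s := by
  have := strictMonoOn_entropy c (mem_Ici.2 le_rfl) (mem_Ici.2 hs.le) hs
  rwa [entropy_zero] at this

lemma tendsto_log_entropy_small (c : WalkCase) :
    Tendsto (fun s => -Real.log (entropy c s) / -Real.log s) (𝓝[>] 0) (𝓝 1) := by
  have h1 := ((tendsto_entropy_div_small c).log one_ne_zero).div_atTop tendsto_neg_log_small
  have h2 : Tendsto (fun s : ℝ => Real.log (-Real.log s) / -Real.log s) (𝓝[>] 0) (𝓝 0) := by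
    have : Tendsto (fun y : ℝ => Real.log y / y) atTop (𝓝 0) :=
      Real.isLittleO_log_id_atTop.tendsto_div_nhds_zero
    exact this.comp tendsto_neg_log_small
  have h3 := (h1.add h2).const_sub 1
  rw [add_zero, sub_zero] at h3
  refine h3.congr' ?_
  filter_upwards [eventually_neg_log_pos] with s hs
  have hH := entropy_pos c hs.1
  have hL := hs.2
  have hl : Real.log s ≠ 0 := (neg_pos.1 hs.2).ne
  rw [Real.log_div (div_pos hH hs.1).ne' hL.ne', Real.log_div hH.ne' hs.1.ne']
  field_simp
  ring

/-- Asymptotic inversion of the entropy at small times. -/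
lemma tendsto_mul_log_entropy_div (c : WalkCase) :
    Tendsto (fun s => s * (-Real.log (entropy c s)) / entropy c s) (𝓝[>] 0) (𝓝 1) := by
  have h := (tendsto_log_entropy_small c).div (tendsto_entropy_div_small c) one_ne_zero
  rw [div_one] at h
  refine h.congr' ?_
  filter_upwards [eventually_neg_log_pos] with s hs
  have hH := (entropy_pos c hs.1).ne'
  have hs0 := hs.1.ne'
  have hL := hs.2
  simp only [Pi.div_apply]
  set L := -Real.log s
  field_simp

/-! ### Slow variation along ultrafilters -/

/-- Along an ultrafilter, a positive sequence of times is large, small or convergent, so that the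
asymptotics at infinity, the asymptotics at zero and continuity cover all cases. -/
lemma ultrafilter_trichotomy {ι : Type*} (U : Ultrafilter ι) {s : ι → ℝ}
    (hs : ∀ᶠ i in (U : Filter ι), 0 < s i) : Tendsto s U atTop ∨
      (∃ a, 0 < a ∧ Tendsto s U (𝓝 a)) ∨ Tendsto s U (𝓝[>] 0) := by
  by_cases h : Tendsto s U atTop
  · exact Or.inl h
  right
  rw [tendsto_atTop] at h
  push Not at h
  obtain ⟨M, hM⟩ := h
  have hM' : ∀ᶠ i in (U : Filter ι), s i ∈ Icc 0 M := by
    filter_upwards [hs, hM] with i h1 h2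
    exact ⟨h1.le, h2.le⟩
  obtain ⟨a, ha, hle⟩ := isCompact_Icc.ultrafilter_le_nhds (U.map s) (le_principal_iff.2 hM')
  have ht : Tendsto s U (𝓝 a) := hle
  rcases ha.1.eq_or_lt with h0 | h0
  · right
    rw [← h0] at ht
    exact tendsto_nhdsWithin_iff.2 ⟨ht, hs⟩
  · exact Or.inl ⟨a, h0, ht⟩

/-- The logarithmic derivative `s H'(s)` is slowly varying, uniformly in `s`. -/
lemma tendsto_entropySlope_ratio (c : WalkCase) {ι : Type*} {l : Filter ι} {s r : ι → ℝ}
    (hs : ∀ᶠ i in l, 0 < s i) (hr : Tendsto (fun i => r i / s i) l (𝓝 1)) :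
    Tendsto (fun i => entropySlope c (r i) / entropySlope c (s i)) l (𝓝 1) := by
  rw [tendsto_iff_ultrafilter]
  intro U hU
  replace hs := hs.filter_mono hU
  replace hr := hr.mono_left hU
  have hrs : ∀ᶠ i in (U : Filter ι), s i * (r i / s i) = r i := by
    filter_upwards [hs] with i hi
    field_simp
  rcases ultrafilter_trichotomy U hs with h | ⟨a, ha, h⟩ | h
  · have h2 : Tendsto r U atTop := (h.atTop_mul_pos one_pos hr).congr' hrs
    have h3 := ((tendsto_large c).2.2.comp h2).div ((tendsto_large c).2.2.comp h) (by norm_num)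
    rw [div_self (by norm_num)] at h3
    exact h3
  · have h2 : Tendsto r U (𝓝 a) := by
      have := (h.mul hr).congr' hrs
      rwa [mul_one] at this
    have hc := (continuousOn_entropySlope c).continuousAt (Ioi_mem_nhds ha)
    have h3 := (hc.tendsto.comp h2).div (hc.tendsto.comp h) (entropySlope_pos c ha).ne'
    rw [div_self (entropySlope_pos c ha).ne'] at h3
    exact h3
  · have h2 : Tendsto r U (𝓝[>] 0) := by
      rw [tendsto_nhdsWithin_iff] at h ⊢
      constructor
      · have := (h.1.mul hr).congr' hrs
        rwa [zero_mul] at this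
      · filter_upwards [hs, hrs, hr.eventually (lt_mem_nhds one_pos)] with i h1 h2 h3
        rw [← h2]
        exact mul_pos h1 h3
    have hD := tendsto_div_neg_log (tendsto_entropyDeriv_small c)
    have h3 := (hD.comp h2).div (hD.comp h) one_ne_zero
    rw [div_one] at h3
    have hlog : Tendsto (fun i => 1 - Real.log (r i / s i) / -Real.log (s i)) U (𝓝 1) := by
      have := ((hr.log one_ne_zero).div_atTop (tendsto_neg_log_small.comp h)).const_sub 1
      rwa [sub_zero] at this
    have h4 := (hr.mul hlog).mul h3
    rw [one_mul, one_mul] at h4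
    refine h4.congr' ?_
    filter_upwards [h.eventually eventually_neg_log_pos, h2.eventually eventually_neg_log_pos]
      with i h1 h2
    have hd := (entropyDeriv_pos c h1.1).ne'
    have l1 := (neg_pos.1 h1.2).ne
    have l2 := (neg_pos.1 h2.2).ne
    have s1 := h1.1.ne'
    simp only [Pi.div_apply, Function.comp_apply, entropySlope]
    rw [Real.log_div h2.1.ne' s1]
    field_simp
    ring

/-! ### Inverting the entropy to first order -/

lemma exists_entropy_sub_eq (c : WalkCase) {s p : ℝ} (hs : 0 < s) (hp : 0 < p) :
    ∃ ξ ∈ uIcc s p, entropy c p - entropy c s = entropyDeriv c ξ * (p - s) := by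
  have key {a b : ℝ} (ha : 0 < a) (hab : a < b) :
      ∃ ξ ∈ Ioo a b, entropyDeriv c ξ = (entropy c b - entropy c a) / (b - a) :=
    exists_hasDerivAt_eq_slope _ _ hab ((continuousOn_entropy c).mono fun x hx => ha.trans_le hx.1)
      fun x hx => hasDerivAt_entropy c (ha.trans hx.1)
  rcases lt_trichotomy s p with h | rfl | h
  · obtain ⟨ξ, hξ, e⟩ := key hs h
    refine ⟨ξ, uIcc_of_le h.le ▸ Ioo_subset_Icc_self hξ, ?_⟩
    rw [e, div_mul_cancel₀ _ (sub_pos.2 h).ne']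
  · exact ⟨s, left_mem_uIcc, by simp⟩
  · obtain ⟨ξ, hξ, e⟩ := key hp h
    refine ⟨ξ, uIcc_of_ge h.le ▸ Ioo_subset_Icc_self hξ, ?_⟩
    rw [e, div_mul_eq_mul_div, eq_div_iff (sub_pos.2 h).ne']
    ring

section first_order
variable {ι : Type*} {l : Filter ι}

/-- If `p ∼ s`, then `H(p) - H(s)` is asymptotically `s H'(s) (p / s - 1)`, wherever `s` is. -/
lemma exists_entropy_sub_expansion (c : WalkCase) {s p : ι → ℝ} (hs : ∀ᶠ i in l, 0 < s i)
    (hp : Tendsto (fun i => p i / s i) l (𝓝 1)) :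
    ∃ ψ : ι → ℝ, Tendsto ψ l (𝓝 1) ∧ ∀ᶠ i in l,
      entropy c (p i) - entropy c (s i) = ψ i * ((p i / s i - 1) * entropySlope c (s i)) := by
  have hp0 : ∀ᶠ i in l, 0 < p i := by
    filter_upwards [hs, hp.eventually (lt_mem_nhds one_pos)] with i h1 h2
    have := mul_pos h2 h1
    rwa [div_mul_cancel₀ _ h1.ne'] at this
  have hex (i : ι) : ∃ ξ, 0 < s i → 0 < p i → ξ ∈ uIcc (s i) (p i) ∧
      entropy c (p i) - entropy c (s i) = entropyDeriv c ξ * (p i - s i) := by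
    by_cases h : 0 < s i ∧ 0 < p i
    · obtain ⟨ξ, hξ⟩ := exists_entropy_sub_eq c h.1 h.2
      exact ⟨ξ, fun _ _ => hξ⟩
    · exact ⟨0, fun h1 h2 => absurd ⟨h1, h2⟩ h⟩
  choose ξ hξ' using hex
  have hξ : ∀ᶠ i in l, ξ i ∈ uIcc (s i) (p i) ∧
      entropy c (p i) - entropy c (s i) = entropyDeriv c (ξ i) * (p i - s i) := by
    filter_upwards [hs, hp0] with i h1 h2
    exact hξ' i h1 h2
  have hξs : Tendsto (fun i => ξ i / s i) l (𝓝 1) := by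
    have h1 : Tendsto (fun i => min 1 (p i / s i)) l (𝓝 1) := by
      simpa using (tendsto_const_nhds (x := (1 : ℝ))).min hp
    have h2 : Tendsto (fun i => max 1 (p i / s i)) l (𝓝 1) := by
      simpa using (tendsto_const_nhds (x := (1 : ℝ))).max hp
    refine tendsto_of_tendsto_of_tendsto_of_le_of_le' h1 h2 ?_ ?_
    · filter_upwards [hs, hξ] with i h1 h2
      rcases le_total (s i) (p i) with h | h
      · rw [uIcc_of_le h] at h2
        exact (min_le_left _ _).trans ((one_le_div h1).2 h2.1.1)
      · rw [uIcc_of_ge h] at h2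
        exact (min_le_right _ _).trans (div_le_div_of_nonneg_right h2.1.1 h1.le)
    · filter_upwards [hs, hξ] with i h1 h2
      rcases le_total (s i) (p i) with h | h
      · rw [uIcc_of_le h] at h2
        exact (div_le_div_of_nonneg_right h2.1.2 h1.le).trans (le_max_right _ _)
      · rw [uIcc_of_ge h] at h2
        exact ((div_le_one h1).2 h2.1.2).trans (le_max_left _ _)
  refine ⟨fun i => entropySlope c (ξ i) / entropySlope c (s i) / (ξ i / s i), ?_, ?_⟩
  · have h := (tendsto_entropySlope_ratio c hs hξs).div hξs one_ne_zero
    rwa [div_one] at h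
  · filter_upwards [hs, hp0, hξ] with i h1 h2 h3
    have hξ0 : 0 < ξ i := (lt_min h1 h2).trans_le h3.1.1
    have hd := (entropyDeriv_pos c h1).ne'
    rw [h3.2, entropySlope, entropySlope]
    field_simp

/-- Adding `w s H'(s)` to the entropy, with `w → 0`, changes the time `s` by `w s` to first
order. -/
lemma exists_entropyInv_add_expansion (c : WalkCase) {s w : ι → ℝ} (hs : ∀ᶠ i in l, 0 < s i)
    (hw : Tendsto w l (𝓝 0)) :
    (∀ᶠ i in l, 0 ≤ entropy c (s i) + w i * entropySlope c (s i)) ∧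
    Tendsto (fun i => entropyInv c (entropy c (s i) + w i * entropySlope c (s i)) / s i) l (𝓝 1) ∧
    ∃ u : ι → ℝ, Tendsto u l (𝓝 1) ∧ ∀ᶠ i in l,
      entropyInv c (entropy c (s i) + w i * entropySlope c (s i)) - s i = u i * (w i * s i) := by
  -- `√|w|` tends to zero but dominates `w`, hence `s (1 ± √|w|)` bracket the new time
  have hδ : Tendsto (fun i => √|w i|) l (𝓝 0) := by
    simpa using hw.abs.sqrt
  have hone {σ : ℝ} : Tendsto (fun i => 1 + σ * √|w i|) l (𝓝 1) := by
    simpa using (hδ.const_mul σ).const_add 1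
  have hratio {σ : ℝ} : Tendsto (fun i => s i * (1 + σ * √|w i|) / s i) l (𝓝 1) := by
    refine (hone (σ := σ)).congr' ?_
    filter_upwards [hs] with i h
    field_simp
  obtain ⟨ψ, hψ, eψ⟩ := exists_entropy_sub_expansion c hs (hratio (σ := 1))
  obtain ⟨χ, hχ, eχ⟩ := exists_entropy_sub_expansion c hs (hratio (σ := -1))
  have hbr : ∀ᶠ i in l, 0 < s i ∧ 0 ≤ s i * (1 + (-1) * √|w i|) ∧
      entropy c (s i * (1 + (-1) * √|w i|)) ≤ entropy c (s i) + w i * entropySlope c (s i) ∧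
      entropy c (s i) + w i * entropySlope c (s i) ≤ entropy c (s i * (1 + 1 * √|w i|)) := by
    have hhalf : (1 / 2 : ℝ) < 1 := by norm_num
    filter_upwards [hs, eψ, eχ, hψ.eventually (lt_mem_nhds hhalf),
      hχ.eventually (lt_mem_nhds hhalf), hδ.eventually (gt_mem_nhds (half_pos one_pos))]
      with i h1 h2 h3 h4 h5 h6
    have hθ := entropySlope_pos c h1
    have hd0 := Real.sqrt_nonneg |w i|
    have hd2 : √|w i| * √|w i| = |w i| := Real.mul_self_sqrt (abs_nonneg _)
    have e1 (σ : ℝ) : s i * (1 + σ * √|w i|) / s i - 1 = σ * √|w i| := by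
      field_simp
      ring
    rw [e1] at h2 h3
    have k1 : |w i| ≤ ψ i * √|w i| := by
      exact hd2.ge.trans (mul_le_mul_of_nonneg_right (h6.le.trans h4.le) hd0)
    have k2 : |w i| ≤ χ i * √|w i| := by
      exact hd2.ge.trans (mul_le_mul_of_nonneg_right (h6.le.trans h5.le) hd0)
    have m1 : w i * entropySlope c (s i) ≤ ψ i * √|w i| * entropySlope c (s i) :=
      mul_le_mul_of_nonneg_right ((le_abs_self _).trans k1) hθ.le
    have m2 : -(χ i * √|w i|) * entropySlope c (s i) ≤ w i * entropySlope c (s i) :=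
      mul_le_mul_of_nonneg_right ((neg_le_neg k2).trans (neg_abs_le _)) hθ.le
    refine ⟨h1, mul_nonneg h1.le (by linarith), by linarith, by linarith⟩
  have hnn : ∀ᶠ i in l, 0 ≤ entropy c (s i) + w i * entropySlope c (s i) := by
    filter_upwards [hbr] with i hi
    refine le_trans ?_ hi.2.2.1
    rw [← entropy_zero c]
    exact (strictMonoOn_entropy c).monotoneOn (mem_Ici.2 le_rfl) hi.2.1 hi.2.1
  have hlim : Tendsto
      (fun i => entropyInv c (entropy c (s i) + w i * entropySlope c (s i)) / s i) l (𝓝 1) := by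
    refine tendsto_of_tendsto_of_tendsto_of_le_of_le' (hone (σ := -1)) (hone (σ := 1)) ?_ ?_
    · filter_upwards [hbr, hnn] with i hi h0
      obtain ⟨r0, hr⟩ := entropyInv_spec c h0
      rw [← hr] at hi
      rw [le_div_iff₀ hi.1, mul_comm]
      exact ((strictMonoOn_entropy c).le_iff_le hi.2.1 r0).1 (hr ▸ hi.2.2.1)
    · filter_upwards [hbr, hnn] with i hi h0
      obtain ⟨r0, hr⟩ := entropyInv_spec c h0
      rw [div_le_iff₀ hi.1, mul_comm _ (s i)]
      refine ((strictMonoOn_entropy c).le_iff_le r0 (mem_Ici.2 ?_)).1 (hr.le.trans hi.2.2.2)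
      have := Real.sqrt_nonneg |w i|
      exact mul_nonneg hi.1.le (by linarith)
  refine ⟨hnn, hlim, ?_⟩
  obtain ⟨ρ, hρ, eρ⟩ := exists_entropy_sub_expansion c hs hlim
  refine ⟨fun i => (ρ i)⁻¹, by simpa using hρ.inv₀ one_ne_zero, ?_⟩
  filter_upwards [hs, hnn, eρ, hρ.eventually (lt_mem_nhds one_pos)] with i h1 h2 h3 h4
  have hθ := entropySlope_pos c h1
  rw [(entropyInv_spec c h2).2, add_sub_cancel_left, ← mul_assoc] at h3
  have h5 := mul_right_cancel₀ hθ.ne' h3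
  generalize entropyInv c (entropy c (s i) + w i * entropySlope c (s i)) = r at h5 ⊢
  rw [h5, ← mul_assoc, inv_mul_cancel_left₀ h4.ne']
  field_simp

end first_order

/-! ### The time change -/

/-- The walk that jumps at rate `1 / k` is the rate-one walk at time `t / k`. -/
lemma meanInfo_eq_iff (c : WalkCase) {k : ℕ} (hk : 0 < k) {h : ℝ} (hh : 0 ≤ h) (t : ℝ) :
    (0 ≤ t ∧ meanInfo c k t = h) ↔ t = k * entropyInv c h := by
  have hk' : (0 : ℝ) < k := Nat.cast_pos.2 hk
  obtain ⟨h1, h2⟩ := entropyInv_spec c hh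
  constructor
  · rintro ⟨ht, rfl⟩
    rw [meanInfo_eq c k ht, entropyInv_entropy c (by positivity)]
    field_simp
  · rintro rfl
    have h0 : 0 ≤ k * entropyInv c h := by positivity
    refine ⟨h0, ?_⟩
    rw [meanInfo_eq c k h0, mul_div_cancel_left₀ _ hk'.ne', h2]

/-- The entropic time of the rate-one walk. -/
noncomputable def unitEntropicTime (c : WalkCase) (k n : ℕ) : ℝ := entropyInv c (Real.log n / k)

lemma entropicTime_eq (c : WalkCase) {k : ℕ} (hk : 0 < k) (n : ℕ) :
    entropicTime c k n = k * unitEntropicTime c k n := by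
  have hh : 0 ≤ Real.log n / k := div_nonneg (Real.log_natCast_nonneg n) (Nat.cast_nonneg k)
  simp_rw [entropicTime, meanInfo_eq_iff c hk hh, Set.ofPred_eq_eq_singleton, csInf_singleton]
  rfl

lemma entropy_unitEntropicTime (c : WalkCase) (k n : ℕ) :
    entropy c (unitEntropicTime c k n) = Real.log n / k :=
  (entropyInv_spec c (div_nonneg (Real.log_natCast_nonneg n) (Nat.cast_nonneg k))).2

/-- The cutoff time of the rate-one walk. -/
noncomputable def unitCutoffTime (c : WalkCase) (k n : ℕ) (α : ℝ) : ℝ :=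
  entropyInv c (entropy c (unitEntropicTime c k n) +
    α * windowScale c (unitEntropicTime c k n) / √k * entropySlope c (unitEntropicTime c k n))

/-- After division by `k`, the right-hand side `(log n + α √(v k)) / k` is a perturbation of the
entropy at the entropic time, of size `α √(v / k)`. -/
lemma isCutoffTime_iff (c : WalkCase) {k n : ℕ} {α : ℝ} (hk : 0 < k)
    (hs : 0 < unitEntropicTime c k n)
    (hh : 0 ≤ entropy c (unitEntropicTime c k n) +
      α * windowScale c (unitEntropicTime c k n) / √k *
        entropySlope c (unitEntropicTime c k n)) (t : ℝ) :
    IsCutoffTime c k n α t ↔ t = k * unitCutoffTime c k n α := by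
  have hk' : (0 : ℝ) < k := Nat.cast_pos.2 hk
  rw [unitCutoffTime, ← meanInfo_eq_iff c hk hh, IsCutoffTime, entropicTime_eq c hk,
    varInfo_eq c k (by positivity), mul_div_cancel_left₀ _ hk'.ne', entropy_unitEntropicTime,
    windowScale]
  have hV := varentropy_pos c hs
  have hθ := (entropySlope_pos c hs).ne'
  have hq := Real.sqrt_pos.2 hk'
  have e : (Real.log n + α * √(varentropy c (unitEntropicTime c k n) * k)) / k =
      Real.log n / k + α * (√(varentropy c (unitEntropicTime c k n)) /
        entropySlope c (unitEntropicTime c k n)) / √k *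
        entropySlope c (unitEntropicTime c k n) := by
    rw [Real.sqrt_mul hV.le, add_div]
    congr 1
    field_simp
    rw [Real.sq_sqrt hk'.le]
  rw [e]

/-! ### Growing `k` and `n` -/

section growth
variable {k n : ℕ → ℕ}

lemma tendsto_cast_of_tendsto_log (hk : Tendsto (fun N => Real.log (k N)) atTop atTop) :
    Tendsto (fun N => (k N : ℝ)) atTop atTop := by
  refine (Real.tendsto_exp_atTop.comp hk).congr' ?_
  filter_upwards [hk.eventually_gt_atTop 0] with N hN
  refine Real.exp_log ?_
  rcases (k N).eq_zero_or_pos with h | h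
  · simp [h] at hN
  · exact Nat.cast_pos.2 h

lemma tendsto_log_div_log (hk : Tendsto (fun N => Real.log (k N)) atTop atTop)
    (hkn : (fun N => Real.log (k N)) =o[atTop] fun N => Real.log (n N)) :
    Tendsto (fun N => Real.log (n N) / Real.log (k N)) atTop atTop := by
  have h1 := hkn.tendsto_div_nhds_zero
  have h2 : ∀ᶠ N in atTop, Real.log (k N) / Real.log (n N) ∈ Ioi (0 : ℝ) := by
    filter_upwards [hk.eventually_gt_atTop 0, hkn.bound one_pos] with N h1 h2
    rw [one_mul, Real.norm_of_nonneg h1.le,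
      Real.norm_of_nonneg (Real.log_natCast_nonneg _)] at h2
    exact div_pos h1 (h1.trans_le h2)
  refine ((tendsto_nhdsWithin_iff.2 ⟨h1, h2⟩).inv_tendsto_nhdsGT_zero).congr fun N => ?_
  simp

lemma tendsto_log_of_isLittleO (hk : Tendsto (fun N => Real.log (k N)) atTop atTop)
    (hkn : (fun N => Real.log (k N)) =o[atTop] fun N => Real.log (n N)) :
    Tendsto (fun N => Real.log (n N)) atTop atTop := by
  refine ((tendsto_log_div_log hk hkn).atTop_mul_atTop₀ hk).congr' ?_
  filter_upwards [hk.eventually_gt_atTop 0] with N hN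
  field_simp

lemma eventually_unitEntropicTime_pos (c : WalkCase)
    (hk : Tendsto (fun N => Real.log (k N)) atTop atTop)
    (hkn : (fun N => Real.log (k N)) =o[atTop] fun N => Real.log (n N)) :
    ∀ᶠ N in atTop, 0 < unitEntropicTime c (k N) (n N) := by
  filter_upwards [(tendsto_cast_of_tendsto_log hk).eventually_gt_atTop 0,
    (tendsto_log_of_isLittleO hk hkn).eventually_gt_atTop 0] with N h1 h2
  exact entropyInv_pos c (div_pos h2 h1)

/-- The entropic time tends to infinity. This is where `log k ≪ log n` is needed: at small times
`s` the entropy is about `s log (1 / s)`, so `k s` is about `log n / log (1 / s)`. -/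
lemma tendsto_mul_unitEntropicTime (c : WalkCase)
    (hk : Tendsto (fun N => Real.log (k N)) atTop atTop)
    (hkn : (fun N => Real.log (k N)) =o[atTop] fun N => Real.log (n N)) :
    Tendsto (fun N => (k N : ℝ) * unitEntropicTime c (k N) (n N)) atTop atTop := by
  have hkr := tendsto_cast_of_tendsto_log hk
  have hn := tendsto_log_of_isLittleO hk hkn
  have hs := eventually_unitEntropicTime_pos c hk hkn
  rw [tendsto_iff_ultrafilter]
  intro U hU
  rcases ultrafilter_trichotomy U (hs.filter_mono hU) with h | ⟨a, ha, h⟩ | h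
  · exact (hkr.mono_left hU).atTop_mul_atTop₀ h
  · exact (hkr.mono_left hU).atTop_mul_pos ha h
  · have h1 := (tendsto_log_div_log hk hkn).mono_left hU
    refine tendsto_atTop_mono' _ ?_ (h1.atTop_div_const (show (0 : ℝ) < 4 by norm_num))
    have hA := (tendsto_entropy_div_small c).comp h
    have hB := (tendsto_entropy_sq_div_small c).comp h
    filter_upwards [hA.eventually (gt_mem_nhds one_lt_two), hB.eventually (gt_mem_nhds one_pos),
      h.eventually eventually_neg_log_pos, (hkr.eventually_gt_atTop 0).filter_mono hU,
      (hk.eventually_gt_atTop 0).filter_mono hU, (hn.eventually_ge_atTop 1).filter_mono hU]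
      with N g1 g2 g3 g4 g5 g6
    simp only [Function.comp_apply] at g1 g2
    set s := unitEntropicTime c (k N) (n N) with hsdef
    have hH : entropy c s = Real.log (n N) / k N := entropy_unitEntropicTime c _ _
    rw [div_lt_iff₀ g3.2, div_lt_iff₀ g3.1] at g1
    rw [div_lt_iff₀ g3.1, one_mul] at g2
    -- `H(s)² ≤ s` and `H(s) ≥ 1 / k`
    have hlog : -Real.log s ≤ 2 * Real.log (k N) := by
      have h2 : 1 / (k N : ℝ) ^ 2 ≤ s := by
        refine le_trans ?_ g2.le
        rw [hH, div_pow]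
        exact div_le_div_of_nonneg_right (one_le_pow₀ g6) (by positivity)
      have h3 := Real.log_le_log (by positivity) h2
      rw [one_div, Real.log_inv, Real.log_pow] at h3
      push_cast at h3
      linarith
    rw [div_div, div_le_iff₀ (by positivity)]
    rw [hH, div_lt_iff₀ g4] at g1
    refine g1.le.trans ?_
    have h4 : 0 ≤ s * k N := mul_nonneg g3.1.le g4.le
    nlinarith [mul_le_mul_of_nonneg_right hlog h4]

/-- The window is short relative to the entropic time. -/
lemma tendsto_windowScale_div_sqrt (c : WalkCase)
    (hk : Tendsto (fun N => Real.log (k N)) atTop atTop)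
    (hkn : (fun N => Real.log (k N)) =o[atTop] fun N => Real.log (n N)) :
    Tendsto (fun N => windowScale c (unitEntropicTime c (k N) (n N)) / √(k N : ℝ)) atTop
      (𝓝 0) := by
  have hkr := tendsto_cast_of_tendsto_log hk
  have hkq := Real.tendsto_sqrt_atTop.comp hkr
  have hs := eventually_unitEntropicTime_pos c hk hkn
  rw [tendsto_iff_ultrafilter]
  intro U hU
  rcases ultrafilter_trichotomy U (hs.filter_mono hU) with h | ⟨a, ha, h⟩ | h
  · exact ((tendsto_windowScale_atTop c).comp h).div_atTop (hkq.mono_left hU)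
  · exact (((continuousOn_windowScale c).continuousAt (Ioi_mem_nhds ha)).tendsto.comp h).div_atTop
      (hkq.mono_left hU)
  · have h1 := ((tendsto_windowScale_mul_sqrt c).comp h).div_atTop
      ((Real.tendsto_sqrt_atTop.comp (tendsto_mul_unitEntropicTime c hk hkn)).mono_left hU)
    refine h1.congr' ?_
    filter_upwards [hs.filter_mono hU, (hkr.eventually_gt_atTop 0).filter_mono hU] with N h2 h3
    have := Real.sqrt_pos.2 h2
    simp only [Function.comp_apply]
    rw [Real.sqrt_mul h3.le]
    field_simp

/-- The cutoff time exists and is unique, and its distance from the entropic time is of order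
`windowScale / √k` relative to the latter. -/
lemma cutoffTime_expansion (c : WalkCase)
    (hk : Tendsto (fun N => Real.log (k N)) atTop atTop)
    (hkn : (fun N => Real.log (k N)) =o[atTop] fun N => Real.log (n N)) (α : ℝ) :
    (∀ᶠ N in atTop, IsCutoffTime c (k N) (n N) α (cutoffTime c (k N) (n N) α) ∧
      ∀ t : ℝ, IsCutoffTime c (k N) (n N) α t → t = cutoffTime c (k N) (n N) α) ∧
    ((fun N => cutoffTime c (k N) (n N) α) ~[atTop] fun N => entropicTime c (k N) (n N)) ∧
    ((fun N => cutoffTime c (k N) (n N) α - entropicTime c (k N) (n N)) ~[atTop]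
      fun N => windowScale c (unitEntropicTime c (k N) (n N)) *
        (α * entropicTime c (k N) (n N) / √(k N : ℝ))) := by
  have hk0 : ∀ᶠ N in atTop, 0 < k N := by
    filter_upwards [(tendsto_cast_of_tendsto_log hk).eventually_gt_atTop 0] with N hN
    exact Nat.cast_pos.1 hN
  have hs := eventually_unitEntropicTime_pos c hk hkn
  have hw : Tendsto (fun N => α * windowScale c (unitEntropicTime c (k N) (n N)) / √(k N : ℝ))
      atTop (𝓝 0) := by
    have := (tendsto_windowScale_div_sqrt c hk hkn).const_mul α
    rw [mul_zero] at this
    exact this.congr fun N => (mul_div_assoc _ _ _).symm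
  obtain ⟨hnn, hr, u, hu, hue⟩ := exists_entropyInv_add_expansion c hs hw
  have hiff : ∀ᶠ N in atTop, 0 < k N ∧ 0 < unitEntropicTime c (k N) (n N) ∧
      ∀ t, IsCutoffTime c (k N) (n N) α t ↔ t = k N * unitCutoffTime c (k N) (n N) α := by
    filter_upwards [hk0, hs, hnn] with N h1 h2 h3
    exact ⟨h1, h2, isCutoffTime_iff c h1 h2 h3⟩
  have hcut : ∀ᶠ N in atTop, cutoffTime c (k N) (n N) α = k N * unitCutoffTime c (k N) (n N) α := by
    filter_upwards [hiff] with N h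
    simp_rw [cutoffTime, h.2.2, Set.ofPred_eq_eq_singleton, csInf_singleton]
  refine ⟨?_, ?_, ?_⟩
  · filter_upwards [hiff, hcut] with N h1 h2
    rw [h2]
    exact ⟨(h1.2.2 _).2 rfl, fun t ht => (h1.2.2 t).1 ht⟩
  · rw [isEquivalent_iff_exists_eq_mul]
    refine ⟨_, hr, ?_⟩
    filter_upwards [hiff, hcut] with N h1 h2
    have := h1.2.1.ne'
    rw [h2, Pi.mul_apply, entropicTime_eq c h1.1, unitCutoffTime]
    field_simp
  · rw [isEquivalent_iff_exists_eq_mul]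
    refine ⟨u, hu, ?_⟩
    filter_upwards [hiff, hcut, hue] with N h1 h2 h3
    rw [Pi.mul_apply, h2, entropicTime_eq c h1.1, ← mul_sub, unitCutoffTime, h3]
    ring

end growth

/-! ### The three regimes -/

section regimes
variable {k n : ℕ → ℕ}

lemma entropicTime_isEquivalent (c : WalkCase)
    (hk : Tendsto (fun N => Real.log (k N)) atTop atTop) {p : ℕ → ℝ}
    (hp : (fun N => unitEntropicTime c (k N) (n N)) ~[atTop] p) :
    (fun N => entropicTime c (k N) (n N)) ~[atTop] fun N => (k N : ℝ) * p N := by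
  have h : (fun N => entropicTime c (k N) (n N)) =ᶠ[atTop]
      fun N => (k N : ℝ) * unitEntropicTime c (k N) (n N) := by
    filter_upwards [(tendsto_cast_of_tendsto_log hk).eventually_gt_atTop 0] with N hN
    exact entropicTime_eq c (Nat.cast_pos.1 hN) _
  exact h.isEquivalent.trans (IsEquivalent.refl.mul hp)

/-- Inversion of `H(s) = log (2 π e s) / 2 + o(1)`. -/
lemma unitEntropicTime_isEquivalent_of_isLittleO (c : WalkCase)
    (hk : Tendsto (fun N => Real.log (k N)) atTop atTop)
    (hkn : (fun N => Real.log (k N)) =o[atTop] fun N => Real.log (n N))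
    (hr : (fun N => (k N : ℝ)) =o[atTop] fun N => Real.log (n N)) :
    Tendsto (fun N => unitEntropicTime c (k N) (n N)) atTop atTop ∧
    (fun N => unitEntropicTime c (k N) (n N)) ~[atTop]
      fun N => (n N : ℝ) ^ (2 / (k N : ℝ)) / (2 * Real.pi * Real.exp 1) := by
  have hkr := tendsto_cast_of_tendsto_log hk
  have hn := tendsto_log_of_isLittleO hk hkn
  have hs := eventually_unitEntropicTime_pos c hk hkn
  have hH : Tendsto (fun N => Real.log (n N) / (k N : ℝ)) atTop atTop := by
    have h2 : ∀ᶠ N in atTop, (k N : ℝ) / Real.log (n N) ∈ Ioi (0 : ℝ) := by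
      filter_upwards [hkr.eventually_gt_atTop 0, hn.eventually_gt_atTop 0] with N h1 h2
      exact div_pos h1 h2
    refine ((tendsto_nhdsWithin_iff.2 ⟨hr.tendsto_div_nhds_zero, h2⟩).inv_tendsto_nhdsGT_zero).congr
      fun N => ?_
    simp
  have hst : Tendsto (fun N => unitEntropicTime c (k N) (n N)) atTop atTop := by
    refine tendsto_atTop_of_tendsto_entropy c (hs.mono fun _ h => h.le) ?_
    simpa only [entropy_unitEntropicTime] using hH
  refine ⟨hst, ?_⟩
  have h1 := (((tendsto_large c).1.comp hst).const_sub (1 / 2)).const_mul 2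
  rw [sub_self, mul_zero] at h1
  rw [isEquivalent_iff_exists_eq_mul]
  refine ⟨_, by simpa using (Real.continuous_exp.tendsto _).comp h1, ?_⟩
  filter_upwards [hs, hn.eventually_gt_atTop 0] with N h2 h3
  have hn0 : (0 : ℝ) < n N := by
    rcases (n N).eq_zero_or_pos with h | h
    · simp [h] at h3
    · exact Nat.cast_pos.2 h
  simp only [Pi.mul_apply, Function.comp_apply, entropy_unitEntropicTime]
  have hd : 2 * Real.pi * Real.exp 1 = Real.exp (Real.log (2 * Real.pi) + 1) := by
    rw [Real.exp_add, Real.exp_log (by positivity)]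
  -- both sides are exponentials, as `log s = 2 H(s) - log (2 π e) + o(1)`
  rw [Real.rpow_def_of_pos hn0, hd, ← Real.exp_sub, ← Real.exp_add,
    Real.log_mul (by positivity) h2.ne']
  conv_lhs => rw [← Real.exp_log h2]
  congr 1
  ring

lemma tendsto_unitEntropicTime_of_isEquivalent (c : WalkCase)
    (hk : Tendsto (fun N => Real.log (k N)) atTop atTop)
    (hkn : (fun N => Real.log (k N)) =o[atTop] fun N => Real.log (n N)) {l : ℝ} (hl : 0 < l)
    (hr : (fun N => (k N : ℝ)) ~[atTop] fun N => l * Real.log (n N)) :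
    Tendsto (fun N => unitEntropicTime c (k N) (n N)) atTop (𝓝 (entropyInv c (1 / l))) := by
  have hn := tendsto_log_of_isLittleO hk hkn
  have hs := eventually_unitEntropicTime_pos c hk hkn
  have hl' : 0 < 1 / l := by positivity
  refine tendsto_of_tendsto_entropy c (hs.mono fun _ h => h.le) (entropyInv_pos c hl') ?_
  rw [(entropyInv_spec c hl'.le).2]
  simp only [entropy_unitEntropicTime]
  have hne : ∀ᶠ N in atTop, l * Real.log (n N) ≠ 0 := by
    filter_upwards [hn.eventually_gt_atTop 0] with N h
    positivity
  have h1 := (((isEquivalent_iff_tendsto_one hne).1 hr).inv₀ one_ne_zero).const_mul (1 / l)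
  rw [inv_one, mul_one] at h1
  refine h1.congr fun N => ?_
  simp only [Pi.div_apply, inv_div]
  field_simp

/-- Inversion of `H(s) ∼ s log (1 / s)`, where `H(s) = 1 / κ`. -/
lemma unitEntropicTime_isEquivalent_of_isLittleO_log (c : WalkCase)
    (hk : Tendsto (fun N => Real.log (k N)) atTop atTop)
    (hkn : (fun N => Real.log (k N)) =o[atTop] fun N => Real.log (n N))
    (hr : (fun N => Real.log (n N)) =o[atTop] fun N => (k N : ℝ)) {κ : ℕ → ℝ}
    (hκ : ∀ N, κ N = (k N : ℝ) / Real.log (n N)) :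
    ((fun N => unitEntropicTime c (k N) (n N)) ~[atTop] fun N => 1 / (κ N * Real.log (κ N))) ∧
    (fun N => windowScale c (unitEntropicTime c (k N) (n N))) ~[atTop]
      fun N => √(κ N * Real.log (κ N)) := by
  have hkr := tendsto_cast_of_tendsto_log hk
  have hn := tendsto_log_of_isLittleO hk hkn
  have hs := eventually_unitEntropicTime_pos c hk hkn
  have hst : Tendsto (fun N => unitEntropicTime c (k N) (n N)) atTop (𝓝[>] 0) := by
    refine tendsto_zero_of_tendsto_entropy c hs ?_
    simpa only [entropy_unitEntropicTime] using hr.tendsto_div_nhds_zero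
  have hκinv (N : ℕ) : entropy c (unitEntropicTime c (k N) (n N)) = (κ N)⁻¹ := by
    rw [entropy_unitEntropicTime, hκ, inv_div]
  have hκ0 : ∀ᶠ N in atTop, 0 < κ N * Real.log (κ N) := by
    have h1 : ∀ᶠ N in atTop, Real.log (n N) / (k N : ℝ) < 1 :=
      hr.tendsto_div_nhds_zero.eventually (gt_mem_nhds one_pos)
    filter_upwards [hkr.eventually_gt_atTop 0, hn.eventually_gt_atTop 0, h1] with N g1 g2 g3
    have : 1 < κ N := by
      rw [hκ, one_lt_div g2]
      rwa [div_lt_one g1] at g3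
    exact mul_pos (one_pos.trans this) (Real.log_pos this)
  have h1 : Tendsto (fun N => unitEntropicTime c (k N) (n N) * (κ N * Real.log (κ N))) atTop
      (𝓝 1) := by
    refine ((tendsto_mul_log_entropy_div c).comp hst).congr fun N => ?_
    simp only [Function.comp_apply, hκinv, Real.log_inv, neg_neg, div_inv_eq_mul]
    ring
  constructor
  · rw [isEquivalent_iff_exists_eq_mul]
    refine ⟨_, h1, ?_⟩
    filter_upwards [hκ0] with N h2
    rw [Pi.mul_apply, mul_assoc, mul_one_div_cancel h2.ne', mul_one]
  · rw [isEquivalent_iff_exists_eq_mul]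
    have h2 := ((tendsto_windowScale_mul_sqrt c).comp hst).div h1.sqrt (by simp)
    rw [Real.sqrt_one, div_one] at h2
    refine ⟨_, h2, ?_⟩
    filter_upwards [hs, hκ0] with N h3 h4
    have h5 := Real.sqrt_pos.2 h3
    have h6 := Real.sqrt_pos.2 h4
    simp only [Pi.mul_apply, Pi.div_apply, Function.comp_apply]
    rw [Real.sqrt_mul h3.le]
    field_simp

end regimes

/-! ### The two limiting functions -/

/-- In the regime `k ∼ l log n`, the limit of `t₀ / k`. -/
noncomputable def timeLimit (c : WalkCase) (l : ℝ) : ℝ := entropyInv c (1 / l)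

/-- In the regime `k ∼ l log n`, the limit of `(t_α - t₀) √k / (α t₀)`. -/
noncomputable def windowLimit (c : WalkCase) (l : ℝ) : ℝ := windowScale c (timeLimit c l)

lemma timeLimit_pos (c : WalkCase) {l : ℝ} (hl : 0 < l) : 0 < timeLimit c l :=
  entropyInv_pos c (by positivity)

lemma continuousOn_timeLimit (c : WalkCase) : ContinuousOn (timeLimit c) (Ioi 0) := by
  refine (continuousOn_entropyInv c).comp (f := fun l : ℝ => 1 / l) ?_
    fun l hl => mem_Ioi.2 (one_div_pos.2 hl)
  exact continuousOn_const.div continuousOn_id fun l hl => (ne_of_gt hl)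

lemma continuousOn_windowLimit (c : WalkCase) : ContinuousOn (windowLimit c) (Ioi 0) :=
  (continuousOn_windowScale c).comp (continuousOn_timeLimit c) fun _ hl => timeLimit_pos c hl

lemma entropy_timeLimit (c : WalkCase) {l : ℝ} (hl : 0 < l) : entropy c (timeLimit c l) = 1 / l :=
  (entropyInv_spec c (by positivity)).2

lemma tendsto_timeLimit_atTop (c : WalkCase) : Tendsto (timeLimit c) atTop (𝓝[>] 0) := by
  refine tendsto_zero_of_tendsto_entropy c ?_ ?_
  · filter_upwards [eventually_gt_atTop 0] with l hl
    exact timeLimit_pos c hl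
  · refine (tendsto_const_nhds (x := (1 : ℝ)).div_atTop tendsto_id).congr' ?_
    filter_upwards [eventually_gt_atTop 0] with l hl
    exact (entropy_timeLimit c hl).symm

lemma jumpEntropy_ne : 1 + jumpEntropy .undirected ≠ 1 + jumpEntropy .directed := by
  have := Real.log_pos one_lt_two
  simp only [jumpEntropy]
  linarith

/-- The two time limits differ, because the entropies differ at small times by the entropy of the
sign of a jump. -/
lemma exists_timeLimit_ne : ∃ l : ℝ, 0 < l ∧ timeLimit .undirected l ≠ timeLimit .directed l := by
  by_contra! h
  refine jumpEntropy_ne (tendsto_nhds_unique (tendsto_entropy_small .undirected)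
    ((tendsto_entropy_small .directed).congr' ?_))
  filter_upwards [self_mem_nhdsWithin] with s hs
  have hs' : (0 : ℝ) < s := hs
  have hH := entropy_pos .undirected hs'
  have h1 := h _ (one_div_pos.2 hH)
  rw [timeLimit, timeLimit, one_div_one_div, entropyInv_entropy _ hs'.le] at h1
  have h2 := (entropyInv_spec .directed hH.le).2
  rw [← h1] at h2
  rw [h2]

/-- The two window limits differ: as `l → ∞`, `windowLimit² / l - 2 log windowLimit` tends to one
plus the entropy of the sign of a jump. -/
lemma exists_windowLimit_ne :
    ∃ l : ℝ, 0 < l ∧ windowLimit .undirected l ≠ windowLimit .directed l := by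
  by_contra! h
  have key (c : WalkCase) := (tendsto_entropy_windowScale c).comp (tendsto_timeLimit_atTop c)
  refine jumpEntropy_ne (tendsto_nhds_unique (key .undirected) ((key .directed).congr' ?_))
  filter_upwards [eventually_gt_atTop 0] with l hl
  have h1 := h l hl
  simp only [windowLimit] at h1
  simp only [Function.comp_apply, entropy_timeLimit _ hl, h1]

end EntropicTimes

theorem mainTheorem3 :
    -- `Q₁(t)` is square integrable, so that its mean and variance are genuine
    (∀ (c : WalkCase) (k : ℕ) (t : ℝ), 0 < k → 0 ≤ t →
      MemLp (infoContent c k t) 2 (coordLaw c k t)) ∧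
    ∃ f g : WalkCase → ℝ → ℝ,
      (∀ c : WalkCase,
        ContinuousOn (f c) (Ioi 0) ∧ MapsTo (f c) (Ioi 0) (Ioi 0) ∧
        ContinuousOn (g c) (Ioi 0) ∧ MapsTo (g c) (Ioi 0) (Ioi 0)) ∧
      (∃ l : ℝ, 0 < l ∧ f .undirected l ≠ f .directed l) ∧
      (∃ l : ℝ, 0 < l ∧ g .undirected l ≠ g .directed l) ∧
      ∀ (c : WalkCase) (k n : ℕ → ℕ),
        Tendsto (fun N => Real.log (k N)) atTop atTop →
        ((fun N => Real.log (k N)) =o[atTop] fun N => Real.log (n N)) →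
        ∀ α : ℝ,
          -- the cutoff time is well defined
          (∀ᶠ N in atTop, IsCutoffTime c (k N) (n N) α (cutoffTime c (k N) (n N) α) ∧
            ∀ t : ℝ, IsCutoffTime c (k N) (n N) α t → t = cutoffTime c (k N) (n N) α) ∧
          -- in all cases
          ((fun N => cutoffTime c (k N) (n N) α) ~[atTop]
            fun N => entropicTime c (k N) (n N)) ∧
          -- the regime `k ≪ log n`
          (((fun N => (k N : ℝ)) =o[atTop] fun N => Real.log (n N)) →
            ((fun N => entropicTime c (k N) (n N)) ~[atTop]
              fun N => (k N : ℝ) * (n N : ℝ) ^ (2 / (k N : ℝ)) / (2 * Real.pi * Real.exp 1)) ∧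
            ((fun N => cutoffTime c (k N) (n N) α - entropicTime c (k N) (n N)) ~[atTop]
              fun N => √2 * (α * entropicTime c (k N) (n N) / √(k N : ℝ)))) ∧
          -- the regime `k ≂ l log n`
          (∀ l : ℝ, 0 < l →
            ((fun N => (k N : ℝ)) ~[atTop] fun N => l * Real.log (n N)) →
            ((fun N => entropicTime c (k N) (n N)) ~[atTop] fun N => (k N : ℝ) * f c l) ∧
            ((fun N => cutoffTime c (k N) (n N) α - entropicTime c (k N) (n N)) ~[atTop]
              fun N => g c l * (α * entropicTime c (k N) (n N) / √(k N : ℝ)))) ∧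
          -- the regime `k ≫ log n`, with `κ = k / log n`
          (((fun N => Real.log (n N)) =o[atTop] fun N => (k N : ℝ)) →
            ∀ κ : ℕ → ℝ, (∀ N, κ N = (k N : ℝ) / Real.log (n N)) →
            ((fun N => entropicTime c (k N) (n N)) ~[atTop]
              fun N => (k N : ℝ) * (1 / (κ N * Real.log (κ N)))) ∧
            ((fun N => cutoffTime c (k N) (n N) α - entropicTime c (k N) (n N)) ~[atTop]
              fun N => √(κ N * Real.log (κ N)) *
                (α * entropicTime c (k N) (n N) / √(k N : ℝ)))) := by
  refine ⟨fun c k t _ ht => memLp_infoContent c k ht, timeLimit, windowLimit, fun c =>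
    ⟨continuousOn_timeLimit c, fun l hl => timeLimit_pos c hl, continuousOn_windowLimit c,
      fun l hl => windowScale_pos c (timeLimit_pos c hl)⟩,
    exists_timeLimit_ne, exists_windowLimit_ne, fun c k n hk hkn α => ?_⟩
  obtain ⟨h1, h2, h3⟩ := cutoffTime_expansion c hk hkn α
  refine ⟨h1, h2, fun hr => ?_, fun l hl hr => ?_, fun hr κ hκ => ?_⟩
  · obtain ⟨h4, h5⟩ := unitEntropicTime_isEquivalent_of_isLittleO c hk hkn hr
    have h6 := (isEquivalent_const_iff_tendsto (by positivity)).2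
      ((tendsto_windowScale_atTop c).comp h4)
    refine ⟨?_, h3.trans (h6.mul IsEquivalent.refl)⟩
    simp_rw [mul_div_assoc]
    exact entropicTime_isEquivalent c hk h5
  · have h4 := tendsto_unitEntropicTime_of_isEquivalent c hk hkn hl hr
    have hf := timeLimit_pos c hl
    have h5 := (isEquivalent_const_iff_tendsto hf.ne').2 h4
    have h6 := (isEquivalent_const_iff_tendsto (windowScale_pos c hf).ne').2
      (((continuousOn_windowScale c).continuousAt (Ioi_mem_nhds hf)).tendsto.comp h4)
    exact ⟨entropicTime_isEquivalent c hk h5, h3.trans (h6.mul IsEquivalent.refl)⟩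
  · obtain ⟨h4, h5⟩ := unitEntropicTime_isEquivalent_of_isLittleO_log c hk hkn hr hκ
    exact ⟨entropicTime_isEquivalent c hk h4, h3.trans (h5.mul IsEquivalent.refl)⟩
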